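/- Write $\lg=\log_2$. A deterministic generic group algorithm is a deterministic algorithm that accesses a group only through a black box: elements are represented by arbitrarily assigned unique identifiers, and the algorithm may request products and inverses; its cost is the number of group operations (multiplications and inversions). A basis of a finite abelian group $G$ is a vector $(\alpha_1,\dots,\alpha_k)$ in $G$ such that every $\beta\in G$ can be written uniquely as $\beta=\alpha_1^{x_1}\cdots\alpha_k^{x_k}$ with $0\le x_i<|\alpha_i|$. There are a deterministic generic algorithm and an absolute constant $c$ such that the following holds. Let $p$ be a prime, let $G$ be an abelian group of size $p^n$, exponent $p^m$ and rank $r$ (the minimal number of generators), and let $S\subseteq G$ be a generating set of $G$. Given $p$ and the identifiers of $1_G$ and of the elements of $S$ (in any order), the algorithm computes a basis of $G$ without trivial entries, using at most $$c\left(\frac{r\lg(m+1)}{\lg\lg(m+2)}\,\lg|G|+\frac nr\,p^{(r-1)/2}+\bigl(|S|-r\bigr)\,T_{\mathrm{DL}}(G)\right)$$ group operations, where $$T_{\mathrm{DL}}(G)=\sum_{i=1}^r\frac{\lg(n_i+1)}{\lg\lg(n_i+2)}\,\lg|\alpha_i|+\sum_{j=0}^{m-1}p^{r_j/2}$$ for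 any basis $(\alpha_1,\dots,\alpha_r)$ of $G$ of length $r$, with $n_i=\log_p|\alpha_i|$ and $r_j$ the rank of the subgroup of $p^j$-th powers in $G$. (For trivial $G$ the three terms are read as $0$.) -/

import Mathlib

/-- What a generic algorithm may do next: halt with an output list of identifiers, ask the black box
for a product, ask it for an inverse, or perform a step that does not involve the black box. -/
abbrev Instruction : Type := List ℕ ⊕ (ℕ × ℕ) ⊕ ℕ ⊕ Unit

abbrev Instruction.halt (out : List ℕ) : Instruction := Sum.inl out

abbrev Instruction.mul (a b : ℕ) : Instruction := Sum.inr (Sum.inl (a, b))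

abbrev Instruction.inv (a : ℕ) : Instruction := Sum.inr (Sum.inr (Sum.inl a))

abbrev Instruction.internal : Instruction := Sum.inr (Sum.inr (Sum.inr ()))

/-- A deterministic generic group algorithm for `p`-groups. It works with identifiers (natural
numbers) of group elements and reaches the group only through a black box. Its input is the prime
`p`, the identifier of the identity element and a list of identifiers. In each state the algorithm
names its next instruction, and it moves to a new state depending on the black box's answer (the
answer is `0` for an internal step). All the local computations have to be computable. -/
structure GenericAlgorithm where
  State : Type
  [primcodable : Primcodable State]
  start : ℕ × ℕ × List ℕ → State
  next : State → Instruction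
  resume : State × ℕ → State
  start_computable : Computable start
  next_computable : Computable next
  resume_computable : Computable resume

/-- `A.Runs ident s t out`: started in state `s`, with a black box for `G` that uses the identifiers
`ident`, the algorithm halts with output `out` after exactly `t` group operations, where every
multiplication and every inversion counts as one operation. A query about a number that identifies
no element gets no answer, so that such a computation never halts. -/
inductive GenericAlgorithm.Runs (A : GenericAlgorithm) {G : Type*} [Group G] (ident : G → ℕ) :
    A.State → ℕ → List ℕ → Prop
  | halt {s : A.State} {out : List ℕ} (h : A.next s = Instruction.halt out) :
      A.Runs ident s 0 out
  | mul {s : A.State} {t : ℕ} {out : List ℕ} (g g' : G)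
      (h : A.next s = Instruction.mul (ident g) (ident g'))
      (hr : A.Runs ident (A.resume (s, ident (g * g'))) t out) : A.Runs ident s (t + 1) out
  | inv {s : A.State} {t : ℕ} {out : List ℕ} (g : G)
      (h : A.next s = Instruction.inv (ident g))
      (hr : A.Runs ident (A.resume (s, ident g⁻¹)) t out) : A.Runs ident s (t + 1) out
  | internal {s : A.State} {t : ℕ} {out : List ℕ}
      (h : A.next s = Instruction.internal)
      (hr : A.Runs ident (A.resume (s, 0)) t out) : A.Runs ident s t out

/-- `α` is a basis of the finite abelian group `G`: every element of `G` can be written uniquely as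
`α₁ ^ x₁ ⋯ αₖ ^ xₖ` with `0 ≤ xᵢ < |αᵢ|`. -/
def IsGroupBasis {G : Type*} [CommGroup G] {k : ℕ} (α : Fin k → G) : Prop :=
  ∀ β : G, ∃! x : Fin k → ℕ, (∀ i, x i < orderOf (α i)) ∧ ∏ i, α i ^ x i = β

/-- The binary logarithm. -/
noncomputable def lg (x : ℝ) : ℝ := Real.logb 2 x

/-- The rank (minimal number of generators) of the subgroup of `p ^ j`-th powers in `G`. -/
noncomputable def powRank (G : Type*) [CommGroup G] [Finite G] (p j : ℕ) : ℕ :=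
  Group.rank (powMonoidHom (p ^ j) : G →* G).range

/-- The discrete logarithm bound for an abelian `p`-group `G` of exponent `p ^ m` with basis `α`,
where `|αᵢ| = p ^ nᵢ`: the sum over `i` of `lg (nᵢ + 1) / lg (lg (nᵢ + 2)) * lg |αᵢ|`, plus
the sum of `p ^ (rⱼ / 2)` over `0 ≤ j < m`, with `rⱼ` the rank of the subgroup of `p ^ j`-th
powers. -/
noncomputable def TDL {G : Type*} [CommGroup G] [Finite G] (p m : ℕ) {k : ℕ} (α : Fin k → G) : ℝ :=
  (∑ i, lg (Nat.log p (orderOf (α i)) + 1) / lg (lg (Nat.log p (orderOf (α i)) + 2)) *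
      lg (orderOf (α i))) +
    ∑ j ∈ Finset.range m, (p : ℝ) ^ ((powRank G p j : ℝ) / 2)

-- The generators are added one at a time to an independent family `α i` of orders `p ^ n i`. For a
-- new element `g`, the algorithm finds the least `d` for which `g ^ p ^ d` lies in the span of the
-- family, together with a relation `g ^ p ^ d * ∏ i, α i ^ x i = 1` (`spec_findRelation`). This
-- relation and the orders of the `α i` span all relations. A row reduction of this relation matrix,
-- carried out on the group elements at the same time, gives an independent family for the larger
-- group (`spec_extendBasis`). The family never gets shorter, and an independent family of
-- nontrivial elements has at most `r` members (`IsIndependent.le_rank`). So exactly `r` steps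
-- lengthen it, one for each length `s < r`, and the remaining `|S| - r` steps are charged to `TDL`.
--
-- Relations are found digit by digit, as in the Pohlig-Hellman method. At position `j` the next
-- digits solve an equation in the group spanned by the `α i ^ p ^ (n i - 1)` with `j < n i`; with
-- `ρ` such elements a baby-step giant-step search costs `O(p ^ (ρ / 2))` (`spec_searchBox`). A
-- failing search shows that `g ^ p ^ d` is not in the span, and `d` increases. Between the searches
-- one needs, for each `α i` of order `p ^ ℓ`, the powers with exponents `p ^ (ℓ - 1 - t) * (X % p ^
-- t)`, where the digits of `X` become known one after the other. They are computed along a tree of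
-- blocks of positions with branching number `w` about `lg ℓ`. Passing from a block to a child is a
-- simultaneous exponentiation, and its subset sums are shared by all blocks of a level except
-- possibly the last. Each of the roughly `lg ℓ / lg lg ℓ` levels then costs `O(ℓ lg p)`. Since
-- computed powers are kept in a table, the cost is a number of distinct exponents
-- (`card_onlineSet_le`).
--
-- For the final bound, the number of `i` with `j < n i` is at most the rank of the group of `p ^
-- j`-th powers (`IsIndependent.rankAbove_le`), which bounds every step by `TDL`
-- (`IsStep.stepCost_le_TDL`). In a step that lengthens a family of length `s`, the estimate `√p ^ ρ
-- ≤ 3 * ρ * √p ^ s / s` and the fact that the numbers `ρ` of all positions add up to at most `n`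
-- bound the searches by a multiple of `n * √p ^ s / s` (`IsStep.stepCost_le_of_lt_rank`). The sum
-- over `s < r` is almost geometric (`sum_pow_sqrt_div_le`).

attribute [fun_prop] Primrec

/-! ### Closure rules for primitive recursive functions. -/

namespace PrimrecRules

variable {α β γ σ : Type*} [Primcodable α] [Primcodable β] [Primcodable γ] [Primcodable σ]

@[fun_prop] theorem id : Primrec (fun x : α => x) := Primrec.id

@[fun_prop] theorem const (c : β) : Primrec (fun _ : α => c) := Primrec.const c

@[fun_prop] theorem comp {f : β → γ} {g : α → β} (hf : Primrec f) (hg : Primrec g) :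
    Primrec (fun x => f (g x)) := hf.comp hg

@[fun_prop] theorem fst {f : α → β × γ} (hf : Primrec f) : Primrec fun x => (f x).1 :=
  Primrec.fst.comp hf

@[fun_prop] theorem snd {f : α → β × γ} (hf : Primrec f) : Primrec fun x => (f x).2 :=
  Primrec.snd.comp hf

@[fun_prop] theorem pair {f : α → β} {g : α → γ} (hf : Primrec f) (hg : Primrec g) :
    Primrec fun x => (f x, g x) := hf.pair hg

@[fun_prop] theorem add {f g : α → ℕ} (hf : Primrec f) (hg : Primrec g) :
    Primrec fun x => f x + g x := Primrec.nat_add.comp hf hg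

@[fun_prop] theorem sub {f g : α → ℕ} (hf : Primrec f) (hg : Primrec g) :
    Primrec fun x => f x - g x := Primrec.nat_sub.comp hf hg

@[fun_prop] theorem mul {f g : α → ℕ} (hf : Primrec f) (hg : Primrec g) :
    Primrec fun x => f x * g x := Primrec.nat_mul.comp hf hg

@[fun_prop] theorem div {f g : α → ℕ} (hf : Primrec f) (hg : Primrec g) :
    Primrec fun x => f x / g x := Primrec.nat_div.comp hf hg

@[fun_prop] theorem mod {f g : α → ℕ} (hf : Primrec f) (hg : Primrec g) :
    Primrec fun x => f x % g x := Primrec.nat_mod.comp hf hg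

@[fun_prop] theorem pow {f g : α → ℕ} (hf : Primrec f) (hg : Primrec g) :
    Primrec fun x => f x ^ g x :=
  (Primrec₂.unpaired'.1 Nat.Primrec.pow : Primrec₂ fun a b : ℕ => a ^ b).comp hf hg

@[fun_prop] theorem sqrt {f : α → ℕ} (hf : Primrec f) : Primrec fun x => (f x).sqrt :=
  Primrec.nat_sqrt.comp hf

@[fun_prop] theorem iteEq {f g : α → ℕ} {u v : α → β} (hf : Primrec f) (hg : Primrec g)
    (hu : Primrec u) (hv : Primrec v) : Primrec fun x => if f x = g x then u x else v x :=
  Primrec.ite (Primrec.eq.comp hf hg) hu hv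

@[fun_prop] theorem iteLT {f g : α → ℕ} {u v : α → β} (hf : Primrec f) (hg : Primrec g)
    (hu : Primrec u) (hv : Primrec v) : Primrec fun x => if f x < g x then u x else v x :=
  Primrec.ite (Primrec.nat_lt.comp hf hg) hu hv

@[fun_prop] theorem iteLE {f g : α → ℕ} {u v : α → β} (hf : Primrec f) (hg : Primrec g)
    (hu : Primrec u) (hv : Primrec v) : Primrec fun x => if f x ≤ g x then u x else v x :=
  Primrec.ite (Primrec.nat_le.comp hf hg) hu hv

@[fun_prop] theorem sumCases {f : α → β ⊕ γ} {g : α → β → σ} {h : α → γ → σ} (hf : Primrec f)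
    (hg : Primrec fun x : α × β => g x.1 x.2) (hh : Primrec fun x : α × γ => h x.1 x.2) :
    Primrec fun a => Sum.elim (g a) (h a) (f a) :=
  (Primrec.sumCasesOn hf hg.to₂ hh.to₂).of_eq fun a => by cases f a <;> rfl

@[fun_prop] theorem inl {f : α → β} (hf : Primrec f) : Primrec fun a => (Sum.inl (f a) : β ⊕ γ) :=
  Primrec.sumInl.comp hf

@[fun_prop] theorem inr {f : α → γ} (hf : Primrec f) : Primrec fun a => (Sum.inr (f a) : β ⊕ γ) :=
  Primrec.sumInr.comp hf

@[fun_prop] theorem optionElim {f : α → Option β} {g : α → σ} {h : α → β → σ} (hf : Primrec f)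
    (hg : Primrec g) (hh : Primrec fun x : α × β => h x.1 x.2) :
    Primrec fun a => Option.elim (f a) (g a) (h a) :=
  (Primrec.option_casesOn hf hg hh.to₂).of_eq fun a => by cases f a <;> rfl

@[fun_prop] theorem some {f : α → β} (hf : Primrec f) : Primrec fun a => Option.some (f a) :=
  Primrec.option_some.comp hf

@[fun_prop] theorem cons {f : α → β} {g : α → List β} (hf : Primrec f) (hg : Primrec g) :
    Primrec fun a => f a :: g a := Primrec.list_cons.comp hf hg

@[fun_prop] theorem append {f g : α → List β} (hf : Primrec f) (hg : Primrec g) :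
    Primrec fun a => f a ++ g a := Primrec.list_append.comp hf hg

@[fun_prop] theorem length {f : α → List β} (hf : Primrec f) : Primrec fun a => (f a).length :=
  Primrec.list_length.comp hf

@[fun_prop] theorem getD {f : α → List β} {i : α → ℕ} (d : β) (hf : Primrec f) (hi : Primrec i) :
    Primrec fun a => (f a).getD (i a) d := (Primrec.list_getD d).comp hf hi

@[fun_prop] theorem lookup [DecidableEq β] {i : α → β} {f : α → List (β × γ)} (hi : Primrec i)
    (hf : Primrec f) : Primrec fun a => (f a).lookup (i a) := Primrec.listLookup.comp hi hf

@[fun_prop] theorem optionGetD {f : α → Option β} {d : α → β} (hf : Primrec f) (hd : Primrec d) :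
    Primrec fun a => (f a).getD (d a) := Primrec.option_getD.comp hf hd

@[fun_prop] theorem range {f : α → ℕ} (hf : Primrec f) : Primrec fun x => List.range (f x) :=
  Primrec.list_range.comp hf

@[fun_prop] theorem map {l : α → List β} {g : α → β → γ} (hl : Primrec l)
    (hg : Primrec fun x : α × β => g x.1 x.2) : Primrec fun a => (l a).map (g a) :=
  Primrec.list_map hl hg.to₂

@[fun_prop] theorem flatMap {l : α → List β} {g : α → β → List γ} (hl : Primrec l)
    (hg : Primrec fun x : α × β => g x.1 x.2) : Primrec fun a => (l a).flatMap (g a) :=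
  Primrec.list_flatMap hl hg.to₂

@[fun_prop] theorem foldl {l : α → List β} {s : α → σ} {g : α → σ → β → σ} (hl : Primrec l)
    (hs : Primrec s) (hg : Primrec fun x : α × σ × β => g x.1 x.2.1 x.2.2) :
    Primrec fun a => (l a).foldl (g a) (s a) :=
  Primrec.list_foldl (h := fun a x => g a x.1 x.2) hl hs hg.to₂

@[fun_prop] theorem natRec {n : α → ℕ} {s : α → σ} {g : α → ℕ → σ → σ} (hn : Primrec n)
    (hs : Primrec s) (hg : Primrec fun x : α × ℕ × σ => g x.1 x.2.1 x.2.2) :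
    Primrec fun a => Nat.rec (motive := fun _ => σ) (s a) (g a) (n a) :=
  Primrec.nat_rec' (h := fun a x => g a x.1 x.2) hn hs hg.to₂

end PrimrecRules

/-! ### Computations with questions to a black box, and rules for their correctness and cost. -/

/-- A computation that may ask a black box for products of identifiers. Given the answers received
so far, it either names its next question or returns a value and the unused answers. -/
abbrev QueryM (β : Type) : Type := List ℕ → (ℕ × ℕ) ⊕ (β × List ℕ)

namespace QueryM

variable {β γ σ : Type}

def ret (b : β) (l : List ℕ) : (ℕ × ℕ) ⊕ (β × List ℕ) := .inr (b, l)

def bind (m : QueryM β) (f : β → QueryM γ) (l : List ℕ) : (ℕ × ℕ) ⊕ (γ × List ℕ) :=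
  Sum.elim .inl (fun x => f x.1 x.2) (m l)

def ask (a b : ℕ) (l : List ℕ) : (ℕ × ℕ) ⊕ (ℕ × List ℕ) :=
  match l with
  | [] => .inl (a, b)
  | x :: l => .inr (x, l)

/-- Run `f` for each entry of a list, threading a state. -/
def loop (l : List β) (s : σ) (f : σ → β → QueryM σ) (ans : List ℕ) :
    (ℕ × ℕ) ⊕ (σ × List ℕ) :=
  l.foldl (fun acc b => Sum.elim .inl (fun x => f x.1 b x.2) acc) (.inr (s, ans))

/-- Run `f` at most `n` times, until it returns a right value. -/
def iter (n : ℕ) (s : σ) (f : σ → QueryM (σ ⊕ β)) (ans : List ℕ) :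
    (ℕ × ℕ) ⊕ ((σ ⊕ β) × List ℕ) :=
  Nat.rec (motive := fun _ => (ℕ × ℕ) ⊕ ((σ ⊕ β) × List ℕ)) (.inr (.inl s, ans))
    (fun _ acc => Sum.elim .inl
      (fun x => Sum.elim (fun s => f s x.2) (fun b => .inr (.inr b, x.2)) x.1) acc) n

/-- Run `f` until it returns a right value. Every run but the last has to ask a question, so
the number of answers bounds the number of runs. -/
def whileLoop (s : σ) (f : σ → QueryM (σ ⊕ β)) (ans : List ℕ) : (ℕ × ℕ) ⊕ (β × List ℕ) :=
  Sum.elim .inl (fun x => Sum.elim (fun _ => .inl (0, 0)) (fun b => .inr (b, x.2)) x.1)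
    (iter (ans.length + 1) s f ans)

section Primrec

variable {α : Type*} [Primcodable α] [Primcodable β] [Primcodable γ] [Primcodable σ]

@[fun_prop] theorem primrec_ret {b : α → β} {l : α → List ℕ} (hb : Primrec b) (hl : Primrec l) :
    Primrec fun a => ret (b a) (l a) := by
  unfold ret; fun_prop

@[fun_prop] theorem primrec_bind {m : α → QueryM β} {f : α → β → QueryM γ} {l : α → List ℕ}
    (hm : Primrec fun a => m a (l a))
    (hf : Primrec fun x : α × β × List ℕ => f x.1 x.2.1 x.2.2) :
    Primrec fun a => bind (m a) (f a) (l a) :=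
  PrimrecRules.sumCases hm (by fun_prop) hf

@[fun_prop] theorem primrec_ask {b c : α → ℕ} {l : α → List ℕ} (hb : Primrec b) (hc : Primrec c)
    (hl : Primrec l) : Primrec fun a => ask (b a) (c a) (l a) := by
  have h : Primrec₂ fun (_ : α) (x : ℕ × List ℕ) => (Sum.inr x : (ℕ × ℕ) ⊕ (ℕ × List ℕ)) := by
    unfold Primrec₂; fun_prop
  have h' : Primrec fun a => (Sum.inl (b a, c a) : (ℕ × ℕ) ⊕ (ℕ × List ℕ)) := by fun_prop
  exact (Primrec.list_casesOn hl h' h).of_eq fun a => by cases l a <;> rfl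

@[fun_prop] theorem primrec_loop {l : α → List β} {s : α → σ} {f : α → σ → β → QueryM σ}
    {r : α → List ℕ} (hl : Primrec l) (hs : Primrec s)
    (hf : Primrec fun x : α × σ × β × List ℕ => f x.1 x.2.1 x.2.2.1 x.2.2.2) (hr : Primrec r) :
    Primrec fun a => loop (l a) (s a) (f a) (r a) := by
  unfold loop; fun_prop

@[fun_prop] theorem primrec_whileLoop {s : α → σ} {f : α → σ → QueryM (σ ⊕ β)}
    {r : α → List ℕ} (hs : Primrec s)
    (hf : Primrec fun x : α × σ × List ℕ => f x.1 x.2.1 x.2.2) (hr : Primrec r) :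
    Primrec fun a => whileLoop (s a) (f a) (r a) := by
  unfold whileLoop iter; fun_prop

end Primrec

/-- A pending question passes through the remaining rounds of the fold unchanged. -/
theorem loop_cons (b : β) (l : List β) (s : σ) (f : σ → β → QueryM σ) :
    loop (b :: l) s f = bind (f s b) (fun s' => loop l s' f) := by
  funext ans
  have h : ∀ (l : List β) (q : ℕ × ℕ), l.foldl (fun (acc : (ℕ × ℕ) ⊕ (σ × List ℕ)) b =>
      Sum.elim .inl (fun x => f x.1 b x.2) acc) (.inl q) = .inl q := by
    intro l; induction l with
    | nil => intro q; rfl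
    | cons b l ih => intro q; exact ih q
  simp only [loop, bind, List.foldl_cons, Sum.elim_inr]
  rcases f s b ans with q | ⟨s', l'⟩
  · exact h l q
  · rfl

/-- The recursion in `iter` adds a run at the end, while induction along an execution has to split
off the first run. -/
theorem iter_succ (n : ℕ) (s : σ) (f : σ → QueryM (σ ⊕ β)) :
    iter (n + 1) s f =
      bind (f s) (fun x => Sum.elim (fun s' => iter n s' f) (fun b => ret (.inr b)) x) := by
  funext ans
  induction n generalizing s ans with
  | zero =>
    have h : iter (0 + 1) s f ans = Sum.elim .inl
      (fun x => Sum.elim (fun s => f s x.2) (fun b => .inr (.inr b, x.2)) x.1)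
      (.inr (.inl s, ans)) := rfl
    rw [h]
    simp only [bind, Sum.elim_inr, Sum.elim_inl]
    rcases f s ans with q | ⟨s' | b, l'⟩ <;> rfl
  | succ n ih =>
    have h : iter (n + 2) s f ans = Sum.elim .inl
      (fun x => Sum.elim (fun s => f s x.2) (fun b => .inr (.inr b, x.2)) x.1)
      (iter (n + 1) s f ans) := rfl
    rw [h, ih]
    simp only [bind]
    rcases f s ans with q | ⟨s' | b, l'⟩ <;> rfl

section Exec

variable {G : Type*} [Group G] (ident : G → ℕ)

/-- With a black box for `G`, the computation `m` receives the answers `ans` and returns `b`. -/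
def Exec (m : QueryM β) (ans : List ℕ) (b : β) : Prop :=
  (∀ rest, m (ans ++ rest) = .inr (b, rest)) ∧ ∀ l₁ x l₂, ans = l₁ ++ x :: l₂ →
    ∃ g h : G, m l₁ = .inl (ident g, ident h) ∧ x = ident (g * h)

/-- With a black box for `G`, the computation `m` ends with a value and a number of questions that
satisfy `Q`. -/
def Spec (m : QueryM β) (Q : β → ℕ → Prop) : Prop :=
  ∃ ans b, Exec ident m ans b ∧ Q b ans.length

variable {ident}

theorem Exec.ret (b : β) : Exec ident (ret b) [] b :=
  ⟨fun _ => rfl, fun l₁ x l₂ h => by simp at h⟩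

theorem Exec.ask (g h : G) : Exec ident (ask (ident g) (ident h)) [ident (g * h)] (ident (g * h)) :=
  ⟨fun _ => rfl, fun l₁ x l₂ e => by
    obtain ⟨rfl, rfl⟩ : l₁ = [] ∧ x = ident (g * h) := by
      rcases l₁ with _ | ⟨y, l₁⟩ <;> simp_all
    exact ⟨g, h, rfl, rfl⟩⟩

theorem Exec.bind {m : QueryM β} {f : β → QueryM γ} {a a' : List ℕ} {b : β} {c : γ}
    (hm : Exec ident m a b) (hf : Exec ident (f b) a' c) :
    Exec ident (bind m f) (a ++ a') c := by
  refine ⟨fun rest => ?_, fun l₁ x l₂ e => ?_⟩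
  · simp [QueryM.bind, hm.1, hf.1]
  -- The question is one of `f b`, with the first question of `f b` as a boundary case, or one of
  -- `m`.
  · rcases List.append_eq_append_iff.1 e with ⟨t, rfl, rfl⟩ | ⟨t, rfl, h⟩
    · obtain ⟨g, h, h1, h2⟩ := hf.2 t x l₂ rfl
      exact ⟨g, h, by simp [QueryM.bind, hm.1, h1], h2⟩
    · rcases t with _ | ⟨y, t⟩
      · obtain ⟨g, h, h1, h2⟩ := hf.2 [] x l₂ (by simpa using h.symm)
        have := hm.1 []
        simp only [List.append_nil] at this
        exact ⟨g, h, by simp [QueryM.bind, this, h1], h2⟩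
      · simp only [List.cons_append, List.cons.injEq] at h
        obtain ⟨rfl, rfl⟩ := h
        obtain ⟨g, h, h1, h2⟩ := hm.2 l₁ x t rfl
        exact ⟨g, h, by simp [QueryM.bind, h1], h2⟩

theorem Spec.mono {m : QueryM β} {Q Q' : β → ℕ → Prop} (h : Spec ident m Q)
    (hQ : ∀ b c, Q b c → Q' b c) : Spec ident m Q' := by
  obtain ⟨ans, b, h1, h2⟩ := h
  exact ⟨ans, b, h1, hQ _ _ h2⟩

theorem Spec.ret {b : β} {Q : β → ℕ → Prop} (h : Q b 0) : Spec ident (ret b) Q :=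
  ⟨[], b, Exec.ret b, h⟩

theorem Spec.ask (g h : G) {Q : ℕ → ℕ → Prop} (hQ : Q (ident (g * h)) 1) :
    Spec ident (ask (ident g) (ident h)) Q :=
  ⟨_, _, Exec.ask g h, hQ⟩

theorem Spec.bind {m : QueryM β} {f : β → QueryM γ} {Q : β → ℕ → Prop} {Q' : γ → ℕ → Prop}
    (hm : Spec ident m Q)
    (hf : ∀ b c, Q b c → Spec ident (f b) (fun b' c' => Q' b' (c + c'))) :
    Spec ident (bind m f) Q' := by
  obtain ⟨a, b, h1, h2⟩ := hm
  obtain ⟨a', b', h3, h4⟩ := hf b _ h2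
  exact ⟨a ++ a', b', h1.bind h3, by simpa using h4⟩

theorem Spec.loop {f : σ → β → QueryM σ} (l : List β) (s : σ) (I : ℕ → σ → ℕ → Prop)
    (h0 : I 0 s 0)
    (hs : ∀ i (hi : i < l.length) s c, I i s c →
      Spec ident (f s l[i]) (fun s' c' => I (i + 1) s' (c + c'))) :
    Spec ident (loop l s f) (I l.length) := by
  induction l generalizing s I with
  | nil => exact Spec.ret h0
  | cons b l ih =>
    rw [loop_cons]
    refine Spec.bind (hs 0 (by simp) s 0 h0) fun s' c hc => ?_
    refine (ih s' (fun i s'' c'' => I (i + 1) s'' (c + c'')) (by simpa using hc) ?_).mono ?_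
    · intro i hi s'' c'' h
      have := hs (i + 1) (by simpa using hi) s'' (c + c'') h
      simpa [add_assoc] using this
    · intro b c h; simpa using h

theorem Spec.loop_range {f : σ → ℕ → QueryM σ} (n : ℕ) (s : σ) (I : ℕ → σ → ℕ → Prop)
    (h0 : I 0 s 0)
    (hs : ∀ i < n, ∀ s c, I i s c →
      Spec ident (f s i) (fun s' c' => I (i + 1) s' (c + c'))) :
    Spec ident (QueryM.loop (List.range n) s f) (I n) := by
  have := Spec.loop (ident := ident) (f := f) (List.range n) s I h0 (fun i hi s c h => by
    simpa using hs i (by simpa using hi) s c h)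
  simpa using this

/-- The fuel for `whileLoop` that a list of answers provides suffices. -/
inductive WhileRun (ident : G → ℕ) (f : σ → QueryM (σ ⊕ β)) : σ → List ℕ → β → Prop
  | done {s a b} (h : Exec ident (f s) a (.inr b)) : WhileRun ident f s a b
  | step {s s' a a' b} (h : Exec ident (f s) a (.inl s')) (ha : a ≠ [])
      (hr : WhileRun ident f s' a' b) : WhileRun ident f s (a ++ a') b

/-- Every run but the last consumes an answer, so a number of runs above the number of available
answers is never exhausted. This is needed for the full list of answers and for each of its proper
prefixes. -/
theorem WhileRun.iter {f : σ → QueryM (σ ⊕ β)} {s : σ} {a : List ℕ} {b : β}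
    (h : WhileRun ident f s a b) :
    (∀ n > a.length, ∀ rest, QueryM.iter n s f (a ++ rest) = .inr (.inr b, rest)) ∧
    ∀ l₁ x l₂, a = l₁ ++ x :: l₂ → ∀ n > l₁.length,
      ∃ g h : G, QueryM.iter n s f l₁ = .inl (ident g, ident h) ∧ x = ident (g * h) := by
  induction h with
  | @done s a b h =>
    refine ⟨fun n hn rest => ?_, fun l₁ x l₂ e n hn => ?_⟩
    · obtain ⟨n, rfl⟩ := Nat.exists_eq_add_of_lt (Nat.zero_lt_of_lt hn)
      rw [iter_succ]
      simp [QueryM.bind, h.1, QueryM.ret]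
    · obtain ⟨n, rfl⟩ := Nat.exists_eq_add_of_lt (Nat.zero_lt_of_lt hn)
      obtain ⟨g, g', h1, h2⟩ := h.2 l₁ x l₂ e
      exact ⟨g, g', by rw [iter_succ]; simp [QueryM.bind, h1], h2⟩
  | @step s s' a a' b h ha hr ih =>
    have hpos : 0 < a.length := List.length_pos_iff.2 ha
    refine ⟨fun n hn rest => ?_, fun l₁ x l₂ e n hn => ?_⟩
    · obtain ⟨n, rfl⟩ := Nat.exists_eq_add_of_lt (Nat.zero_lt_of_lt hn)
      rw [iter_succ]
      simp only [List.length_append] at hn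
      simp only [QueryM.bind, List.append_assoc, h.1, Sum.elim_inr, Sum.elim_inl]
      exact ih.1 _ (by omega) rest
    · obtain ⟨n, rfl⟩ := Nat.exists_eq_add_of_lt (Nat.zero_lt_of_lt hn)
      rw [iter_succ]
      rcases List.append_eq_append_iff.1 e with ⟨t, rfl, rfl⟩ | ⟨t, rfl, h'⟩
      · simp only [List.length_append] at hn
        obtain ⟨g, g', h1, h2⟩ := ih.2 t x l₂ rfl (0 + n) (by omega)
        exact ⟨g, g', by simpa [QueryM.bind, h.1] using h1, h2⟩
      · rcases t with _ | ⟨y, t⟩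
        · simp only [List.append_nil] at *
          obtain ⟨g, g', h1, h2⟩ := ih.2 [] x l₂ (by simpa using h'.symm) (0 + n)
            (by simp only [List.length_nil]; omega)
          have := h.1 []
          simp only [List.append_nil] at this
          exact ⟨g, g', by simpa [QueryM.bind, this] using h1, h2⟩
        · simp only [List.cons_append, List.cons.injEq] at h'
          obtain ⟨rfl, rfl⟩ := h'
          obtain ⟨g, g', h1, h2⟩ := h.2 l₁ x t rfl
          exact ⟨g, g', by simp [QueryM.bind, h1], h2⟩

theorem WhileRun.exec {f : σ → QueryM (σ ⊕ β)} {s : σ} {a : List ℕ} {b : β}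
    (h : WhileRun ident f s a b) : Exec ident (whileLoop s f) a b := by
  refine ⟨fun rest => ?_, fun l₁ x l₂ e => ?_⟩
  · have := h.iter.1 ((a ++ rest).length + 1) (by simp) rest
    simp only [whileLoop, this, Sum.elim_inr]
  · obtain ⟨g, g', h1, h2⟩ := h.iter.2 l₁ x l₂ e (l₁.length + 1) (by omega)
    exact ⟨g, g', by simp only [whileLoop, h1, Sum.elim_inl], h2⟩

/-- The measure `μ` gives termination; the condition `0 < c'` allows the answers to serve as fuel.
-/
theorem Spec.whileLoop {f : σ → QueryM (σ ⊕ β)} (μ : σ → ℕ) (I : σ → ℕ → Prop)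
    {Q : β → ℕ → Prop}
    (hs : ∀ s c, I s c → Spec ident (f s) (fun x c' =>
      (∃ s', x = .inl s' ∧ 0 < c' ∧ I s' (c + c') ∧ μ s' < μ s) ∨
      (∃ b, x = .inr b ∧ Q b (c + c'))))
    (s : σ) (h0 : I s 0) : Spec ident (whileLoop s f) Q := by
  have key : ∀ k s c, μ s ≤ k → I s c →
      ∃ a b, WhileRun ident f s a b ∧ Q b (c + a.length) := by
    intro k
    induction k with
    | zero =>
      intro s c hk hI
      obtain ⟨a, x, h1, h2⟩ := hs s c hI
      rcases h2 with ⟨s', rfl, -, -, h⟩ | ⟨b, rfl, h⟩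
      · omega
      · exact ⟨a, b, .done h1, h⟩
    | succ k ih =>
      intro s c hk hI
      obtain ⟨a, x, h1, h2⟩ := hs s c hI
      rcases h2 with ⟨s', rfl, hpos, hI', h⟩ | ⟨b, rfl, h⟩
      · obtain ⟨a', b, h3, h4⟩ := ih s' _ (by omega) hI'
        refine ⟨a ++ a', b, .step h1 (List.length_pos_iff.1 hpos) h3, ?_⟩
        simpa [add_assoc] using h4
      · exact ⟨a, b, .done h1, h⟩
  obtain ⟨a, b, h1, h2⟩ := key _ s 0 le_rfl h0
  exact ⟨a, b, h1.exec, by simpa using h2⟩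

end Exec

end QueryM

/-! ### From computations with questions to generic algorithms. -/

/-- The generic algorithm given by a primitive recursive computation with questions. -/
def GenericAlgorithm.ofQueryM (alg : ℕ × ℕ × List ℕ → QueryM (List ℕ))
    (h : Primrec fun x : (ℕ × ℕ × List ℕ) × List ℕ => alg x.1 x.2) : GenericAlgorithm where
  State := (ℕ × ℕ × List ℕ) × List ℕ
  start i := (i, [])
  next s := Sum.elim (fun q => Instruction.mul q.1 q.2) (fun x => Instruction.halt x.1)
    (alg s.1 s.2)
  resume s := (s.1.1, s.1.2 ++ [s.2])
  start_computable := Primrec.to_comp (by fun_prop)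
  next_computable := Primrec.to_comp (by fun_prop)
  resume_computable := Primrec.to_comp (by fun_prop)

/-- The state consists of the input and all answers so far, and the computation is replayed from its
beginning after each answer. Only the questions count as group operations. -/
theorem GenericAlgorithm.runs_ofQueryM {G : Type*} [Group G] {ident : G → ℕ}
    {alg : ℕ × ℕ × List ℕ → QueryM (List ℕ)}
    {h : Primrec fun x : (ℕ × ℕ × List ℕ) × List ℕ => alg x.1 x.2} {i : ℕ × ℕ × List ℕ}
    {ans out : List ℕ} (he : QueryM.Exec ident (alg i) ans out) :
    (GenericAlgorithm.ofQueryM alg h).Runs ident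
      ((GenericAlgorithm.ofQueryM alg h).start i) ans.length out := by
  have key : ∀ l₂ l₁, ans = l₁ ++ l₂ →
      (GenericAlgorithm.ofQueryM alg h).Runs ident (i, l₁) l₂.length out := by
    intro l₂
    induction l₂ with
    | nil =>
      intro l₁ e
      refine .halt ?_
      have := he.1 []
      simp only [e, List.append_nil] at this
      simp [GenericAlgorithm.ofQueryM, this]
    | cons x l₂ ih =>
      intro l₁ e
      obtain ⟨g, g', h1, rfl⟩ := he.2 l₁ x l₂ e
      exact .mul g g' (by simp [GenericAlgorithm.ofQueryM, h1]) (ih (l₁ ++ [ident (g * g')])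
        (by simp [e]))
  exact key ans [] rfl

/-! ### Addition chains. -/

/-- The exponents that a list of additions produces. -/
def additionSums (l : List (ℕ × ℕ)) : Finset ℕ := (l.map fun q => q.1 + q.2).toFinset

/-- Every addition of the list has its terms in `K` or among the earlier results. -/
def IsAdditionChain : Finset ℕ → List (ℕ × ℕ) → Prop
  | _, [] => True
  | K, q :: l => q.1 ∈ K ∧ q.2 ∈ K ∧ IsAdditionChain (insert (q.1 + q.2) K) l

theorem mem_additionSums {l : List (ℕ × ℕ)} {x : ℕ} :
    x ∈ additionSums l ↔ ∃ q ∈ l, q.1 + q.2 = x := by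
  simp [additionSums]

@[simp] theorem additionSums_nil : additionSums [] = ∅ := rfl

theorem additionSums_cons (q : ℕ × ℕ) (l : List (ℕ × ℕ)) :
    additionSums (q :: l) = insert (q.1 + q.2) (additionSums l) := by
  simp [additionSums]

theorem additionSums_append (l₁ l₂ : List (ℕ × ℕ)) :
    additionSums (l₁ ++ l₂) = additionSums l₁ ∪ additionSums l₂ := by
  simp [additionSums]

theorem mem_additionSums_flatMap {n : ℕ} {f : ℕ → List (ℕ × ℕ)} {x : ℕ} :
    x ∈ additionSums ((List.range n).flatMap f) ↔ ∃ i < n, x ∈ additionSums (f i) := by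
  simp only [mem_additionSums, List.mem_flatMap, List.mem_range]
  constructor
  · rintro ⟨q, ⟨i, hi, hq⟩, rfl⟩; exact ⟨i, hi, q, hq, rfl⟩
  · rintro ⟨i, hi, q, hq, rfl⟩; exact ⟨q, ⟨i, hi, hq⟩, rfl⟩

theorem isAdditionChain_append {l₁ l₂ : List (ℕ × ℕ)} {K : Finset ℕ} :
    IsAdditionChain K (l₁ ++ l₂) ↔
      IsAdditionChain K l₁ ∧ IsAdditionChain (K ∪ additionSums l₁) l₂ := by
  induction l₁ generalizing K with
  | nil => simp [IsAdditionChain]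
  | cons q l ih =>
    simp only [List.cons_append, IsAdditionChain, ih, additionSums_cons, and_assoc]
    rw [show insert (q.1 + q.2) K ∪ additionSums l = K ∪ insert (q.1 + q.2) (additionSums l) by
      ext; simp]

theorem isAdditionChain_flatMap_range {n : ℕ} {f : ℕ → List (ℕ × ℕ)} {K : Finset ℕ}
    (h : ∀ i < n, ∀ K', K ⊆ K' → (∀ j < i, additionSums (f j) ⊆ K') → IsAdditionChain K' (f i)) :
    IsAdditionChain K ((List.range n).flatMap f) := by
  induction n with
  | zero => trivial
  | succ n ih =>
    rw [List.range_succ, List.flatMap_append, isAdditionChain_append]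
    refine ⟨ih fun i hi => h i (by omega), ?_⟩
    simp only [List.flatMap_cons, List.flatMap_nil, List.append_nil]
    refine h n (by omega) _ Finset.subset_union_left fun j hj x hx => ?_
    exact Finset.mem_union_right _ (mem_additionSums_flatMap.2 ⟨j, hj, hx⟩)

/-- Additions that lead from `A` to `A * n` by the binary method. -/
def mulChain (A n : ℕ) : List (ℕ × ℕ) :=
  (List.range n).flatMap fun i =>
    [(A * (n / 2 ^ (n - i)), A * (n / 2 ^ (n - i))), (2 * (A * (n / 2 ^ (n - i))), A)]

/-- The nontrivial sums in `mulChain A n`. -/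
def mulChainSet (A n : ℕ) : Finset ℕ :=
  (Finset.range (Nat.log 2 n)).biUnion fun b =>
    {2 * (A * (n / 2 ^ (b + 1))), 2 * (A * (n / 2 ^ (b + 1))) + A}

theorem card_mulChainSet_le (A n : ℕ) : (mulChainSet A n).card ≤ 2 * Nat.log 2 n := by
  refine (Finset.card_biUnion_le_card_mul _ _ 2 fun b _ => Finset.card_le_two).trans ?_
  simp [mul_comm]

/-- The chain runs over `n` binary positions, which avoids a logarithm in its definition. At the
superfluous leading positions the quotient is `0`, and only `0` and `A` arise. -/
theorem additionSums_mulChain_subset (A n : ℕ) :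
    additionSums (mulChain A n) ⊆ {0, A} ∪ mulChainSet A n := by
  intro x hx
  obtain ⟨i, hi, hx⟩ := mem_additionSums_flatMap.1 hx
  simp only [additionSums_cons, additionSums_nil, Finset.mem_insert, Finset.notMem_empty,
    or_false, ← two_mul] at hx
  by_cases h : n / 2 ^ (n - i) = 0
  · simp only [h, mul_zero, zero_add] at hx
    exact Finset.mem_union_left _ (by simpa using hx)
  · have hb : n - i - 1 < Nat.log 2 n := by
      have : 2 ^ (n - i) ≤ n := by
        by_contra h'
        exact h (Nat.div_eq_of_lt (by omega))
      have := Nat.le_log_of_pow_le (by norm_num) this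
      omega
    refine Finset.mem_union_right _ (Finset.mem_biUnion.2 ⟨n - i - 1, by simpa using hb, ?_⟩)
    rw [show n - i - 1 + 1 = n - i by omega]
    simpa using hx

theorem mulChain_spec {A n : ℕ} {K : Finset ℕ} (h0 : 0 ∈ K) (hA : A ∈ K) :
    IsAdditionChain K (mulChain A n) ∧ A * n ∈ K ∪ additionSums (mulChain A n) := by
  -- Horner's rule: the next quotient is twice the present one, or one more than that.
  have key : ∀ i < n, A * (n / 2 ^ (n - (i + 1))) ∈ additionSums
      [(A * (n / 2 ^ (n - i)), A * (n / 2 ^ (n - i))), (2 * (A * (n / 2 ^ (n - i))), A)] := by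
    intro i hi
    have h1 : n / 2 ^ (n - i) = n / 2 ^ (n - (i + 1)) / 2 := by
      rw [Nat.div_div_eq_div_mul, ← pow_succ]
      congr 2; omega
    rw [h1]
    simp only [additionSums_cons, additionSums_nil, Finset.mem_insert, Finset.notMem_empty,
      or_false, ← two_mul]
    generalize n / 2 ^ (n - (i + 1)) = q
    rcases Nat.even_or_odd' q with ⟨c, rfl | rfl⟩
    · left; rw [Nat.mul_div_cancel_left _ (by norm_num)]; ring
    · right; rw [show (2 * c + 1) / 2 = c by omega]; ring
  constructor
  · refine isAdditionChain_flatMap_range fun i hi K' hK hK' => ?_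
    have : A * (n / 2 ^ (n - i)) ∈ K' := by
      rcases i with _ | i
      · rw [Nat.sub_zero, Nat.div_eq_of_lt Nat.lt_two_pow_self, mul_zero]
        exact hK h0
      · exact hK' i (by omega) (key i (by omega))
    refine ⟨this, this, ?_, ?_, trivial⟩
    · simp [two_mul]
    · exact Finset.mem_insert_of_mem (hK hA)
  · rcases n with _ | n
    · exact Finset.mem_union_left _ (by simpa using h0)
    · refine Finset.mem_union_right _ (mem_additionSums_flatMap.2 ⟨n, by omega, ?_⟩)
      simpa using key n (by omega)

@[fun_prop] theorem primrec_mulChain {α : Type*} [Primcodable α] {A n : α → ℕ} (hA : Primrec A)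
    (hn : Primrec n) : Primrec fun a => mulChain (A a) (n a) := by
  unfold mulChain; fun_prop

/-! ### Tables of powers of one element. -/

section Memo

variable {G : Type*} [Group G] {ident : G → ℕ}

/-- The table `M` holds the identifiers of the powers `a ^ E` for exactly the exponents `E ∈ K`. -/
def IsMemo (ident : G → ℕ) (a : G) (M : List (ℕ × ℕ)) (K : Finset ℕ) : Prop :=
  M.length = K.card ∧ ∀ E, M.lookup E = if E ∈ K then some (ident (a ^ E)) else none

theorem IsMemo.getD {a : G} {M : List (ℕ × ℕ)} {K : Finset ℕ} (h : IsMemo ident a M K) {E : ℕ}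
    (hE : E ∈ K) : (M.lookup E).getD 0 = ident (a ^ E) := by
  simp [h.2, hE]

theorem isMemo_init (a : G) : IsMemo ident a [(0, ident 1), (1, ident a)] {0, 1} := by
  refine ⟨rfl, fun E => ?_⟩
  rcases E with _ | _ | E <;> simp [List.lookup]

/-- Extend a table of powers by a list of additions of exponents. -/
def extendMemo (M l : List (ℕ × ℕ)) : QueryM (List (ℕ × ℕ)) :=
  QueryM.loop l M fun M q ans => (M.lookup (q.1 + q.2)).elim
    (QueryM.bind (QueryM.ask ((M.lookup q.1).getD 0) ((M.lookup q.2).getD 0))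
      (fun x => QueryM.ret ((q.1 + q.2, x) :: M)) ans)
    (fun _ => QueryM.ret M ans)

@[fun_prop] theorem primrec_extendMemo {α : Type*} [Primcodable α] {M l : α → List (ℕ × ℕ)}
    {r : α → List ℕ} (hM : Primrec M) (hl : Primrec l) (hr : Primrec r) :
    Primrec fun a => extendMemo (M a) (l a) (r a) := by
  unfold extendMemo; fun_prop

/-- A sum that is already in the table needs no question, so the cost is the growth of the set of
exponents. All later bounds for powers are therefore bounds for numbers of distinct exponents. -/
theorem spec_extendMemo {a : G} {l : List (ℕ × ℕ)} {M : List (ℕ × ℕ)} {K : Finset ℕ}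
    (hM : IsMemo ident a M K) (hl : IsAdditionChain K l) :
    QueryM.Spec ident (extendMemo M l) fun M' c =>
      IsMemo ident a M' (K ∪ additionSums l) ∧ K.card + c = (K ∪ additionSums l).card := by
  induction l generalizing M K with
  | nil => exact QueryM.Spec.ret (by simpa using hM)
  | cons q l ih =>
    rw [extendMemo, QueryM.loop_cons]
    have hK : K ∪ additionSums (q :: l) = insert (q.1 + q.2) K ∪ additionSums l := by
      rw [additionSums_cons]; ext; simp
    rw [hK]
    refine QueryM.Spec.bind (Q := fun M' c => IsMemo ident a M' (insert (q.1 + q.2) K) ∧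
      K.card + c = (insert (q.1 + q.2) K).card) ?_ ?_
    · by_cases h : q.1 + q.2 ∈ K
      · simp only [hM.2 (q.1 + q.2), if_pos h, Option.elim]
        refine QueryM.Spec.ret ?_
        rw [Finset.insert_eq_of_mem h]
        exact ⟨hM, rfl⟩
      · simp only [hM.2 (q.1 + q.2), if_neg h, Option.elim]
        rw [hM.getD hl.1, hM.getD hl.2.1]
        refine QueryM.Spec.bind (Q := fun x c => x = ident (a ^ (q.1 + q.2)) ∧ c = 1)
          (QueryM.Spec.ask _ _ ⟨by rw [pow_add], rfl⟩) ?_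
        rintro x c ⟨rfl, rfl⟩
        refine QueryM.Spec.ret ⟨⟨?_, fun E => ?_⟩, ?_⟩
        · rw [List.length_cons, hM.1, Finset.card_insert_of_notMem h]
        · rw [List.lookup_cons, hM.2]
          by_cases hE : E = q.1 + q.2
          · simp [hE]
          · simp [hE, beq_eq_false_iff_ne.2 hE]
        · rw [Finset.card_insert_of_notMem h]
    · rintro M' c ⟨h1, h2⟩
      refine (ih h1 hl.2.2).mono ?_
      rintro M'' c' ⟨h3, h4⟩
      exact ⟨h3, by omega⟩

/-- The identifier of the `n`-th power, given the identifiers of `1` and of the base. -/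
def powQuery (e x n : ℕ) : QueryM ℕ :=
  QueryM.bind (extendMemo [(0, e), (1, x)] (mulChain 1 n))
    fun M => QueryM.ret ((M.lookup n).getD 0)

@[fun_prop] theorem primrec_powQuery {α : Type*} [Primcodable α] {e x n : α → ℕ}
    {r : α → List ℕ} (he : Primrec e) (hx : Primrec x) (hn : Primrec n) (hr : Primrec r) :
    Primrec fun a => powQuery (e a) (x a) (n a) (r a) := by
  unfold powQuery; fun_prop

/-- The last conjunct is what makes each unfinished run in `primePowers` ask a question; it holds
because for `2 ≤ n` the exponent `n` is not in the initial table. -/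
theorem spec_powQuery (a : G) (n : ℕ) :
    QueryM.Spec ident (powQuery (ident 1) (ident a) n) fun y c =>
      y = ident (a ^ n) ∧ c ≤ 2 * Nat.log 2 n ∧ (2 ≤ n → 0 < c) := by
  have hc := mulChain_spec (A := 1) (n := n) (K := {0, 1}) (by simp) (by simp)
  refine QueryM.Spec.bind (spec_extendMemo (isMemo_init a) hc.1) ?_
  rintro M c ⟨h1, h2⟩
  rw [one_mul] at hc
  refine QueryM.Spec.ret ⟨h1.getD hc.2, ?_, ?_⟩
  · have : ({0, 1} ∪ additionSums (mulChain 1 n)).card ≤ ({0, 1} ∪ mulChainSet 1 n).card := by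
      refine Finset.card_le_card (Finset.union_subset Finset.subset_union_left ?_)
      exact additionSums_mulChain_subset 1 n
    have h3 := Finset.card_union_le {0, 1} (mulChainSet 1 n)
    have h4 := card_mulChainSet_le 1 n
    omega
  · intro hn
    have : ({n, 0, 1} : Finset ℕ).card ≤ ({0, 1} ∪ additionSums (mulChain 1 n)).card := by
      refine Finset.card_le_card (Finset.insert_subset hc.2 Finset.subset_union_left)
    rw [Finset.card_insert_of_notMem (by simp; omega)] at this
    omega

end Memo

/-! ### Simultaneous exponentiation. -/

/-- The sum of `f i` over `i < n`, as a primitive recursive function. -/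
def rangeSum (n : ℕ) (f : ℕ → ℕ) : ℕ := (List.range n).foldl (fun s i => s + f i) 0

theorem rangeSum_eq (n : ℕ) (f : ℕ → ℕ) : rangeSum n f = ∑ i ∈ Finset.range n, f i := by
  induction n with
  | zero => rfl
  | succ n ih =>
    rw [Finset.sum_range_succ, ← ih]
    simp [rangeSum, List.range_succ]

@[fun_prop] theorem primrec_rangeSum {α : Type*} [Primcodable α] {n : α → ℕ} {f : α → ℕ → ℕ}
    (hn : Primrec n) (hf : Primrec fun x : α × ℕ => f x.1 x.2) :
    Primrec fun a => rangeSum (n a) (f a) := by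
  have : Primrec fun x : α × ℕ × ℕ => f x.1 x.2.2 :=
    hf.comp (Primrec.fst.pair (Primrec.snd.comp Primrec.snd))
  unfold rangeSum; fun_prop

/-- Additions that lead from the numbers `B i` to `∑ i ∈ range c, B i * x i`, by Horner's rule
for the binary digits of all the `x i` at once. -/
def multiChain (c : ℕ) (B x : ℕ → ℕ) (N : ℕ) : List (ℕ × ℕ) :=
  (List.range N).flatMap fun k =>
    ((List.range c).map fun i => (rangeSum i fun j => B j * (x j / 2 ^ (N - 1 - k) % 2),
      B i * (x i / 2 ^ (N - 1 - k) % 2))) ++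
    [(rangeSum c fun j => B j * (x j / 2 ^ (N - k)), rangeSum c fun j => B j * (x j / 2 ^ (N - k))),
      (2 * rangeSum c fun j => B j * (x j / 2 ^ (N - k)),
        rangeSum c fun j => B j * (x j / 2 ^ (N - 1 - k) % 2))]

@[fun_prop] theorem primrec_multiChain {α : Type*} [Primcodable α] {c N : α → ℕ}
    {B x : α → ℕ → ℕ} (hc : Primrec c) (hB : Primrec fun x : α × ℕ => B x.1 x.2)
    (hx : Primrec fun y : α × ℕ => x y.1 y.2) (hN : Primrec N) :
    Primrec fun a => multiChain (c a) (B a) (x a) (N a) := by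
  have hB₁ : ∀ {β : Type _} [Primcodable β] {u : β → α} {v : β → ℕ}, Primrec u → Primrec v →
      Primrec fun b => B (u b) (v b) := fun hu hv => hB.comp (hu.pair hv)
  have hx₁ : ∀ {β : Type _} [Primcodable β] {u : β → α} {v : β → ℕ}, Primrec u → Primrec v →
      Primrec fun b => x (u b) (v b) := fun hu hv => hx.comp (hu.pair hv)
  have e₁ : Primrec fun y : ((α × ℕ) × ℕ) => B y.1.1 y.2 := hB₁ (by fun_prop) (by fun_prop)
  have e₂ : Primrec fun y : ((α × ℕ) × ℕ) => x y.1.1 y.2 := hx₁ (by fun_prop) (by fun_prop)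
  have e₃ : Primrec fun y : (((α × ℕ) × ℕ) × ℕ) => B y.1.1.1 y.2 :=
    hB₁ (by fun_prop) (by fun_prop)
  have e₄ : Primrec fun y : (((α × ℕ) × ℕ) × ℕ) => x y.1.1.1 y.2 :=
    hx₁ (by fun_prop) (by fun_prop)
  unfold multiChain; fun_prop

theorem additionSums_map_range (c : ℕ) (f : ℕ → ℕ × ℕ) (e : ℕ) :
    e ∈ additionSums ((List.range c).map f) ↔ ∃ i < c, (f i).1 + (f i).2 = e := by
  simp [mem_additionSums]

theorem isAdditionChain_map_range {c : ℕ} {f : ℕ → ℕ × ℕ} {K : Finset ℕ}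
    (h : ∀ i < c, ∀ K', K ⊆ K' → (∀ j < i, (f j).1 + (f j).2 ∈ K') →
      (f i).1 ∈ K' ∧ (f i).2 ∈ K') :
    IsAdditionChain K ((List.range c).map f) := by
  rw [List.map_eq_flatMap]
  refine isAdditionChain_flatMap_range fun i hi K' hK hK' => ?_
  have := h i hi K' hK fun j hj => hK' j hj (by simp [mem_additionSums])
  exact ⟨this.1, this.2, trivial⟩

theorem multiChain_spec {c N : ℕ} {B x : ℕ → ℕ} {K : Finset ℕ} (h0 : 0 ∈ K)
    (hB : ∀ i < c, B i ∈ K) (hx : ∀ i < c, x i < 2 ^ N) :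
    IsAdditionChain K (multiChain c B x N) ∧
      ∑ i ∈ Finset.range c, B i * x i ∈ K ∪ additionSums (multiChain c B x N) := by
  -- One step of Horner's rule, for all the `x i` at once.
  have hQ : ∀ k < N, (∑ i ∈ Finset.range c, B i * (x i / 2 ^ (N - (k + 1)))) =
      2 * ∑ i ∈ Finset.range c, B i * (x i / 2 ^ (N - k)) +
        ∑ i ∈ Finset.range c, B i * (x i / 2 ^ (N - 1 - k) % 2) := by
    intro k hk
    rw [Finset.mul_sum, ← Finset.sum_add_distrib]
    refine Finset.sum_congr rfl fun i _ => ?_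
    rw [show N - k = N - 1 - k + 1 by omega, pow_succ, ← Nat.div_div_eq_div_mul,
      show N - (k + 1) = N - 1 - k by omega]
    generalize x i / 2 ^ (N - 1 - k) = q
    conv_lhs => rw [← Nat.div_add_mod q 2]
    ring
  have hT : (∑ i ∈ Finset.range c, B i * (x i / 2 ^ N)) = 0 :=
    Finset.sum_eq_zero fun i hi => by
      rw [Nat.div_eq_of_lt (hx i (Finset.mem_range.1 hi)), mul_zero]
  constructor
  · refine isAdditionChain_flatMap_range fun k hk K' hK hK' => ?_
    rw [isAdditionChain_append]
    refine ⟨isAdditionChain_map_range fun i hi K'' hK1 hK2 => ⟨?_, ?_⟩, ?_⟩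
    · rcases i with _ | i
      · exact hK1 (hK h0)
      · have := hK2 i (by omega)
        simp only [rangeSum_eq] at this ⊢
        rwa [Finset.sum_range_succ]
    · rcases Nat.mod_two_eq_zero_or_one (x i / 2 ^ (N - 1 - k)) with h | h
      · simpa [h] using hK1 (hK h0)
      · simpa [h] using hK1 (hK (hB i hi))
    · have h1 : (rangeSum c fun j => B j * (x j / 2 ^ (N - k))) ∈ K' := by
        rcases k with _ | k
        · rw [rangeSum_eq, Nat.sub_zero, hT]; exact hK h0
        · refine hK' k (by omega) ?_
          simp only [rangeSum_eq]
          rw [hQ k (by omega), additionSums_append]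
          simp [additionSums_cons]
      have h2 : (rangeSum c fun j => B j * (x j / 2 ^ (N - 1 - k) % 2)) ∈ K' ∪ additionSums
          ((List.range c).map fun i => (rangeSum i fun j => B j * (x j / 2 ^ (N - 1 - k) % 2),
            B i * (x i / 2 ^ (N - 1 - k) % 2))) := by
        rcases c with _ | c
        · exact Finset.mem_union_left _ (hK h0)
        · refine Finset.mem_union_right _ ((additionSums_map_range _ _ _).2 ⟨c, by omega, ?_⟩)
          simp only [rangeSum_eq]
          rw [Finset.sum_range_succ]
      refine ⟨Finset.mem_union_left _ h1, Finset.mem_union_left _ h1, ?_, ?_, trivial⟩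
      · rw [← two_mul]; exact Finset.mem_insert_self _ _
      · exact Finset.mem_insert_of_mem h2
  · rcases N with _ | N
    · have := hT
      simp only [pow_zero, Nat.div_one] at this
      rw [this]
      exact Finset.mem_union_left _ h0
    · refine Finset.mem_union_right _ (mem_additionSums_flatMap.2 ⟨N, by omega, ?_⟩)
      have := hQ N (by omega)
      simp only [Nat.sub_self, pow_zero, Nat.div_one] at this
      rw [this, additionSums_append]
      simp [additionSums_cons, rangeSum_eq]

/-- The sums of the first kind are subset sums of the bases. They do not depend on the `x i` beyond
the choice of the subset, so different chains can share them; the other two are the values in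
Horner's rule. -/
theorem mem_additionSums_multiChain {c N e : ℕ} {B x : ℕ → ℕ}
    (h : e ∈ additionSums (multiChain c B x N)) : ∃ b,
      (∃ i < c, e = ∑ j ∈ Finset.range (i + 1), B j * (x j / 2 ^ b % 2)) ∨
      e = 2 * (∑ j ∈ Finset.range c, B j * (x j / 2 ^ (b + 1))) ∨
      e = 2 * (∑ j ∈ Finset.range c, B j * (x j / 2 ^ (b + 1))) +
        ∑ j ∈ Finset.range c, B j * (x j / 2 ^ b % 2) := by
  obtain ⟨k, hk, h⟩ := mem_additionSums_flatMap.1 h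
  refine ⟨N - 1 - k, ?_⟩
  rw [show N - 1 - k + 1 = N - k by omega]
  rw [additionSums_append, Finset.mem_union, additionSums_map_range] at h
  rcases h with ⟨i, hi, h⟩ | h
  · refine .inl ⟨i, hi, ?_⟩
    rw [← h, rangeSum_eq, Finset.sum_range_succ]
  · simp only [additionSums_cons, additionSums_nil, Finset.mem_insert, Finset.notMem_empty,
      or_false, ← two_mul, rangeSum_eq] at h
    exact .inr h

/-- Additions that lead from `A` to `A * p ^ k` for all `k ≤ n`. -/
def powChain (p A n : ℕ) : List (ℕ × ℕ) :=
  (List.range n).flatMap fun k => mulChain (A * p ^ k) p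

@[fun_prop] theorem primrec_powChain {α : Type*} [Primcodable α] {p A n : α → ℕ}
    (hp : Primrec p) (hA : Primrec A) (hn : Primrec n) :
    Primrec fun a => powChain (p a) (A a) (n a) := by
  unfold powChain; fun_prop

theorem powChain_spec {p A n : ℕ} {K : Finset ℕ} (h0 : 0 ∈ K) (hA : A ∈ K) :
    IsAdditionChain K (powChain p A n) ∧
      ∀ k ≤ n, A * p ^ k ∈ K ∪ additionSums (powChain p A n) := by
  induction n with
  | zero =>
    refine ⟨trivial, fun k hk => ?_⟩
    obtain rfl : k = 0 := by omega
    exact Finset.mem_union_left _ (by simpa using hA)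
  | succ n ih =>
    have e : powChain p A (n + 1) = powChain p A n ++ mulChain (A * p ^ n) p := by
      simp [powChain, List.range_succ]
    have h := mulChain_spec (A := A * p ^ n) (n := p) (K := K ∪ additionSums (powChain p A n))
      (Finset.mem_union_left _ h0) (ih.2 n le_rfl)
    rw [e, isAdditionChain_append, additionSums_append, ← Finset.union_assoc]
    refine ⟨⟨ih.1, h.1⟩, fun k hk => ?_⟩
    rcases Nat.lt_or_ge k (n + 1) with hk | hk'
    · exact Finset.mem_union_left _ (ih.2 k (by omega))
    · obtain rfl : k = n + 1 := by omega
      rw [pow_succ, ← mul_assoc]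
      exact h.2

/-- The sums in `powChain p A n`, up to `0`. -/
def powChainSet (p A n : ℕ) : Finset ℕ :=
  (Finset.range n).biUnion fun k => insert (A * p ^ k) (mulChainSet (A * p ^ k) p)

theorem card_powChainSet_le (p A n : ℕ) :
    (powChainSet p A n).card ≤ n * (2 * Nat.log 2 p + 1) := by
  refine (Finset.card_biUnion_le_card_mul _ _ (2 * Nat.log 2 p + 1) fun k _ => ?_).trans
    (by simp)
  exact (Finset.card_insert_le _ _).trans (Nat.succ_le_succ (card_mulChainSet_le _ _))

theorem additionSums_powChain_subset {p A n n' : ℕ} (h : n ≤ n') :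
    additionSums (powChain p A n) ⊆ {0} ∪ powChainSet p A n' := by
  intro e he
  obtain ⟨k, hk, he⟩ := mem_additionSums_flatMap.1 he
  have := additionSums_mulChain_subset _ _ he
  simp only [Finset.mem_union, Finset.mem_insert, Finset.mem_singleton] at this ⊢
  rcases this with (h | h) | h'
  · exact .inl h
  all_goals
    refine .inr (Finset.mem_biUnion.2 ⟨k, by simp; omega, ?_⟩)
    simp [*]

/-! ### Powers whose exponents become known digit by digit. -/

theorem sum_digits_add_mod (P Y a c : ℕ) :
    Y % P ^ a + ∑ i ∈ Finset.range c, P ^ (a + i) * (Y / P ^ (a + i) % P) = Y % P ^ (a + c) := by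
  induction c with
  | zero => simp
  | succ c ih =>
    rw [Finset.sum_range_succ, ← add_assoc, ih, ← add_assoc a c 1, Nat.mod_pow_succ]

/-- The exponent in the online algorithm for the block `[y * w ^ s, (y + 1) * w ^ s)` of positions:
the digits of `X` below the block, shifted such that the last position of the block lands at
position `ℓ - 1`. -/
def blockExp (p ℓ w X s y : ℕ) : ℕ := p ^ (ℓ - (y + 1) * w ^ s) * (X % p ^ (y * w ^ s))

/-- The left siblings of block `y` are the blocks `y / w * w + i` with `i < y % w`. Each of them
holds one digit in base `p ^ w ^ s`, and this is the place value of that digit after the shift that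
belongs to `y`. -/
def blockBase (p ℓ w s y i : ℕ) : ℕ := p ^ (ℓ - (y + 1) * w ^ s + (y / w * w + i) * w ^ s)

def blockDigit (p w X s y i : ℕ) : ℕ :=
  X % p ^ (y * w ^ s) / p ^ ((y / w * w + i) * w ^ s) % p ^ w ^ s

/-- The amount by which block `y` is shifted further than its parent. By truncated subtraction,
blocks that end beyond `ℓ` are not shifted at all. -/
def blockShift (ℓ w s y : ℕ) : ℕ := (ℓ - (y + 1) * w ^ s) - (ℓ - (y / w + 1) * w ^ (s + 1))

/-- Additions that lead from `blockExp p ℓ w X (s + 1) (y / w)` to `blockExp p ℓ w X s y`. -/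
def blockChain (p ℓ w X s y : ℕ) : List (ℕ × ℕ) :=
  powChain p (blockExp p ℓ w (X % p ^ (y * w ^ s)) (s + 1) (y / w)) (blockShift ℓ w s y) ++
  (multiChain (y % w) (blockBase p ℓ w s y) (blockDigit p w X s y) (p * w ^ s) ++
  [(blockExp p ℓ w (X % p ^ (y * w ^ s)) (s + 1) (y / w) * p ^ blockShift ℓ w s y,
    rangeSum (y % w) fun i => blockBase p ℓ w s y i * blockDigit p w X s y i)])

/-- Additions that lead to the exponent `p ^ (ℓ - 1 - t) * (X % p ^ t)`. Only the digits of `X`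
below `t` matter, and for different `t` the additions have many sums in common. -/
def onlineChain (p ℓ w X t : ℕ) : List (ℕ × ℕ) :=
  powChain p 1 ℓ ++
    (List.range (ℓ + 1)).flatMap fun i => blockChain p ℓ w X (ℓ - i) (t / w ^ (ℓ - i))

section Primrec

variable {α : Type*} [Primcodable α]

@[fun_prop] theorem primrec_blockExp {p ℓ w X s y : α → ℕ} (hp : Primrec p) (hℓ : Primrec ℓ)
    (hw : Primrec w) (hX : Primrec X) (hs : Primrec s) (hy : Primrec y) :
    Primrec fun a => blockExp (p a) (ℓ a) (w a) (X a) (s a) (y a) := by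
  unfold blockExp; fun_prop

@[fun_prop] theorem primrec_blockBase {p ℓ w s y i : α → ℕ} (hp : Primrec p) (hℓ : Primrec ℓ)
    (hw : Primrec w) (hs : Primrec s) (hy : Primrec y) (hi : Primrec i) :
    Primrec fun a => blockBase (p a) (ℓ a) (w a) (s a) (y a) (i a) := by
  unfold blockBase; fun_prop

@[fun_prop] theorem primrec_blockDigit {p w X s y i : α → ℕ} (hp : Primrec p)
    (hw : Primrec w) (hX : Primrec X) (hs : Primrec s) (hy : Primrec y) (hi : Primrec i) :
    Primrec fun a => blockDigit (p a) (w a) (X a) (s a) (y a) (i a) := by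
  unfold blockDigit; fun_prop

@[fun_prop] theorem primrec_blockShift {ℓ w s y : α → ℕ} (hℓ : Primrec ℓ)
    (hw : Primrec w) (hs : Primrec s) (hy : Primrec y) :
    Primrec fun a => blockShift (ℓ a) (w a) (s a) (y a) := by
  unfold blockShift; fun_prop

@[fun_prop] theorem primrec_blockChain {p ℓ w X s y : α → ℕ} (hp : Primrec p) (hℓ : Primrec ℓ)
    (hw : Primrec w) (hX : Primrec X) (hs : Primrec s) (hy : Primrec y) :
    Primrec fun a => blockChain (p a) (ℓ a) (w a) (X a) (s a) (y a) := by
  unfold blockChain; fun_prop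

@[fun_prop] theorem primrec_onlineChain {p ℓ w X t : α → ℕ} (hp : Primrec p) (hℓ : Primrec ℓ)
    (hw : Primrec w) (hX : Primrec X) (ht : Primrec t) :
    Primrec fun a => onlineChain (p a) (ℓ a) (w a) (X a) (t a) := by
  unfold onlineChain; fun_prop

end Primrec

variable {p ℓ w X s y t : ℕ}

/-- The parent does not start after its child, so discarding the digits of `X` from the start of the
child onwards does not affect it. -/
theorem blockExp_parent (hy : y / w * w ≤ y) :
    blockExp p ℓ w (X % p ^ (y * w ^ s)) (s + 1) (y / w) = blockExp p ℓ w X (s + 1) (y / w) := by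
  unfold blockExp
  rw [Nat.mod_mod_of_dvd]
  refine pow_dvd_pow p ?_
  rw [pow_succ', ← mul_assoc]
  exact Nat.mul_le_mul_right _ hy

theorem blockChain_mod (h : y * w ^ s ≤ t) :
    blockChain p ℓ w (X % p ^ t) s y = blockChain p ℓ w X s y := by
  have : X % p ^ t % p ^ (y * w ^ s) = X % p ^ (y * w ^ s) :=
    Nat.mod_mod_of_dvd _ (pow_dvd_pow p h)
  have e : blockDigit p w (X % p ^ t) s y = blockDigit p w X s y := by
    funext i; simp only [blockDigit, this]
  simp only [blockChain, this, e]

/-- Only digits below position `t` enter the chain; hence it can be formed before the others are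
known. -/
theorem onlineChain_mod : onlineChain p ℓ w (X % p ^ t) t = onlineChain p ℓ w X t := by
  unfold onlineChain
  congr 2
  funext i
  exact blockChain_mod (Nat.div_mul_le_self _ _)

theorem blockShift_eq (hw : 0 < w) :
    ℓ - (y / w + 1) * w ^ (s + 1) + blockShift ℓ w s y = ℓ - (y + 1) * w ^ s := by
  have h1 : (y + 1) * w ^ s ≤ (y / w + 1) * w ^ (s + 1) := by
    rw [pow_succ', ← mul_assoc]
    exact Nat.mul_le_mul_right _ (Nat.lt_div_mul_add hw |>.trans_eq (by ring))
  unfold blockShift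
  omega

theorem blockShift_le : blockShift ℓ w s y ≤ min (w ^ (s + 1)) ℓ := by
  have h1 : y / w * w ^ (s + 1) ≤ y * w ^ s := by
    rw [pow_succ', ← mul_assoc]
    exact Nat.mul_le_mul_right _ (Nat.div_mul_le_self y w)
  have h2 : (y / w + 1) * w ^ (s + 1) = y / w * w ^ (s + 1) + w ^ (s + 1) := by ring
  have h3 : (y + 1) * w ^ s = y * w ^ s + w ^ s := by ring
  unfold blockShift
  refine le_min ?_ ?_ <;> omega

/-- The digits below block `y` are those below its parent, followed by those of its left siblings.
-/
theorem blockExp_eq (hw : 0 < w) :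
    blockExp p ℓ w X s y =
      blockExp p ℓ w X (s + 1) (y / w) * p ^ blockShift ℓ w s y +
        ∑ i ∈ Finset.range (y % w), blockBase p ℓ w s y i * blockDigit p w X s y i := by
  have hy : y / w * w + y % w = y := Nat.div_add_mod' y w
  have h := sum_digits_add_mod (p ^ w ^ s) (X % p ^ (y * w ^ s)) (y / w * w) (y % w)
  simp only [← pow_mul, mul_comm (w ^ s)] at h
  rw [hy, Nat.mod_mod, Nat.mod_mod_of_dvd _ (pow_dvd_pow p (Nat.mul_le_mul_right _
    (Nat.div_mul_le_self y w)))] at h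
  unfold blockExp
  conv_lhs => rw [← h]
  rw [mul_add, Finset.mul_sum]
  congr 1
  · rw [← blockShift_eq (ℓ := ℓ) (s := s) (y := y) hw, pow_add,
      show y / w * w ^ (s + 1) = y / w * w * w ^ s by ring]
    ring
  · refine Finset.sum_congr rfl fun i _ => ?_
    simp only [blockBase, blockDigit, pow_add]
    ring

theorem blockChain_spec {K : Finset ℕ} (hp : 1 < p) (hw : 0 < w) (h0 : 0 ∈ K)
    (hP : ∀ k ≤ ℓ, p ^ k ∈ K) (hy : y * w ^ s < ℓ)
    (hR : blockExp p ℓ w X (s + 1) (y / w) ∈ K) :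
    IsAdditionChain K (blockChain p ℓ w X s y) ∧
      blockExp p ℓ w X s y ∈ K ∪ additionSums (blockChain p ℓ w X s y) := by
  have hB : ∀ i < y % w, blockBase p ℓ w s y i ∈ K := by
    intro i hi
    refine hP _ ?_
    have h1 : (y / w * w + i + 1) * w ^ s ≤ y * w ^ s :=
      Nat.mul_le_mul_right _ (by have := Nat.div_add_mod' y w; omega)
    have h2 : (y / w * w + i + 1) * w ^ s = (y / w * w + i) * w ^ s + w ^ s := by ring
    have h3 : (y + 1) * w ^ s = y * w ^ s + w ^ s := by ring
    omega
  -- The bound `p < 2 ^ p` is generous, but surplus binary positions only give the sum `0`.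
  have hx : ∀ i < y % w, blockDigit p w X s y i < 2 ^ (p * w ^ s) := by
    intro i hi
    refine (Nat.mod_lt _ (by positivity)).trans_le ?_
    rw [pow_mul]
    exact Nat.pow_le_pow_left Nat.lt_two_pow_self.le _
  unfold blockChain
  rw [blockExp_parent (Nat.div_mul_le_self _ _)]
  have h1 := powChain_spec (p := p) (n := blockShift ℓ w s y) h0 hR
  have h2 := multiChain_spec (K := K ∪ additionSums (powChain p
      (blockExp p ℓ w X (s + 1) (y / w)) (blockShift ℓ w s y)))
    (Finset.mem_union_left _ h0) (fun i hi => Finset.mem_union_left _ (hB i hi)) hx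
  simp only [isAdditionChain_append, additionSums_append, ← Finset.union_assoc]
  refine ⟨⟨h1.1, h2.1, Finset.mem_union_left _ (h1.2 _ le_rfl), ?_, trivial⟩, ?_⟩
  · rw [rangeSum_eq]
    exact h2.2
  · refine Finset.mem_union_right _ ?_
    rw [additionSums_cons, rangeSum_eq, ← blockExp_eq hw]
    exact Finset.mem_insert_self _ _

/-- The chain descends through the blocks that contain position `t`: from level `ℓ`, where `t < w ^
ℓ` forces index `0` and exponent `0`, to level `0`, where the block is the single position `t` and
`blockExp` is the required exponent. -/
theorem onlineChain_spec {K : Finset ℕ} (hp : 1 < p) (hw : 1 < w) (h0 : 0 ∈ K) (h1 : 1 ∈ K)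
    (ht : t < ℓ) :
    IsAdditionChain K (onlineChain p ℓ w X t) ∧
      p ^ (ℓ - 1 - t) * (X % p ^ t) ∈ K ∪ additionSums (onlineChain p ℓ w X t) ∧
      ∀ k ≤ ℓ, p ^ k ∈ K ∪ additionSums (onlineChain p ℓ w X t) := by
  have hpow := powChain_spec (p := p) (n := ℓ) h0 h1
  simp only [one_mul] at hpow
  have key : ∀ i ≤ ℓ, ∀ K', K ∪ additionSums (powChain p 1 ℓ) ⊆ K' →
      (∀ j < i, additionSums (blockChain p ℓ w X (ℓ - j) (t / w ^ (ℓ - j))) ⊆ K') →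
      IsAdditionChain K' (blockChain p ℓ w X (ℓ - i) (t / w ^ (ℓ - i))) ∧
      blockExp p ℓ w X (ℓ - i) (t / w ^ (ℓ - i)) ∈
        K' ∪ additionSums (blockChain p ℓ w X (ℓ - i) (t / w ^ (ℓ - i))) := by
    intro i
    induction i with
    | zero =>
      intro _ K' hK _
      refine blockChain_spec hp (by omega) (hK (Finset.mem_union_left _ h0))
        (fun k hk => hK (hpow.2 k hk)) ((Nat.div_mul_le_self _ _).trans_lt ht) ?_
      have : t / w ^ ℓ = 0 := Nat.div_eq_of_lt (ht.trans (Nat.lt_pow_self hw))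
      simp only [Nat.sub_zero, this, Nat.zero_div, blockExp, zero_mul, pow_zero, Nat.mod_one,
        mul_zero]
      exact hK (Finset.mem_union_left _ h0)
    | succ i ih =>
      intro hi K' hK hj
      refine blockChain_spec hp (by omega) (hK (Finset.mem_union_left _ h0))
        (fun k hk => hK (hpow.2 k hk)) ((Nat.div_mul_le_self _ _).trans_lt ht) ?_
      have h := (ih (by omega) K' hK fun j hj' => hj j (by omega)).2
      rw [Finset.union_eq_left.2 (hj i (by omega))] at h
      rwa [Nat.div_div_eq_div_mul, ← pow_succ, show ℓ - (i + 1) + 1 = ℓ - i by omega]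
  unfold onlineChain
  rw [isAdditionChain_append, additionSums_append, ← Finset.union_assoc]
  refine ⟨⟨hpow.1, isAdditionChain_flatMap_range fun i hi K' hK hj =>
    (key i (by omega) K' hK hj).1⟩, ?_, fun k hk => Finset.mem_union_left _ (hpow.2 k hk)⟩
  have h := (key ℓ le_rfl (K ∪ additionSums (powChain p 1 ℓ) ∪ additionSums
    ((List.range (ℓ + 1)).flatMap fun i => blockChain p ℓ w X (ℓ - i) (t / w ^ (ℓ - i))))
    Finset.subset_union_left fun j hj e he => Finset.mem_union_right _
      (mem_additionSums_flatMap.2 ⟨j, by omega, he⟩)).2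
  rw [Finset.union_eq_left.2 fun e he => Finset.mem_union_right _
      (mem_additionSums_flatMap.2 ⟨ℓ, by omega, he⟩)] at h
  have e : blockExp p ℓ w X (ℓ - ℓ) (t / w ^ (ℓ - ℓ)) = p ^ (ℓ - 1 - t) * (X % p ^ t) := by
    simp only [blockExp, Nat.sub_self, pow_zero, Nat.div_one, mul_one]
    congr 2; omega
  rwa [e] at h

/-- The nontrivial sums at level `s` of the online algorithm. -/
def levelSet (p ℓ w X s : ℕ) : Finset ℕ :=
  ((Finset.range (ℓ / w ^ (s + 1) + 1)).biUnion fun v =>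
    powChainSet p (blockExp p ℓ w X (s + 1) v) (min (w ^ (s + 1)) ℓ)) ∪
  ((Finset.range (ℓ / w ^ s + 1)).biUnion fun y => insert (blockExp p ℓ w X s y)
    ((Finset.range (w ^ s * (Nat.log 2 p + 1))).biUnion fun b =>
      {2 * (∑ j ∈ Finset.range (y % w),
          blockBase p ℓ w s y j * (blockDigit p w X s y j / 2 ^ (b + 1))),
        2 * (∑ j ∈ Finset.range (y % w),
          blockBase p ℓ w s y j * (blockDigit p w X s y j / 2 ^ (b + 1))) +
        ∑ j ∈ Finset.range (y % w),
          blockBase p ℓ w s y j * (blockDigit p w X s y j / 2 ^ b % 2)})) ∪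
  (Finset.range (w + 1)).powerset.image (fun T => ∑ e ∈ T, p ^ (ℓ - e * w ^ s)) ∪
  (Finset.range w).powerset.image
    (fun T => ∑ i ∈ T, p ^ (((ℓ - 1) / w ^ s / w * w + i) * w ^ s))

/-- Bounds the total length of the blocks of one level, the last and possibly incomplete one
included. -/
theorem div_succ_mul_le {a ℓ : ℕ} : (ℓ / a + 1) * min a ℓ ≤ 2 * ℓ := by
  rcases le_total a ℓ with h | h
  · rw [min_eq_left h]
    have := Nat.div_mul_le_self ℓ a
    linarith
  · rw [min_eq_right h]
    have : ℓ / a ≤ 1 := Nat.div_le_of_le_mul (by linarith)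
    exact Nat.mul_le_mul_right _ (by omega)

/-- The number of blocks times their length is `O(ℓ)`, which accounts for the shifts and for the
Horner steps. The two tables of subset sums have at most `2 ^ (w + 1)` and `2 ^ w` entries, together
`3 * 2 ^ w`. -/
theorem card_levelSet_le (hs : w ^ s ≤ ℓ) (hw : 0 < w) :
    (levelSet p ℓ w X s).card ≤
      2 * ℓ * (2 * Nat.log 2 p + 1) + 2 * ℓ + 4 * ℓ * (Nat.log 2 p + 1) + 3 * 2 ^ w := by
  have hW : 0 < w ^ s := by positivity
  have h1 : ((Finset.range (ℓ / w ^ (s + 1) + 1)).biUnion fun v =>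
      powChainSet p (blockExp p ℓ w X (s + 1) v) (min (w ^ (s + 1)) ℓ)).card ≤
      2 * ℓ * (2 * Nat.log 2 p + 1) := by
    refine (Finset.card_biUnion_le_card_mul _ _ _ fun v _ => card_powChainSet_le _ _ _).trans ?_
    rw [Finset.card_range, ← mul_assoc]
    exact Nat.mul_le_mul_right _ div_succ_mul_le
  have h2 : ((Finset.range (ℓ / w ^ s + 1)).biUnion fun y => insert (blockExp p ℓ w X s y)
      ((Finset.range (w ^ s * (Nat.log 2 p + 1))).biUnion fun b =>
      {2 * (∑ j ∈ Finset.range (y % w),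
          blockBase p ℓ w s y j * (blockDigit p w X s y j / 2 ^ (b + 1))),
        2 * (∑ j ∈ Finset.range (y % w),
          blockBase p ℓ w s y j * (blockDigit p w X s y j / 2 ^ (b + 1))) +
        ∑ j ∈ Finset.range (y % w),
          blockBase p ℓ w s y j * (blockDigit p w X s y j / 2 ^ b % 2)})).card ≤
      2 * ℓ + 4 * ℓ * (Nat.log 2 p + 1) := by
    refine (Finset.card_biUnion_le_card_mul _ _ (w ^ s * (Nat.log 2 p + 1) * 2 + 1)
      fun y _ => ?_).trans ?_
    · refine (Finset.card_insert_le _ _).trans (Nat.succ_le_succ ?_)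
      refine (Finset.card_biUnion_le_card_mul _ _ 2 fun b _ => Finset.card_le_two).trans ?_
      rw [Finset.card_range]
    · have e1 := div_succ_mul_le (a := w ^ s) (ℓ := ℓ)
      rw [min_eq_left hs] at e1
      have e2 : ℓ / w ^ s + 1 ≤ 2 * ℓ :=
        (Nat.le_mul_of_pos_right _ hW).trans e1
      rw [Finset.card_range]
      calc (ℓ / w ^ s + 1) * (w ^ s * (Nat.log 2 p + 1) * 2 + 1)
          = (ℓ / w ^ s + 1) * w ^ s * ((Nat.log 2 p + 1) * 2) + (ℓ / w ^ s + 1) := by ring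
        _ ≤ 2 * ℓ * ((Nat.log 2 p + 1) * 2) + 2 * ℓ :=
          Nat.add_le_add (Nat.mul_le_mul_right _ e1) e2
        _ = _ := by ring
  have h3 : ((Finset.range (w + 1)).powerset.image
      (fun T => ∑ e ∈ T, p ^ (ℓ - e * w ^ s))).card ≤ 2 * 2 ^ w := by
    refine Finset.card_image_le.trans ?_
    rw [Finset.card_powerset, Finset.card_range, pow_succ, mul_comm]
  have h4 : ((Finset.range w).powerset.image
      (fun T => ∑ i ∈ T, p ^ (((ℓ - 1) / w ^ s / w * w + i) * w ^ s))).card ≤ 2 ^ w := by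
    refine Finset.card_image_le.trans ?_
    rw [Finset.card_powerset, Finset.card_range]
  unfold levelSet
  refine (Finset.card_union_le _ _).trans ?_
  refine (Nat.add_le_add ((Finset.card_union_le _ _).trans
    (Nat.add_le_add ((Finset.card_union_le _ _).trans (Nat.add_le_add h1 h2)) h3)) h4).trans ?_
  linarith

theorem sum_mul_mod_two (c : ℕ) (B x : ℕ → ℕ) :
    ∑ j ∈ Finset.range c, B j * (x j % 2) = ∑ j ∈ (Finset.range c).filter (x · % 2 = 1), B j := by
  rw [Finset.sum_filter]
  refine Finset.sum_congr rfl fun j _ => ?_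
  rcases Nat.mod_two_eq_zero_or_one (x j) with h | h <;> simp [h]

theorem additionSums_blockChain_subset (hp : 0 < p) (hw : 1 < w) (hy : y * w ^ s < ℓ) :
    additionSums (blockChain p ℓ w X s y) ⊆ {0} ∪ levelSet p ℓ w X s := by
  have hW : 0 < w ^ s := by positivity
  have hyl : y ∈ Finset.range (ℓ / w ^ s + 1) := by
    rw [Finset.mem_range, Nat.lt_succ_iff, Nat.le_div_iff_mul_le hW]; exact hy.le
  have hdiv : y / w * w + y % w = y := Nat.div_add_mod' y w
  have hmod : y % w < w := Nat.mod_lt _ (by omega)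
  intro e he
  unfold blockChain at he
  rw [blockExp_parent (Nat.div_mul_le_self _ _)] at he
  simp only [additionSums_append, Finset.mem_union] at he
  rcases he with he | he | he
  · have := additionSums_powChain_subset blockShift_le he
    rw [Finset.mem_union] at this ⊢
    refine this.imp_right fun h => Finset.mem_union_left _ (Finset.mem_union_left _
      (Finset.mem_union_left _ (Finset.mem_biUnion.2 ⟨y / w, ?_, h⟩)))
    rw [Finset.mem_range, Nat.lt_succ_iff, Nat.le_div_iff_mul_le (by positivity), pow_succ',
      ← mul_assoc]
    exact (Nat.mul_le_mul_right _ (Nat.div_mul_le_self y w)).trans hy.le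
  · obtain ⟨b, hb⟩ := mem_additionSums_multiChain he
    rcases hb with ⟨i, hi, rfl⟩ | hb
    · rw [sum_mul_mod_two]
      refine Finset.mem_union_right _ ?_
      by_cases hl : (y + 1) * w ^ s ≤ ℓ
      · refine Finset.mem_union_left _ (Finset.mem_union_right _ (Finset.mem_image.2
          ⟨((Finset.range (i + 1)).filter (blockDigit p w X s y · / 2 ^ b % 2 = 1)).image
            (fun j => y % w + 1 - j), ?_, ?_⟩))
        · rw [Finset.mem_powerset]
          intro x hx
          simp only [Finset.mem_image, Finset.mem_range] at hx ⊢
          omega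
        · rw [Finset.sum_image]
          · refine Finset.sum_congr rfl fun j hj => ?_
            simp only [Finset.mem_filter, Finset.mem_range] at hj
            unfold blockBase
            congr 1
            have e1 : (y % w + 1 - j) * w ^ s + (y / w * w + j) * w ^ s = (y + 1) * w ^ s := by
              rw [← add_mul]; congr 1; omega
            omega
          · intro a ha b hb hab
            simp only [Finset.coe_filter, Finset.mem_range, Set.mem_ofPred_eq] at ha hb hab
            omega
      · refine Finset.mem_union_right _ (Finset.mem_image.2
          ⟨(Finset.range (i + 1)).filter (blockDigit p w X s y · / 2 ^ b % 2 = 1), ?_, ?_⟩)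
        · rw [Finset.mem_powerset]
          intro x hx
          simp only [Finset.mem_filter, Finset.mem_range] at hx ⊢
          omega
        · have hy' : (ℓ - 1) / w ^ s = y := by
            have h3 : (y + 1) * w ^ s = y * w ^ s + w ^ s := by ring
            rw [Nat.div_eq_iff hW]
            constructor <;> omega
          refine Finset.sum_congr rfl fun j hj => ?_
          rw [hy', blockBase, Nat.sub_eq_zero_of_le (by omega), zero_add]
    -- Beyond the binary length of a digit both Horner values are `0`.
    · by_cases hbs : b < w ^ s * (Nat.log 2 p + 1)
      · refine Finset.mem_union_right _ (Finset.mem_union_left _ (Finset.mem_union_left _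
          (Finset.mem_union_right _ (Finset.mem_biUnion.2 ⟨y, hyl, Finset.mem_insert_of_mem
          (Finset.mem_biUnion.2 ⟨b, Finset.mem_range.2 hbs, ?_⟩)⟩))))
        simpa using hb
      · have hd : ∀ j, blockDigit p w X s y j < 2 ^ b := by
          intro j
          refine (Nat.mod_lt _ (by positivity)).trans_le ?_
          calc p ^ w ^ s ≤ (2 ^ (Nat.log 2 p + 1)) ^ w ^ s :=
                Nat.pow_le_pow_left (Nat.lt_pow_succ_log_self (by norm_num) p).le _
            _ = 2 ^ (w ^ s * (Nat.log 2 p + 1)) := by rw [← pow_mul, mul_comm]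
            _ ≤ 2 ^ b := Nat.pow_le_pow_right (by norm_num) (by omega)
        have hd' : ∀ j, blockDigit p w X s y j / 2 ^ (b + 1) = 0 := fun j =>
          Nat.div_eq_of_lt ((hd j).trans (Nat.pow_lt_pow_right (by norm_num) (by omega)))
        simp only [hd', Nat.div_eq_of_lt (hd _), Nat.zero_mod, mul_zero, Finset.sum_const_zero,
          add_zero, or_self] at hb
        simp [hb]
  · rw [additionSums_cons, rangeSum_eq, ← blockExp_eq (by omega)] at he
    simp only [additionSums_nil, Finset.mem_insert, Finset.notMem_empty, or_false] at he
    refine Finset.mem_union_right _ (Finset.mem_union_left _ (Finset.mem_union_left _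
          (Finset.mem_union_right _ (Finset.mem_biUnion.2 ⟨y, hyl, ?_⟩))))
    rw [he]
    exact Finset.mem_insert_self _ _

/-- No digits lie below block `0`. This makes the levels `s` with `ℓ ≤ w ^ s` free, since there `t`
lies in block `0`. -/
theorem additionSums_blockChain_zero :
    additionSums (blockChain p ℓ w X s 0) ⊆ {0} := by
  intro e he
  have h : blockExp p ℓ w (X % p ^ (0 * w ^ s)) (s + 1) (0 / w) = 0 := by
    simp [blockExp, Nat.mod_one]
  unfold blockChain at he
  simp only [additionSums_append, Finset.mem_union, h] at he
  rcases he with he | he | he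
  · obtain ⟨k, hk, he⟩ := mem_additionSums_flatMap.1 he
    obtain ⟨i, hi, he⟩ := mem_additionSums_flatMap.1 he
    simpa [additionSums_cons] using he
  · obtain ⟨b, hb⟩ := mem_additionSums_multiChain he
    simpa using hb
  · simpa [additionSums_cons, rangeSum_eq] using he

/-- All the sums that occur in the online algorithm. -/
def onlineSet (p ℓ w X : ℕ) : Finset ℕ :=
  {0, 1} ∪ powChainSet p 1 ℓ ∪
    (Finset.range (Nat.clog w ℓ)).biUnion fun s => levelSet p ℓ w X s

theorem additionSums_onlineChain_subset (hp : 0 < p) (hw : 1 < w) (ht : t < ℓ) :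
    additionSums (onlineChain p ℓ w X t) ⊆ onlineSet p ℓ w X := by
  intro e he
  unfold onlineChain at he
  rw [additionSums_append, Finset.mem_union] at he
  unfold onlineSet
  simp only [Finset.mem_union, Finset.mem_insert, Finset.mem_singleton]
  rcases he with he | he
  · have := additionSums_powChain_subset le_rfl he
    simp only [Finset.mem_union, Finset.mem_singleton] at this
    tauto
  · obtain ⟨i, hi, he⟩ := mem_additionSums_flatMap.1 he
    by_cases hs : ℓ - i < Nat.clog w ℓ
    · have := additionSums_blockChain_subset hp hw
        ((Nat.div_mul_le_self t (w ^ (ℓ - i))).trans_lt ht) he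
      simp only [Finset.mem_union, Finset.mem_singleton] at this
      rcases this with h | h
      · exact .inl (.inl (.inl h))
      · exact .inr (Finset.mem_biUnion.2 ⟨_, Finset.mem_range.2 hs, h⟩)
    · have h1 : ℓ ≤ w ^ (ℓ - i) := (Nat.clog_le_iff_le_pow hw).1 (by omega)
      rw [Nat.div_eq_of_lt (by omega)] at he
      have := additionSums_blockChain_zero he
      simp only [Finset.mem_singleton] at this
      exact .inl (.inl (.inl this))

/-- The assumption `2 ^ w ≤ 8 * ℓ` keeps the tables of subset sums linear in `ℓ`, so that `36 * ℓ *
(Nat.log 2 p + 1)` covers each of the `Nat.clog w ℓ` levels and also the powers of `p`. -/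
theorem card_onlineSet_le (hw : 1 < w) (hℓ : 0 < ℓ) (hw' : 2 ^ w ≤ 8 * ℓ) :
    (onlineSet p ℓ w X).card ≤ 36 * ℓ * (Nat.log 2 p + 1) * (Nat.clog w ℓ + 1) := by
  have h1 : ((Finset.range (Nat.clog w ℓ)).biUnion fun s => levelSet p ℓ w X s).card ≤
      Nat.clog w ℓ * (36 * ℓ * (Nat.log 2 p + 1)) := by
    refine (Finset.card_biUnion_le_card_mul _ _ (36 * ℓ * (Nat.log 2 p + 1)) fun s hs => ?_).trans
      (by rw [Finset.card_range])
    have hs : w ^ s < ℓ := (Nat.lt_clog_iff_pow_lt hw).1 (Finset.mem_range.1 hs)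
    refine (card_levelSet_le hs.le (by omega)).trans ?_
    have : ℓ * 0 ≤ ℓ * Nat.log 2 p := Nat.mul_le_mul_left _ (Nat.zero_le _)
    nlinarith
  have h2 := card_powChainSet_le p 1 ℓ
  unfold onlineSet
  refine (Finset.card_union_le _ _).trans ((Nat.add_le_add ((Finset.card_union_le _ _).trans
    (Nat.add_le_add Finset.card_le_two h2)) h1).trans ?_)
  nlinarith [Nat.zero_le (ℓ * Nat.log 2 p)]

/-! ### Enumeration of products of powers. -/

/-- For each entry `(v, z)` of `T`, extend `v` by each of `0, m, 2 * m, …, (n - 1) * m`, and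
multiply the element `z` by the corresponding power of `x`. -/
def extendBox (x m n : ℕ) (T : List (List ℕ × ℕ)) : QueryM (List (List ℕ × ℕ)) :=
  QueryM.loop T [] fun out q => QueryM.bind
    (QueryM.loop (List.range (n - 1)) [(q.1 ++ [0], q.2)] fun layer c =>
      QueryM.bind (QueryM.ask (layer.getD 0 ([], 0)).2 x)
        fun z => QueryM.ret ((q.1 ++ [(c + 1) * m], z) :: layer))
    fun layer => QueryM.ret (layer ++ out)

/-- List the products of `y` with powers of the generators. Each entry `(x, m, n)` of `gens`
describes a generator: `x` is its `m`-th power, and the exponents are the multiples `c * m` with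
`c < n`. -/
def enumBox (s : ℕ) (gens : List (ℕ × ℕ × ℕ)) (y : ℕ) : QueryM (List (List ℕ × ℕ)) :=
  QueryM.loop (List.range s) [([], y)] fun T i =>
    extendBox (gens.getD i (0, 0, 0)).1 (gens.getD i (0, 0, 0)).2.1 (gens.getD i (0, 0, 0)).2.2 T

section Primrec

variable {α : Type*} [Primcodable α]

@[fun_prop] theorem primrec_extendBox {x m n : α → ℕ} {T : α → List (List ℕ × ℕ)}
    {r : α → List ℕ} (hx : Primrec x) (hm : Primrec m) (hn : Primrec n) (hT : Primrec T)
    (hr : Primrec r) : Primrec fun a => extendBox (x a) (m a) (n a) (T a) (r a) := by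
  unfold extendBox; fun_prop

@[fun_prop] theorem primrec_enumBox {s y : α → ℕ} {gens : α → List (ℕ × ℕ × ℕ)}
    {r : α → List ℕ} (hs : Primrec s) (hg : Primrec gens) (hy : Primrec y)
    (hr : Primrec r) : Primrec fun a => enumBox (s a) (gens a) (y a) (r a) := by
  unfold enumBox; fun_prop

end Primrec

section Enumeration

variable {G : Type*} [CommGroup G] {ident : G → ℕ}

/-- The list `T` consists of the products `y * ∏ i < k, b i ^ v i`, where `v` runs through the
vectors with entries `v i ∈ {0, m i, …, (n i - 1) * m i}`. -/
structure IsBox (ident : G → ℕ) (y : G) (b : ℕ → G) (m n : ℕ → ℕ) (k : ℕ)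
    (T : List (List ℕ × ℕ)) : Prop where
  length : T.length = ∏ i ∈ Finset.range k, n i
  vec : ∀ q ∈ T, q.1.length = k ∧ (∀ i < k, ∃ c < n i, q.1.getD i 0 = c * m i) ∧
    q.2 = ident (y * ∏ i ∈ Finset.range k, b i ^ q.1.getD i 0)
  exists_mem : ∀ c : ℕ → ℕ, (∀ i < k, c i < n i) →
    ∃ q ∈ T, ∀ i < k, q.1.getD i 0 = c i * m i

/-- Entries with last exponent `0` are inherited, and every other entry is one multiplication away
from its predecessor at the head of `layer`. So the cost is the growth of the list. -/
theorem spec_extendBox {y : G} {b : ℕ → G} {m n : ℕ → ℕ} {k : ℕ} {T : List (List ℕ × ℕ)}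
    (hT : IsBox ident y b m n k T) (hn : 0 < n k) :
    QueryM.Spec ident (extendBox (ident (b k ^ m k)) (m k) (n k) T) fun T' c =>
      IsBox ident y b m n (k + 1) T' ∧ T.length + c = T'.length := by
  have app : ∀ (v : List ℕ) (a : ℕ), v.length = k → (∀ i < k, (v ++ [a]).getD i 0 = v.getD i 0) ∧
      (v ++ [a]).getD k 0 = a := by
    intro v a hv
    constructor
    · intro i hi
      rw [List.getD_append _ _ _ _ (by omega)]
    · rw [List.getD_append_right _ _ _ _ (by omega)]; simp [hv]
  have prod_app : ∀ (v : List ℕ) (a : ℕ), v.length = k →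
      ∏ i ∈ Finset.range (k + 1), b i ^ (v ++ [a]).getD i 0 =
        (∏ i ∈ Finset.range k, b i ^ v.getD i 0) * b k ^ a := by
    intro v a hv
    rw [Finset.prod_range_succ, (app v a hv).2]
    congr 1
    exact Finset.prod_congr rfl fun i hi => by rw [(app v a hv).1 i (Finset.mem_range.1 hi)]
  -- the state after the first `j` entries of `T`
  let I : ℕ → List (List ℕ × ℕ) → ℕ → Prop := fun j out c =>
    out.length = j * n k ∧ j + c = out.length ∧
    (∀ q ∈ out, q.1.length = k + 1 ∧ (∀ i < k + 1, ∃ c < n i, q.1.getD i 0 = c * m i) ∧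
      q.2 = ident (y * ∏ i ∈ Finset.range (k + 1), b i ^ q.1.getD i 0)) ∧
    ∀ q ∈ T.take j, ∀ c < n k, ∃ z, (q.1 ++ [c * m k], z) ∈ out
  refine (QueryM.Spec.loop T [] I ⟨by simp, by simp, by simp, by simp⟩ ?_).mono ?_
  · rintro j hj out c ⟨h1, h2, h3, h4⟩
    have hq := hT.vec _ (List.getElem_mem hj)
    set q := T[j] with hq_def
    let J : ℕ → List (List ℕ × ℕ) → ℕ → Prop := fun l layer c =>
      layer.length = l + 1 ∧ c = l ∧
      (∀ q' ∈ layer, ∃ c ≤ l, q' = (q.1 ++ [c * m k],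
        ident (y * ∏ i ∈ Finset.range (k + 1), b i ^ (q.1 ++ [c * m k]).getD i 0))) ∧
      (∀ c ≤ l, ∃ z, (q.1 ++ [c * m k], z) ∈ layer) ∧
      (layer.getD 0 ([], 0)).2 =
        ident (y * ∏ i ∈ Finset.range (k + 1), b i ^ (q.1 ++ [l * m k]).getD i 0)
    refine QueryM.Spec.bind (QueryM.Spec.loop_range (n k - 1) _ J ?_ ?_) ?_
    · have e : (q.1 ++ [0], q.2) = (q.1 ++ [0 * m k],
        ident (y * ∏ i ∈ Finset.range (k + 1), b i ^ (q.1 ++ [0 * m k]).getD i 0)) := by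
        rw [prod_app _ _ hq.1, zero_mul, pow_zero, mul_one, ← hq.2.2]
      refine ⟨rfl, rfl, ?_, ?_, ?_⟩
      · intro q' hq'
        rw [List.mem_singleton] at hq'
        exact ⟨0, le_rfl, hq'.trans e⟩
      · intro c hc
        obtain rfl : c = 0 := by omega
        exact ⟨q.2, by simp⟩
      · exact congrArg Prod.snd e
    · rintro l hl layer c ⟨h5, rfl, h6, h7, h8⟩
      rw [h8]
      have e : (y * ∏ i ∈ Finset.range (k + 1), b i ^ (q.1 ++ [c * m k]).getD i 0) * b k ^ m k =
          y * ∏ i ∈ Finset.range (k + 1), b i ^ (q.1 ++ [(c + 1) * m k]).getD i 0 := by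
        rw [prod_app _ _ hq.1, prod_app _ _ hq.1, add_mul, one_mul, pow_add]
        simp only [mul_assoc]
      refine QueryM.Spec.bind (Q := fun z c' => z = ident (y * ∏ i ∈ Finset.range (k + 1),
        b i ^ (q.1 ++ [(c + 1) * m k]).getD i 0) ∧ c' = 1)
        (QueryM.Spec.ask _ _ ⟨by rw [e], rfl⟩) ?_
      rintro z c' ⟨rfl, rfl⟩
      refine QueryM.Spec.ret ⟨by simp [h5], rfl, ?_, ?_, rfl⟩
      · intro q' hq'
        rcases List.mem_cons.1 hq' with rfl | hq'
        · exact ⟨c + 1, le_rfl, rfl⟩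
        · obtain ⟨d, hd, h⟩ := h6 q' hq'
          exact ⟨d, by omega, h⟩
      · intro d hd
        rcases Nat.lt_or_ge d (c + 1) with h | h
        · obtain ⟨z, hz⟩ := h7 d (by omega)
          exact ⟨z, List.mem_cons_of_mem _ hz⟩
        · obtain rfl : d = c + 1 := by omega
          exact ⟨_, List.mem_cons_self⟩
    · rintro layer c' ⟨h5, rfl, h6, h7, -⟩
      refine QueryM.Spec.ret ⟨?_, ?_, ?_, ?_⟩
      · rw [List.length_append, h5, h1, add_mul]; omega
      · rw [List.length_append, h5]; omega
      · intro q' hq'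
        rcases List.mem_append.1 hq' with hq' | hq'
        · obtain ⟨d, hd, rfl⟩ := h6 q' hq'
          refine ⟨by simp [hq.1], fun i hi => ?_, rfl⟩
          rcases Nat.lt_or_ge i k with h | h
          · obtain ⟨c, hc, hc'⟩ := hq.2.1 i h
            exact ⟨c, hc, by rw [(app _ _ hq.1).1 i h, hc']⟩
          · obtain rfl : i = k := by omega
            exact ⟨d, by omega, (app _ _ hq.1).2⟩
        · exact h3 q' hq'
      · intro q' hq' d hd
        rw [List.take_succ_eq_append_getElem hj, List.mem_append, List.mem_singleton] at hq'
        rcases hq' with hq' | rfl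
        · obtain ⟨z, hz⟩ := h4 q' hq' d hd
          exact ⟨z, List.mem_append_right _ hz⟩
        · obtain ⟨z, hz⟩ := h7 d (by omega)
          exact ⟨z, List.mem_append_left _ hz⟩
  · rintro out c ⟨h1, h2, h3, h4⟩
    refine ⟨⟨?_, h3, ?_⟩, h2⟩
    · rw [h1, hT.length, Finset.prod_range_succ]
    · intro c hc
      obtain ⟨q, hq, hqc⟩ := hT.exists_mem c fun i hi => hc i (by omega)
      obtain ⟨z, hz⟩ := h4 q (by simpa using hq) (c k) (hc k (by omega))
      refine ⟨_, hz, fun i hi => ?_⟩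
      have hl := (hT.vec q hq).1
      rcases Nat.lt_or_ge i k with h | h
      · simp only [(app _ _ hl).1 i h, hqc i h]
      · obtain rfl : i = k := by omega
        exact (app _ _ hl).2

theorem spec_enumBox {y : G} {b : ℕ → G} {m n : ℕ → ℕ} {k : ℕ} (hn : ∀ i < k, 0 < n i)
    {gens : List (ℕ × ℕ × ℕ)}
    (hg : ∀ i < k, gens.getD i (0, 0, 0) = (ident (b i ^ m i), m i, n i)) :
    QueryM.Spec ident (enumBox k gens (ident y)) fun T c =>
      IsBox ident y b m n k T ∧ c + 1 = ∏ i ∈ Finset.range k, n i := by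
  refine (QueryM.Spec.loop_range k _ (fun j T c => IsBox ident y b m n j T ∧ c + 1 = T.length)
    ⟨⟨by simp, by simp, by simp⟩, rfl⟩ ?_).mono fun T c h => ⟨h.1, h.1.length ▸ h.2⟩
  rintro j hj T c ⟨h1, h2⟩
  rw [hg j hj]
  refine (spec_extendBox h1 (hn j hj)).mono ?_
  rintro T' c' ⟨h3, h4⟩
  exact ⟨h3, by omega⟩

end Enumeration

/-! ### Baby-step giant-step search in several generators of order `p`. -/

/-- The role of the generator in the baby-step giant-step search: `0` if it does not take part, else
`1` (baby steps), `2` (both), or `3` (giant steps). Here `f` tells whether it takes part, `r` is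
the number of generators that do, and `a` the number of those before this one. -/
def boxKind (f r a : ℕ) : ℕ :=
  if f = 0 then 0 else if a < r / 2 then 1 else
    if a = r / 2 then (if r % 2 = 1 then 2 else 3) else 3

def babyCount (p κ : ℕ) : ℕ := if κ = 1 then p else if κ = 2 then p.sqrt + 1 else 1

def giantStep (p κ : ℕ) : ℕ := if κ = 2 then p.sqrt + 1 else 1

/-- For kind `2`, the giant exponent is rounded up to a multiple of `p.sqrt + 1`, and the quotient
can be as large as `p.sqrt + 1`. This requires `p.sqrt + 2` values. -/
def giantCount (p κ : ℕ) : ℕ := if κ = 3 then p else if κ = 2 then p.sqrt + 2 else 1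

/-- The kinds of the generators described by the list `bs` of pairs (identifier, flag). -/
def kindAt (k : ℕ) (bs : List (ℕ × ℕ)) (i : ℕ) : ℕ :=
  boxKind (bs.getD i (0, 0)).2 (rangeSum k fun j => (bs.getD j (0, 0)).2)
    (rangeSum i fun j => (bs.getD j (0, 0)).2)

/-- A collision of a giant vector with a baby vector solves the equation with their difference as
exponent; `p - 1` stands for `-1` modulo `p`. -/
def matchBoxes (p k : ℕ) (T₁ T₂ : List (List ℕ × ℕ)) : Option (List ℕ) :=
  T₂.foldl (fun acc q => ((T₁.map fun q' => (q'.2, q'.1)).lookup q.2).elim acc fun v =>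
    some ((List.range k).map fun i => (q.1.getD i 0 + (p - 1) * v.getD i 0) % p)) none

/-- Search for exponents `d i < p` such that `y * ∏ i < k, b i ^ d i = 1`, where the identifiers of
the `b i` are in `bs` together with a flag that tells whether `d i = 0` is required. -/
def searchBox (e p k : ℕ) (bs : List (ℕ × ℕ)) (y : ℕ) : QueryM (Option (List ℕ)) :=
  QueryM.bind (enumBox k ((List.range k).map fun i =>
    ((bs.getD i (0, 0)).1, 1, babyCount p (kindAt k bs i))) e) fun T₁ =>
  QueryM.bind (QueryM.loop (List.range k) [] fun gens i =>
    QueryM.bind (powQuery e (bs.getD i (0, 0)).1 (giantStep p (kindAt k bs i))) fun x =>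
      QueryM.ret (gens ++ [(x, giantStep p (kindAt k bs i), giantCount p (kindAt k bs i))]))
    fun gens =>
  QueryM.bind (enumBox k gens y) fun T₂ =>
  QueryM.ret (matchBoxes p k T₁ T₂)

section Primrec

variable {α : Type*} [Primcodable α]

@[fun_prop] theorem primrec_kindAt {k i : α → ℕ} {bs : α → List (ℕ × ℕ)} (hk : Primrec k)
    (hbs : Primrec bs) (hi : Primrec i) : Primrec fun a => kindAt (k a) (bs a) (i a) := by
  unfold kindAt boxKind; fun_prop

@[fun_prop] theorem primrec_babyCount {p κ : α → ℕ} (hp : Primrec p) (hκ : Primrec κ) :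
    Primrec fun a => babyCount (p a) (κ a) := by
  unfold babyCount; fun_prop

@[fun_prop] theorem primrec_giantStep {p κ : α → ℕ} (hp : Primrec p) (hκ : Primrec κ) :
    Primrec fun a => giantStep (p a) (κ a) := by
  unfold giantStep; fun_prop

@[fun_prop] theorem primrec_giantCount {p κ : α → ℕ} (hp : Primrec p) (hκ : Primrec κ) :
    Primrec fun a => giantCount (p a) (κ a) := by
  unfold giantCount; fun_prop

@[fun_prop] theorem primrec_matchBoxes {p k : α → ℕ} {T₁ T₂ : α → List (List ℕ × ℕ)}
    (hp : Primrec p) (hk : Primrec k) (h₁ : Primrec T₁) (h₂ : Primrec T₂) :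
    Primrec fun a => matchBoxes (p a) (k a) (T₁ a) (T₂ a) := by
  unfold matchBoxes; fun_prop

@[fun_prop] theorem primrec_searchBox {e p k y : α → ℕ} {bs : α → List (ℕ × ℕ)}
    {r : α → List ℕ} (he : Primrec e) (hp : Primrec p) (hk : Primrec k) (hbs : Primrec bs)
    (hy : Primrec y) (hr : Primrec r) :
    Primrec fun a => searchBox (e a) (p a) (k a) (bs a) (y a) (r a) := by
  unfold searchBox; fun_prop

end Primrec

/-- A bound for the cost of the baby-step giant-step search. -/
def searchCost (p r : ℕ) : ℕ :=
  if r = 0 then 0 else 5 * p ^ (r / 2) * (if r % 2 = 1 then p.sqrt + 1 else 1)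

/-- Renumbers the generators that take part in the search, so that the roles depend on the new index
alone. -/
theorem prod_range_flag {M : Type*} [CommMonoid M] {f : ℕ → ℕ} (hf : ∀ i, f i ≤ 1) (g : ℕ → M)
    (i : ℕ) : ∏ j ∈ Finset.range i, (if f j = 0 then 1 else g (∑ l ∈ Finset.range j, f l)) =
      ∏ a ∈ Finset.range (∑ l ∈ Finset.range i, f l), g a := by
  induction i with
  | zero => simp
  | succ i ih =>
    rw [Finset.prod_range_succ, ih, Finset.sum_range_succ]
    have := hf i
    interval_cases h : f i <;> simp [Finset.prod_range_succ]

theorem sum_range_flag {f : ℕ → ℕ} (hf : ∀ i, f i ≤ 1) (g : ℕ → ℕ)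
    (i : ℕ) : ∑ j ∈ Finset.range i, (if f j = 0 then 0 else g (∑ l ∈ Finset.range j, f l)) =
      ∑ a ∈ Finset.range (∑ l ∈ Finset.range i, f l), g a := by
  induction i with
  | zero => simp
  | succ i ih =>
    rw [Finset.sum_range_succ, ih, Finset.sum_range_succ _ i]
    have := hf i
    interval_cases h : f i <;> simp [Finset.sum_range_succ]

theorem boxKind_even {q a : ℕ} : boxKind 1 (2 * q) a = if a < q then 1 else 3 := by
  unfold boxKind
  rw [Nat.mul_div_cancel_left _ (by norm_num)]
  have : ¬ 2 * q % 2 = 1 := by omega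
  split_ifs <;> first | rfl | omega

theorem boxKind_odd {q a : ℕ} :
    boxKind 1 (2 * q + 1) a = if a < q then 1 else if a = q then 2 else 3 := by
  unfold boxKind
  rw [show (2 * q + 1) / 2 = q by omega]
  have : (2 * q + 1) % 2 = 1 := by omega
  split_ifs <;> first | rfl | omega

theorem prod_range_halves {M : Type*} [CommMonoid M] (q : ℕ) (x y : M) :
    ∏ a ∈ Finset.range (2 * q), (if a < q then x else y) = x ^ q * y ^ q := by
  rw [two_mul, Finset.prod_range_add]
  congr 1
  · rw [Finset.prod_congr rfl (g := fun _ => x) fun a ha => by simp [Finset.mem_range.1 ha]]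
    simp
  · simp

theorem prod_range_halves_mid {M : Type*} [CommMonoid M] (q : ℕ) (x y z : M) :
    ∏ a ∈ Finset.range (2 * q + 1), (if a < q then x else if a = q then y else z) =
      x ^ q * y * z ^ q := by
  rw [show 2 * q + 1 = q + 1 + q by ring, Finset.prod_range_add, Finset.prod_range_succ]
  congr 1
  · congr 1
    · rw [Finset.prod_congr rfl (g := fun _ => x) fun a ha => by simp [Finset.mem_range.1 ha]]
      simp
    · simp
  · rw [Finset.prod_congr rfl (g := fun _ => z) fun a ha => by
      rw [if_neg (by omega), if_neg (by omega)]]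
    simp

theorem sum_range_halves_mid (q y : ℕ) :
    ∑ a ∈ Finset.range (2 * q + 1), (if a < q then 0 else if a = q then y else 0) = y := by
  rw [Finset.sum_eq_single q]
  · simp
  · intro b _ hb; simp [hb]
  · intro h; simp at h; omega

/-- For `r = 2 * q` both sides list `p ^ q` products. For odd `r` the middle generator multiplies
the two sides by `p.sqrt + 1` and `p.sqrt + 2`, and its giant step takes at most `2 * Nat.log 2
(p.sqrt + 1)` further operations; the factor `5` covers the total. -/
theorem searchCost_spec {f : ℕ → ℕ} (hf : ∀ i, f i ≤ 1) {k p c₁ c₂ c₃ : ℕ} (hp : 0 < p)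
    (h₁ : c₁ + 1 = ∏ i ∈ Finset.range k, babyCount p
      (boxKind (f i) (∑ l ∈ Finset.range k, f l) (∑ l ∈ Finset.range i, f l)))
    (h₂ : c₂ ≤ ∑ i ∈ Finset.range k, 2 * Nat.log 2 (giantStep p
      (boxKind (f i) (∑ l ∈ Finset.range k, f l) (∑ l ∈ Finset.range i, f l))))
    (h₃ : c₃ + 1 = ∏ i ∈ Finset.range k, giantCount p
      (boxKind (f i) (∑ l ∈ Finset.range k, f l) (∑ l ∈ Finset.range i, f l))) :
    c₁ + (c₂ + c₃) ≤ searchCost p (∑ l ∈ Finset.range k, f l) := by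
  set r := ∑ l ∈ Finset.range k, f l with hr
  have hk : ∀ i, boxKind (f i) r (∑ l ∈ Finset.range i, f l) =
      if f i = 0 then 0 else boxKind 1 r (∑ l ∈ Finset.range i, f l) := by
    intro i
    by_cases h : f i = 0
    · simp [h, boxKind]
    · have := hf i
      rw [if_neg h, show f i = 1 by omega]
  have e₁ := prod_range_flag hf (fun a => babyCount p (boxKind 1 r a)) k
  have e₂ := sum_range_flag hf (fun a => 2 * Nat.log 2 (giantStep p (boxKind 1 r a))) k
  have e₃ := prod_range_flag hf (fun a => giantCount p (boxKind 1 r a)) k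
  have r₁ : ∀ i, (if f i = 0 then 1 else babyCount p (boxKind 1 r (∑ l ∈ Finset.range i, f l))) =
      babyCount p (boxKind (f i) r (∑ l ∈ Finset.range i, f l)) := by
    intro i; rw [hk]; split_ifs <;> simp [babyCount]
  have r₂ : ∀ i, (if f i = 0 then 0 else
      2 * Nat.log 2 (giantStep p (boxKind 1 r (∑ l ∈ Finset.range i, f l)))) =
      2 * Nat.log 2 (giantStep p (boxKind (f i) r (∑ l ∈ Finset.range i, f l))) := by
    intro i; rw [hk]; split_ifs <;> simp [giantStep]
  have r₃ : ∀ i, (if f i = 0 then 1 else giantCount p (boxKind 1 r (∑ l ∈ Finset.range i, f l))) =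
      giantCount p (boxKind (f i) r (∑ l ∈ Finset.range i, f l)) := by
    intro i; rw [hk]; split_ifs <;> simp [giantCount]
  simp only [r₁] at e₁
  simp only [r₂] at e₂
  simp only [r₃] at e₃
  rw [e₁] at h₁
  rw [e₂] at h₂
  rw [e₃] at h₃
  rw [← hr] at h₁ h₂ h₃
  clear e₁ e₂ e₃ r₁ r₂ r₃ hk
  clear_value r
  clear hr
  unfold searchCost
  rcases Nat.even_or_odd' r with ⟨q, rfl | rfl⟩
  · have k₁ : ∀ a, babyCount p (boxKind 1 (2 * q) a) = if a < q then p else 1 := by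
      intro a; rw [boxKind_even]; split_ifs <;> simp [babyCount]
    have k₂ : ∀ a, 2 * Nat.log 2 (giantStep p (boxKind 1 (2 * q) a)) = 0 := by
      intro a; rw [boxKind_even]; split_ifs <;> simp [giantStep]
    have k₃ : ∀ a, giantCount p (boxKind 1 (2 * q) a) = if a < q then 1 else p := by
      intro a; rw [boxKind_even]; split_ifs <;> simp [giantCount]
    simp only [k₁, k₂, k₃, prod_range_halves, one_pow, mul_one, one_mul, Finset.sum_const_zero]
      at h₁ h₂ h₃
    rw [Nat.mul_div_cancel_left _ (by norm_num), if_neg (show ¬ 2 * q % 2 = 1 by omega)]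
    split_ifs with h
    · obtain rfl : q = 0 := by omega
      simp at h₁ h₃; omega
    · omega
  · have k₁ : ∀ a, babyCount p (boxKind 1 (2 * q + 1) a) =
        if a < q then p else if a = q then p.sqrt + 1 else 1 := by
      intro a; rw [boxKind_odd]; split_ifs <;> simp [babyCount]
    have k₂ : ∀ a, 2 * Nat.log 2 (giantStep p (boxKind 1 (2 * q + 1) a)) =
        if a < q then 0 else if a = q then 2 * Nat.log 2 (p.sqrt + 1) else 0 := by
      intro a; rw [boxKind_odd]; split_ifs <;> simp [giantStep]
    have k₃ : ∀ a, giantCount p (boxKind 1 (2 * q + 1) a) =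
        if a < q then 1 else if a = q then p.sqrt + 2 else p := by
      intro a; rw [boxKind_odd]; split_ifs <;> simp [giantCount]
    simp only [k₁, k₂, k₃, prod_range_halves_mid, sum_range_halves_mid, one_pow, mul_one, one_mul]
      at h₁ h₂ h₃
    rw [show (2 * q + 1) / 2 = q by omega, if_pos (show (2 * q + 1) % 2 = 1 by omega),
      if_neg (by omega)]
    have h4 : 1 ≤ p ^ q := Nat.one_le_pow _ _ hp
    have h5 : Nat.log 2 (p.sqrt + 1) ≤ p.sqrt + 1 := Nat.log_le_self _ _
    generalize p.sqrt = c at *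
    generalize p ^ q = P at *
    nlinarith

section Search

variable {G : Type*} [CommGroup G] {ident : G → ℕ} {p k : ℕ} {y : G} {b : ℕ → G}
  {m₁ n₁ m₂ n₂ : ℕ → ℕ} {T₁ T₂ : List (List ℕ × ℕ)}

theorem lookup_eq_some_mem {β γ : Type*} [DecidableEq β] {l : List (β × γ)} {x : β} {v : γ}
    (h : l.lookup x = some v) : (x, v) ∈ l := by
  induction l with
  | nil => simp at h
  | cons q l ih =>
    rw [List.lookup_cons] at h
    by_cases e : x = q.1
    · simp [e] at h; subst e; simp [← h]
    · simp [beq_eq_false_iff_ne.2 e] at h; exact List.mem_cons_of_mem _ (ih h)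

theorem lookup_ne_none {β γ : Type*} [DecidableEq β] {l : List (β × γ)} {x : β} {v : γ}
    (h : (x, v) ∈ l) : l.lookup x ≠ none := by
  induction l with
  | nil => simp at h
  | cons q l ih =>
    rw [List.lookup_cons]
    by_cases e : x = q.1
    · simp [e]
    · simp only [beq_eq_false_iff_ne.2 e]
      rcases List.mem_cons.1 h with h | h
      · exact absurd (congrArg Prod.fst h) e
      · exact ih h

theorem matchBoxes_some {v : List ℕ} (h : matchBoxes p k T₁ T₂ = some v) :
    ∃ q₁ ∈ T₁, ∃ q₂ ∈ T₂, q₁.2 = q₂.2 ∧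
      v = (List.range k).map fun i => (q₂.1.getD i 0 + (p - 1) * q₁.1.getD i 0) % p := by
  unfold matchBoxes at h
  suffices H : ∀ (T : List (List ℕ × ℕ)) (acc : Option (List ℕ)), T.foldl (fun acc q =>
      ((T₁.map fun q' => (q'.2, q'.1)).lookup q.2).elim acc fun v => some ((List.range k).map
        fun i => (q.1.getD i 0 + (p - 1) * v.getD i 0) % p)) acc = some v → acc = some v ∨
      ∃ q₁ ∈ T₁, ∃ q₂ ∈ T, q₁.2 = q₂.2 ∧
      v = (List.range k).map fun i => (q₂.1.getD i 0 + (p - 1) * q₁.1.getD i 0) % p by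
    exact (H _ _ h).resolve_left (by simp)
  intro T
  induction T with
  | nil => intro acc h; exact .inl h
  | cons q T ih =>
    intro acc h
    rcases ih _ h with h | ⟨q₁, h1, q₂, h2, h3⟩
    · beta_reduce at h
      rcases e : (T₁.map fun q' => (q'.2, q'.1)).lookup q.2 with _ | u
      · rw [e] at h; exact .inl h
      · rw [e] at h
        have hm := lookup_eq_some_mem e
        simp only [List.mem_map, Prod.mk.injEq] at hm
        obtain ⟨q', h1, h2, h3⟩ := hm
        refine .inr ⟨q', h1, q, List.mem_cons_self, h2, ?_⟩
        subst h3
        exact (Option.some.inj h).symm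
    · exact .inr ⟨q₁, h1, q₂, List.mem_cons_of_mem _ h2, h3⟩

theorem matchBoxes_none (h : matchBoxes p k T₁ T₂ = none) {q₁ q₂ : List ℕ × ℕ} (h₁ : q₁ ∈ T₁)
    (h₂ : q₂ ∈ T₂) : q₁.2 ≠ q₂.2 := by
  intro e
  unfold matchBoxes at h
  have some_ne : ∀ (T : List (List ℕ × ℕ)) (u : List ℕ), T.foldl (fun acc q =>
      ((T₁.map fun q' => (q'.2, q'.1)).lookup q.2).elim acc fun v => some ((List.range k).map
        fun i => (q.1.getD i 0 + (p - 1) * v.getD i 0) % p)) (some u) ≠ none := by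
    intro T
    induction T with
    | nil => intro u; simp
    | cons q T ih =>
      intro u
      rw [List.foldl_cons]
      rcases e' : (T₁.map fun q' => (q'.2, q'.1)).lookup q.2 with _ | u'
      · simp only [e', Option.elim]; exact ih _
      · simp only [e', Option.elim]; exact ih _
  obtain ⟨A, B, rfl⟩ := List.append_of_mem h₂
  rw [List.foldl_append, List.foldl_cons] at h
  have hl : (T₁.map fun q' => (q'.2, q'.1)).lookup q₂.2 ≠ none :=
    lookup_ne_none (v := q₁.1) (List.mem_map.2 ⟨q₁, h₁, by rw [e]⟩)
  rcases e' : (T₁.map fun q' => (q'.2, q'.1)).lookup q₂.2 with _ | u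
  · exact hl e'
  · rw [e'] at h
    exact some_ne _ _ h

theorem exists_box_digits (hp : 0 < p) {f r a δ : ℕ} (hδ : δ < p) (h0 : f = 0 → δ = 0) :
    ∃ c₁ < babyCount p (boxKind f r a), ∃ c₂ < giantCount p (boxKind f r a),
      c₂ * giantStep p (boxKind f r a) + (p - 1) * c₁ ≡ δ [MOD p] := by
  generalize hκ : boxKind f r a = κ
  have hneg : ∀ {x z : ℕ}, x = δ + z → x + (p - 1) * z ≡ δ [MOD p] := by
    rintro x z rfl
    have : δ + z + (p - 1) * z = δ + p * z := by
      obtain ⟨p, rfl⟩ := Nat.exists_eq_succ_of_ne_zero hp.ne'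
      simp; ring
    rw [this]
    exact Nat.modEq_iff_dvd.2 ⟨-z, by push_cast; ring⟩
  by_cases h1 : κ = 1
  · subst h1
    by_cases hd : δ = 0
    · exact ⟨0, by simpa [babyCount], 0, by simp [giantCount], by simp [hd]; rfl⟩
    · refine ⟨p - δ, by simp [babyCount]; omega, 0, by simp [giantCount], ?_⟩
      have : 0 * giantStep p 1 + (p - 1) * (p - δ) + p * 1 ≡
          p + (p - 1) * (p - δ) [MOD p] := by
        rw [show 0 * giantStep p 1 + (p - 1) * (p - δ) + p * 1 = p + (p - 1) * (p - δ) by ring]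
      refine Nat.ModEq.trans ?_ (hneg (x := p) (z := p - δ) (by omega))
      refine Nat.ModEq.trans ?_ this
      exact Nat.modEq_iff_dvd.2 ⟨1, by push_cast; ring⟩
  by_cases h2 : κ = 2
  · subst h2
    have hs : p ≤ p.sqrt * p.sqrt + p.sqrt + p.sqrt := Nat.sqrt_le_add p
    -- The giant digit is `δ / (p.sqrt + 1)` rounded up, and the baby digit is the excess.
    have e : (δ + p.sqrt) / (p.sqrt + 1) ≤ p.sqrt + 1 := by
      refine Nat.le_of_lt_succ ((Nat.div_lt_iff_lt_mul (by omega)).2 ?_)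
      nlinarith
    have e1 := Nat.div_add_mod (δ + p.sqrt) (p.sqrt + 1)
    have e2 := Nat.mod_lt (δ + p.sqrt) (show 0 < p.sqrt + 1 by omega)
    refine ⟨p.sqrt - (δ + p.sqrt) % (p.sqrt + 1), by simp [babyCount],
      (δ + p.sqrt) / (p.sqrt + 1), by simp [giantCount]; omega, hneg ?_⟩
    simp only [giantStep, if_true]
    rw [mul_comm]
    omega
  by_cases h3 : κ = 3
  · subst h3
    exact ⟨0, by simp [babyCount], δ, by simpa [giantCount], by simp [giantStep]; rfl⟩
  · have hf : f = 0 := by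
      by_contra hf
      revert h1 h2 h3
      rw [← hκ]
      unfold boxKind
      rw [if_neg hf]
      split_ifs <;> simp
    exact ⟨0, by simp [babyCount, h1, h2], 0, by simp [giantCount, h2, h3], by simp [h0 hf]; rfl⟩

theorem pow_eq_pow_mul_pow {p x z δ : ℕ} (hp : 0 < p) {g : G}
    (h : x + (p - 1) * z ≡ δ [MOD p]) (hg : g ^ p = 1 ∨ (x = 0 ∧ z = 0 ∧ δ = 0)) :
    g ^ x = g ^ δ * g ^ z := by
  rcases hg with hg | ⟨rfl, rfl, rfl⟩
  · have e : x + p * z ≡ δ + z [MOD p] := by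
      have := h.add_right z
      rwa [show x + (p - 1) * z + z = x + p * z by
        obtain ⟨p, rfl⟩ := Nat.exists_eq_succ_of_ne_zero hp.ne'
        simp; ring] at this
    have := pow_eq_pow_mod (x + p * z) hg
    rw [e, ← pow_eq_pow_mod _ hg, pow_add, pow_add, pow_mul, hg, one_pow, mul_one] at this
    exact this
  · simp

/-- A failure is conclusive because every admissible `δ` is a giant minus a baby exponent modulo `p`
(`exists_box_digits`). A success is sound because equal identifiers mean equal elements. -/
theorem spec_searchBox {k p : ℕ} {f : ℕ → ℕ} (hident : Function.Injective ident)
    (hf : ∀ i, f i ≤ 1) (hp : 0 < p)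
    (hb : ∀ i < k, f i = 1 → b i ^ p = 1) {bs : List (ℕ × ℕ)}
    (hbs : ∀ i < k, bs.getD i (0, 0) = (ident (b i), f i)) :
    QueryM.Spec ident (searchBox (ident 1) p k bs (ident y)) fun o c =>
      c ≤ searchCost p (∑ l ∈ Finset.range k, f l) ∧
      (o = none → ∀ δ : ℕ → ℕ, (∀ i < k, δ i < p ∧ (f i = 0 → δ i = 0)) →
        y * ∏ i ∈ Finset.range k, b i ^ δ i ≠ 1) ∧
      ∀ v, o = some v → v.length = k ∧ (∀ i < k, v.getD i 0 < p ∧ (f i = 0 → v.getD i 0 = 0)) ∧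
        y * ∏ i ∈ Finset.range k, b i ^ v.getD i 0 = 1 := by
  set κ : ℕ → ℕ := fun i => boxKind (f i) (∑ l ∈ Finset.range k, f l) (∑ l ∈ Finset.range i, f l)
    with hκ
  have hkind : ∀ i < k, kindAt k bs i = κ i := by
    intro i hi
    simp only [kindAt, hκ, rangeSum_eq, hbs i hi]
    congr 1
    · exact Finset.sum_congr rfl fun j hj => by rw [hbs j (Finset.mem_range.1 hj)]
    · exact Finset.sum_congr rfl fun j hj => by
        rw [hbs j ((Finset.mem_range.1 hj).trans hi)]
  have getD_map : ∀ {β : Type} (g : ℕ → β) (d : β) (i), i < k →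
      ((List.range k).map g).getD i d = g i := by
    intro β g d i hi
    simp [List.getD_eq_getElem?_getD, hi]
  have hB : ∀ i, 0 < babyCount p (κ i) := by
    intro i; unfold babyCount; split_ifs <;> omega
  have hC : ∀ i, 0 < giantCount p (κ i) := by
    intro i; unfold giantCount; split_ifs <;> omega
  unfold searchBox
  refine QueryM.Spec.bind (spec_enumBox (y := 1) (b := b) (m := fun _ => 1)
    (n := fun i => babyCount p (κ i)) (fun i _ => hB i) fun i hi => ?_) ?_
  · rw [getD_map _ _ _ hi, hbs i hi, hkind i hi, pow_one]
  rintro T₁ c₁ ⟨hT₁, hc₁⟩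
  let I : ℕ → List (ℕ × ℕ × ℕ) → ℕ → Prop := fun j gens c =>
    gens = (List.range j).map (fun i =>
      (ident (b i ^ giantStep p (κ i)), giantStep p (κ i), giantCount p (κ i))) ∧
    c ≤ ∑ i ∈ Finset.range j, 2 * Nat.log 2 (giantStep p (κ i))
  refine QueryM.Spec.bind (QueryM.Spec.loop_range k _ I ⟨rfl, by simp⟩ ?_) ?_
  · rintro i hi gens c ⟨rfl, hc⟩
    rw [hbs i hi, hkind i hi]
    refine QueryM.Spec.bind (spec_powQuery (b i) _) ?_
    rintro x c' ⟨rfl, hc', -⟩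
    refine QueryM.Spec.ret ⟨by simp [List.range_succ], ?_⟩
    rw [Finset.sum_range_succ]
    omega
  rintro gens c₂ ⟨rfl, hc₂⟩
  refine QueryM.Spec.bind (spec_enumBox (y := y) (b := b) (m := fun i => giantStep p (κ i))
    (n := fun i => giantCount p (κ i)) (fun i _ => hC i) fun i hi => getD_map _ _ _ hi) ?_
  rintro T₂ c₃ ⟨hT₂, hc₃⟩
  have hzero : ∀ i < k, f i = 0 → ∀ q₁ ∈ T₁, ∀ q₂ ∈ T₂,
      q₁.1.getD i 0 = 0 ∧ q₂.1.getD i 0 = 0 := by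
    intro i hi h q₁ hq₁ q₂ hq₂
    obtain ⟨c, hc, hc'⟩ := (hT₁.vec q₁ hq₁).2.1 i hi
    obtain ⟨d, hd, hd'⟩ := (hT₂.vec q₂ hq₂).2.1 i hi
    have h0 : κ i = 0 := by simp [hκ, boxKind, h]
    rw [h0] at hc hd
    simp only [babyCount, giantCount] at hc hd
    have hc0 : c = 0 := by simpa using hc
    have hd0 : d = 0 := by simpa using hd
    rw [hc', hd', hc0, hd0]
    simp
  refine QueryM.Spec.ret ⟨?_, ?_, ?_⟩
  · have := searchCost_spec hf hp hc₁ hc₂ hc₃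
    omega
  · intro ho δ hδ hy
    choose! c₁ h1 c₂ h2 h3 using fun i (hi : i < k) =>
      exists_box_digits hp (r := ∑ l ∈ Finset.range k, f l) (a := ∑ l ∈ Finset.range i, f l)
        (hδ i hi).1 (hδ i hi).2
    obtain ⟨q₁, hq₁, hv₁⟩ := hT₁.exists_mem c₁ h1
    obtain ⟨q₂, hq₂, hv₂⟩ := hT₂.exists_mem c₂ h2
    refine matchBoxes_none ho hq₁ hq₂ ?_
    rw [(hT₁.vec q₁ hq₁).2.2, (hT₂.vec q₂ hq₂).2.2, one_mul]
    congr 1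
    rw [Finset.prod_congr rfl fun i hi => pow_eq_pow_mul_pow (x := q₂.1.getD i 0)
      (z := q₁.1.getD i 0) (δ := δ i) hp ?_ ?_, Finset.prod_mul_distrib, ← mul_assoc, hy, one_mul]
    · have hi := Finset.mem_range.1 hi
      rw [hv₁ i hi, hv₂ i hi, mul_one]
      exact h3 i hi
    · have hi := Finset.mem_range.1 hi
      rcases Nat.eq_zero_or_pos (f i) with h | h
      · obtain ⟨h4, h5⟩ := hzero i hi h q₁ hq₁ q₂ hq₂
        exact .inr ⟨h5, h4, (hδ i hi).2 h⟩
      · exact .inl (hb i hi (by have := hf i; omega))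
  · intro v hv
    obtain ⟨q₁, hq₁, q₂, hq₂, he, rfl⟩ := matchBoxes_some hv
    refine ⟨by simp, fun i hi => ?_, ?_⟩
    · rw [getD_map _ _ _ hi]
      refine ⟨Nat.mod_lt _ hp, fun h => ?_⟩
      obtain ⟨h4, h5⟩ := hzero i hi h q₁ hq₁ q₂ hq₂
      rw [h4, h5]; simp
    · rw [(hT₁.vec q₁ hq₁).2.2, (hT₂.vec q₂ hq₂).2.2, one_mul] at he
      have he := hident he
      rw [Finset.prod_congr rfl fun i hi => pow_eq_pow_mul_pow (x := q₂.1.getD i 0)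
        (z := q₁.1.getD i 0) (δ := (q₂.1.getD i 0 + (p - 1) * q₁.1.getD i 0) % p) hp
        (Nat.mod_modEq _ _).symm ?_, Finset.prod_mul_distrib, ← mul_assoc, right_eq_mul] at he
      · rw [Finset.prod_congr rfl fun i hi => by rw [getD_map _ _ _ (Finset.mem_range.1 hi)]]
        exact he
      · have hi := Finset.mem_range.1 hi
        rcases Nat.eq_zero_or_pos (f i) with h | h
        · obtain ⟨h4, h5⟩ := hzero i hi h q₁ hq₁ q₂ hq₂
          exact .inr ⟨h5, h4, by rw [h4, h5]; simp⟩
        · exact .inl (hb i hi (by have := hf i; omega))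

end Search

/-! ### Relations between a new element and an independent family. -/

theorem getD_map_range {β : Type*} (g : ℕ → β) (d : β) {i k : ℕ} (hi : i < k) :
    ((List.range k).map g).getD i d = g i := by
  simp [List.getD_eq_getElem?_getD, hi]

/-- The number of digits per block of the online algorithm for `ℓ` digits. -/
def onlineWidth (ℓ : ℕ) : ℕ := (rangeSum ℓ fun b => if 2 ^ (b + 1) ≤ ℓ then 1 else 0) + 3

@[fun_prop] theorem primrec_onlineWidth {α : Type*} [Primcodable α] {ℓ : α → ℕ}
    (hℓ : Primrec ℓ) : Primrec fun a => onlineWidth (ℓ a) := by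
  unfold onlineWidth; fun_prop

theorem onlineWidth_eq (ℓ : ℕ) : onlineWidth ℓ = Nat.log 2 ℓ + 3 := by
  rw [onlineWidth, rangeSum_eq, ← Finset.sum_filter, Finset.sum_const, smul_eq_mul, mul_one]
  congr 1
  rw [← Finset.card_range (Nat.log 2 ℓ)]
  congr 1
  ext b
  simp only [Finset.mem_filter, Finset.mem_range]
  rcases Nat.eq_zero_or_pos ℓ with rfl | h
  · simp
  · rw [← Nat.le_log_iff_pow_le (by norm_num) (by omega)]
    have := Nat.log_lt_self 2 h.ne'
    omega

/-- List the powers `x, x ^ p, x ^ p ^ 2, …` up to the last one that is not the identity. -/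
def primePowers (e p x : ℕ) : QueryM (List ℕ) :=
  QueryM.whileLoop ([], x) fun (q : List ℕ × ℕ) ans =>
    if q.2 = e then QueryM.ret (.inr q.1) ans
    else QueryM.bind (powQuery e q.2 p) (fun y => QueryM.ret (.inl (q.1 ++ [q.2], y))) ans

@[fun_prop] theorem primrec_primePowers {α : Type*} [Primcodable α] {e p x : α → ℕ}
    {r : α → List ℕ} (he : Primrec e) (hp : Primrec p) (hx : Primrec x) (hr : Primrec r) :
    Primrec fun a => primePowers (e a) (p a) (x a) (r a) := by
  unfold primePowers; fun_prop

/-- The bound `N` occurs only in the termination measure; the algorithm does not know it. -/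
theorem spec_primePowers {G : Type*} [Group G] {ident : G → ℕ}
    (hident : Function.Injective ident) {p N : ℕ} (hp : 2 ≤ p) {g : G} (hg : g ^ p ^ N = 1) :
    QueryM.Spec ident (primePowers (ident 1) p (ident g)) fun l c => ∃ k,
      l = (List.range k).map (fun i => ident (g ^ p ^ i)) ∧ g ^ p ^ k = 1 ∧
      (∀ i < k, g ^ p ^ i ≠ 1) ∧ c ≤ k * (2 * Nat.log 2 p) := by
  refine QueryM.Spec.whileLoop (fun q => N - q.1.length) (fun q c => ∃ k,
    q = ((List.range k).map (fun i => ident (g ^ p ^ i)), ident (g ^ p ^ k)) ∧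
      (∀ i < k, g ^ p ^ i ≠ 1) ∧ c ≤ k * (2 * Nat.log 2 p)) ?_ _ ⟨0, by simp⟩
  rintro q c ⟨k, rfl, h1, h2⟩
  by_cases h : g ^ p ^ k = 1
  · simp only [h, if_true]
    exact QueryM.Spec.ret (.inr ⟨_, rfl, k, rfl, h, h1, h2⟩)
  · simp only [hident.ne h, if_false]
    refine QueryM.Spec.bind (spec_powQuery (g ^ p ^ k) p) ?_
    rintro y c' ⟨rfl, h3, h4⟩
    have hk : k < N := by
      by_contra hk
      refine h ?_
      obtain ⟨d, rfl⟩ := Nat.exists_eq_add_of_le (not_lt.1 hk)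
      rw [pow_add, pow_mul, hg, one_pow]
    refine QueryM.Spec.ret (.inl ⟨_, rfl, h4 hp, ⟨k + 1, ?_, ?_, ?_⟩, ?_⟩)
    · rw [List.range_succ, List.map_append, ← pow_mul, ← pow_succ]; rfl
    · intro i hi
      rcases Nat.lt_or_ge i k with hi' | hi'
      · exact h1 i hi'
      · rwa [show i = k by omega]
    · rw [add_mul, one_mul]; omega
    · simp; omega

/-- The elements `α i` for `i < s` are independent of orders `p ^ n i`. -/
def IsIndependent {G : Type*} [CommGroup G] (p s : ℕ) (α : ℕ → G) (n : ℕ → ℕ) : Prop :=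
  ∀ z : ℕ → ℤ, ∏ i ∈ Finset.range s, α i ^ z i = 1 ↔ ∀ i < s, (p : ℤ) ^ n i ∣ z i

/-- For one position `j`, multiply `y` by the known parts of the powers of the basis elements of
order greater than `p ^ j`, and list the elements of order `p` for the search. -/
def preparePosition (p s j : ℕ) (basis : List (ℕ × ℕ)) (items : List (ℕ × ℕ × List (ℕ × ℕ)))
    (y : ℕ) : QueryM (ℕ × List (ℕ × ℕ × List (ℕ × ℕ)) × List (ℕ × ℕ)) :=
  QueryM.loop (List.range s) (y, [], []) fun q i ans =>
    if j < (basis.getD i (0, 0)).2 then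
      QueryM.bind (extendMemo (items.getD i (0, 0, [])).2.2
        (onlineChain p (basis.getD i (0, 0)).2 (onlineWidth (basis.getD i (0, 0)).2)
          (items.getD i (0, 0, [])).2.1 (items.getD i (0, 0, [])).1)) (fun M =>
      QueryM.bind (QueryM.ask q.1 ((M.lookup (p ^ ((basis.getD i (0, 0)).2 - 1 -
        (items.getD i (0, 0, [])).1) * ((items.getD i (0, 0, [])).2.1 %
          p ^ (items.getD i (0, 0, [])).1))).getD 0)) fun y' =>
      QueryM.ret (y', q.2.1 ++ [((items.getD i (0, 0, [])).1, (items.getD i (0, 0, [])).2.1, M)],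
        q.2.2 ++ [((M.lookup (p ^ ((basis.getD i (0, 0)).2 - 1))).getD 0, 1)])) ans
    else QueryM.ret (q.1, q.2.1 ++ [items.getD i (0, 0, [])],
      q.2.2 ++ [((basis.getD i (0, 0)).1, 0)]) ans

@[fun_prop] theorem primrec_preparePosition {α : Type*} [Primcodable α] {p s j y : α → ℕ}
    {basis : α → List (ℕ × ℕ)} {items : α → List (ℕ × ℕ × List (ℕ × ℕ))} {r : α → List ℕ}
    (hp : Primrec p) (hs : Primrec s) (hj : Primrec j) (hb : Primrec basis)
    (hi : Primrec items) (hy : Primrec y) (hr : Primrec r) :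
    Primrec fun a => preparePosition (p a) (s a) (j a) (basis a) (items a) (y a) (r a) := by
  unfold preparePosition; fun_prop

/-- Record the digits `v` found at position `j`. -/
def appendDigits (p s j : ℕ) (basis : List (ℕ × ℕ)) (items : List (ℕ × ℕ × List (ℕ × ℕ)))
    (v : List ℕ) : List (ℕ × ℕ × List (ℕ × ℕ)) :=
  (List.range s).map fun i => if j < (basis.getD i (0, 0)).2 then
    ((items.getD i (0, 0, [])).1 + 1, (items.getD i (0, 0, [])).2.1 +
      v.getD i 0 * p ^ (items.getD i (0, 0, [])).1, (items.getD i (0, 0, [])).2.2)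
    else items.getD i (0, 0, [])

@[fun_prop] theorem primrec_appendDigits {α : Type*} [Primcodable α] {p s j : α → ℕ}
    {basis : α → List (ℕ × ℕ)} {items : α → List (ℕ × ℕ × List (ℕ × ℕ))} {v : α → List ℕ}
    (hp : Primrec p) (hs : Primrec s) (hj : Primrec j) (hb : Primrec basis)
    (hi : Primrec items) (hv : Primrec v) :
    Primrec fun a => appendDigits (p a) (s a) (j a) (basis a) (items a) (v a) := by
  unfold appendDigits; fun_prop

/-- Find the least `d` for which the `p ^ d`-th power of the given element is in the span of the
basis, and numbers `x i` such that `g ^ p ^ d * ∏ i, α i ^ x i = 1`. -/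
def findRelation (e p s : ℕ) (basis : List (ℕ × ℕ)) (g : ℕ) : QueryM (ℕ × List ℕ) :=
  QueryM.bind (primePowers e p g) fun l =>
  QueryM.bind (QueryM.loop (List.range l.length)
    (0, (List.range s).map fun i => (0, 0, [(0, e), (1, (basis.getD i (0, 0)).1)]))
    fun q i => QueryM.bind (preparePosition p s (l.length - 1 - i) basis q.2
        (l.getD (q.1 + (l.length - 1 - i)) 0)) fun u =>
      QueryM.bind (searchBox e p s u.2.2 u.1) fun o => QueryM.ret
        (o.elim (q.1 + 1, u.2.1) fun v =>
          (q.1, appendDigits p s (l.length - 1 - i) basis u.2.1 v)))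
    fun q => QueryM.ret (q.1, (List.range s).map fun i =>
      p ^ ((basis.getD i (0, 0)).2 - (q.2.getD i (0, 0, [])).1) * (q.2.getD i (0, 0, [])).2.1)

@[fun_prop] theorem primrec_findRelation {α : Type*} [Primcodable α] {e p s g : α → ℕ}
    {basis : α → List (ℕ × ℕ)} {r : α → List ℕ} (he : Primrec e) (hp : Primrec p)
    (hs : Primrec s) (hb : Primrec basis) (hg : Primrec g) (hr : Primrec r) :
    Primrec fun a => findRelation (e a) (p a) (s a) (basis a) (g a) (r a) := by
  unfold findRelation; fun_prop

/-- The number of `i < s` with `j < n i`. -/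
def rankAbove (n : ℕ → ℕ) (s j : ℕ) : ℕ := ∑ i ∈ Finset.range s, if j < n i then 1 else 0

section Position

variable {G : Type*} [CommGroup G] {ident : G → ℕ} {p s : ℕ} {α : ℕ → G} {n : ℕ → ℕ}

theorem pow_sub_mul_mod {ℓ t X : ℕ} (hX : X < p ^ t) :
    p ^ (ℓ - 1 - t) * (X % p ^ t) = p ^ (ℓ - (t + 1)) * X := by
  rw [Nat.mod_eq_of_lt hX, show ℓ - 1 - t = ℓ - (t + 1) by omega]

/-- The state of the online algorithm for the basis element `a`, after `t` digits, with value
`X`. -/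
structure IsItem (ident : G → ℕ) (p ℓ : ℕ) (a : G) (t X : ℕ) (M : List (ℕ × ℕ)) (K : Finset ℕ) :
    Prop where
  memo : IsMemo ident a M K
  lt : X < p ^ t
  mem : 0 ∈ K ∧ 1 ∈ K
  subset : ∀ X', X' % p ^ t = X → K ⊆ onlineSet p ℓ (onlineWidth ℓ) X'

/-- The cost is the growth of the tables, plus one multiplication for each basis element that takes
part. The growth is summed up only at the end: `IsItem.subset` holds for all continuations of the
known digits, so the tables stay inside one `onlineSet` throughout. -/
theorem spec_preparePosition (hp : 2 ≤ p) {basis : List (ℕ × ℕ)}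
    (hbasis : ∀ i < s, basis.getD i (0, 0) = (ident (α i), n i)) {j : ℕ} {t X : ℕ → ℕ}
    {M : ℕ → List (ℕ × ℕ)} {K : ℕ → Finset ℕ}
    (hI : ∀ i < s, IsItem ident p (n i) (α i) (t i) (X i) (M i) (K i))
    (ht : ∀ i < s, j < n i → t i < n i) (y : G) :
    QueryM.Spec ident (preparePosition p s j basis
      ((List.range s).map fun i => (t i, X i, M i)) (ident y)) fun u c =>
      ∃ (M' : ℕ → List (ℕ × ℕ)) (K' : ℕ → Finset ℕ),
        (∀ i < s, IsItem ident p (n i) (α i) (t i) (X i) (M' i) (K' i)) ∧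
        u.1 = ident (y * ∏ i ∈ Finset.range s,
          if j < n i then α i ^ (p ^ (n i - (t i + 1)) * X i) else 1) ∧
        u.2.1 = ((List.range s).map fun i => (t i, X i, M' i)) ∧
        u.2.2 = ((List.range s).map fun i => if j < n i then (ident (α i ^ p ^ (n i - 1)), 1)
          else (ident (α i), 0)) ∧
        (∑ i ∈ Finset.range s, (K i).card) + c =
          (∑ i ∈ Finset.range s, (K' i).card) + rankAbove n s j := by
  let I : ℕ → ℕ × List (ℕ × ℕ × List (ℕ × ℕ)) × List (ℕ × ℕ) → ℕ → Prop := fun k u c =>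
    ∃ (M' : ℕ → List (ℕ × ℕ)) (K' : ℕ → Finset ℕ),
        (∀ i < k, IsItem ident p (n i) (α i) (t i) (X i) (M' i) (K' i)) ∧
        u.1 = ident (y * ∏ i ∈ Finset.range k,
          if j < n i then α i ^ (p ^ (n i - (t i + 1)) * X i) else 1) ∧
        u.2.1 = ((List.range k).map fun i => (t i, X i, M' i)) ∧
        u.2.2 = ((List.range k).map fun i => if j < n i then (ident (α i ^ p ^ (n i - 1)), 1)
          else (ident (α i), 0)) ∧
        (∑ i ∈ Finset.range k, (K i).card) + c =
          (∑ i ∈ Finset.range k, (K' i).card) + rankAbove n k j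
  refine QueryM.Spec.loop_range s _ I ⟨M, K, by simp, by simp, rfl, rfl, by simp [rankAbove]⟩ ?_
  rintro k hk ⟨u₁, u₂, u₃⟩ c ⟨M', K', h1, h2, h3, h4, h5⟩
  simp only at h2 h3 h4
  subst h2 h3 h4
  have hIk := hI k hk
  -- extending the families by one entry
  have ext_items : ∀ M₁ : List (ℕ × ℕ), (List.range (k + 1)).map
      (fun i => (t i, X i, Function.update M' k M₁ i)) =
      (List.range k).map (fun i => (t i, X i, M' i)) ++ [(t k, X k, M₁)] := by
    intro M₁
    rw [List.range_succ, List.map_append]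
    congr 1
    · refine List.map_congr_left fun i hi => ?_
      rw [Function.update_of_ne (List.mem_range.1 hi).ne]
    · simp
  have ext_sum : ∀ K₁ : Finset ℕ, ∑ i ∈ Finset.range (k + 1), (Function.update K' k K₁ i).card =
      (∑ i ∈ Finset.range k, (K' i).card) + K₁.card := by
    intro K₁
    rw [Finset.sum_range_succ, Function.update_self]
    congr 1
    exact Finset.sum_congr rfl fun i hi => by
      rw [Function.update_of_ne (Finset.mem_range.1 hi).ne]
  have ext_isItem : ∀ (M₁ : List (ℕ × ℕ)) (K₁ : Finset ℕ),
      IsItem ident p (n k) (α k) (t k) (X k) M₁ K₁ → ∀ i < k + 1, IsItem ident p (n i) (α i) (t i)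
        (X i) (Function.update M' k M₁ i) (Function.update K' k K₁ i) := by
    intro M₁ K₁ h i hi
    rcases Nat.lt_or_ge i k with hi' | hi'
    · rw [Function.update_of_ne hi'.ne, Function.update_of_ne hi'.ne]; exact h1 i hi'
    · obtain rfl : i = k := by omega
      rw [Function.update_self, Function.update_self]; exact h
  have hw : 1 < onlineWidth (n k) := by unfold onlineWidth; omega
  simp only [hbasis k hk, getD_map_range _ _ hk]
  by_cases hj : j < n k
  · simp only [if_pos hj]
    have htk := ht k hk hj
    have hch := onlineChain_spec (p := p) (X := X k) (by omega) hw hIk.mem.1 hIk.mem.2 htk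
    refine QueryM.Spec.bind (spec_extendMemo hIk.memo hch.1) ?_
    rintro M₁ c₁ ⟨hM₁, hc₁⟩
    rw [hM₁.getD hch.2.1, hM₁.getD (hch.2.2 (n k - 1) (by omega)), pow_sub_mul_mod hIk.lt]
    refine QueryM.Spec.bind (QueryM.Spec.ask (Q := fun x c => x = ident ((y * ∏ i ∈
      Finset.range k, if j < n i then α i ^ (p ^ (n i - (t i + 1)) * X i) else 1) *
      α k ^ (p ^ (n k - (t k + 1)) * X k)) ∧ c = 1) _ _ ⟨rfl, rfl⟩) ?_
    rintro x c' ⟨rfl, rfl⟩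
    refine QueryM.Spec.ret ⟨Function.update M' k M₁, Function.update K' k
      (K k ∪ additionSums (onlineChain p (n k) (onlineWidth (n k)) (X k) (t k))),
      ext_isItem _ _ ⟨hM₁, hIk.lt, ⟨Finset.mem_union_left _ hIk.mem.1,
        Finset.mem_union_left _ hIk.mem.2⟩, fun X' hX' => Finset.union_subset
        (hIk.subset X' hX') ?_⟩, ?_, ?_, ?_, ?_⟩
    -- The chain for the known digits is also the chain for the continuation `X'`.
    · rw [← hX', onlineChain_mod]
      exact additionSums_onlineChain_subset (by omega) hw htk
    · rw [Finset.prod_range_succ, if_pos hj, mul_assoc]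
    · exact (ext_items M₁).symm
    · rw [List.range_succ, List.map_append]; simp [hj]
    · rw [ext_sum, Finset.sum_range_succ, rankAbove, Finset.sum_range_succ, if_pos hj]
      rw [rankAbove] at h5
      omega
  · simp only [if_neg hj]
    refine QueryM.Spec.ret ⟨Function.update M' k (M k), Function.update K' k (K k),
      ext_isItem _ _ hIk, ?_, ?_, ?_, ?_⟩
    · rw [Finset.prod_range_succ, if_neg hj, mul_one]
    · exact (ext_items (M k)).symm
    · rw [List.range_succ, List.map_append]; simp [hj]
    · rw [ext_sum, Finset.sum_range_succ, rankAbove, Finset.sum_range_succ, if_neg hj]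
      rw [rankAbove] at h5
      omega

end Position

/-- The relations between `g` and the independent elements `α i` are spanned, away from `p`, by the
orders of the `α i` and by `g ^ (u * p ^ d) * ∏ i, α i ^ x i = 1`. -/
def IsRelation {G : Type*} [CommGroup G] (p s : ℕ) (α : ℕ → G) (n : ℕ → ℕ) (g : G) (d u : ℕ)
    (x : ℕ → ℕ) : Prop :=
  ∀ (y : ℤ) (z : ℕ → ℤ), g ^ y * ∏ i ∈ Finset.range s, α i ^ z i = 1 ↔
    ∃ y' : ℤ, y = p ^ d * y' ∧ ∀ i < s, (p : ℤ) ^ n i ∣ u * z i - y' * x i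

/-- A bound for the cost of the online algorithm for a basis element of order `p ^ ℓ`. -/
def onlineCost (p ℓ : ℕ) : ℕ := 36 * ℓ * (Nat.log 2 p + 1) * (Nat.clog (onlineWidth ℓ) ℓ + 1)

theorem prod_zpow_mul {G : Type*} [CommGroup G] (s : ℕ) (α : ℕ → G) (z w : ℕ → ℤ) :
    (∏ i ∈ Finset.range s, α i ^ z i) * ∏ i ∈ Finset.range s, α i ^ w i =
      ∏ i ∈ Finset.range s, α i ^ (z i + w i) := by
  rw [← Finset.prod_mul_distrib]
  exact Finset.prod_congr rfl fun i _ => (zpow_add _ _ _).symm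

theorem prod_zpow_zpow {G : Type*} [CommGroup G] (s : ℕ) (α : ℕ → G) (z : ℕ → ℤ) (a : ℤ) :
    (∏ i ∈ Finset.range s, α i ^ z i) ^ a = ∏ i ∈ Finset.range s, α i ^ (z i * a) := by
  rw [← Finset.prod_zpow]
  exact Finset.prod_congr rfl fun i _ => (zpow_mul _ _ _).symm

section Relation

variable {G : Type*} [CommGroup G] {ident : G → ℕ} {p s : ℕ} {α : ℕ → G} {n : ℕ → ℕ}

/-- If `p ^ d` did not divide the exponent `y` of `g`, Bézout's identity for `y` and `p ^ d` would
combine two relations into one for the power of `g` with exponent `p ^ (d - 1)`, against minimality.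
For `y = p ^ d * y'`, substitute the known relation and use independence. -/
theorem isRelation_of_minimal (hp : p.Prime) (hα : IsIndependent p s α n) {g : G} {d : ℕ}
    {x : ℕ → ℕ} (h : g ^ p ^ d * ∏ i ∈ Finset.range s, α i ^ x i = 1)
    (hmin : ∀ d', d = d' + 1 → ∀ z : ℕ → ℤ, g ^ p ^ d' * ∏ i ∈ Finset.range s, α i ^ z i ≠ 1) :
    IsRelation p s α n g d 1 x := by
  have h' : g ^ ((p : ℤ) ^ d) * ∏ i ∈ Finset.range s, α i ^ (x i : ℤ) = 1 := by
    simpa [← zpow_natCast] using h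
  intro y z
  have key : ∀ y' : ℤ, g ^ ((p : ℤ) ^ d * y') * ∏ i ∈ Finset.range s, α i ^ z i = 1 ↔
      ∀ i < s, (p : ℤ) ^ n i ∣ (1 : ℕ) * z i - y' * x i := by
    intro y'
    have e : g ^ ((p : ℤ) ^ d * y') = ∏ i ∈ Finset.range s, α i ^ (- (y' * x i)) := by
      rw [zpow_mul, eq_inv_of_mul_eq_one_left h', inv_zpow', prod_zpow_zpow]
      exact Finset.prod_congr rfl fun i _ => by congr 1; ring
    rw [e, prod_zpow_mul, hα]
    refine forall₂_congr fun i _ => ?_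
    rw [show -(y' * (x i : ℤ)) + z i = (1 : ℕ) * z i - y' * x i by push_cast; ring]
  constructor
  · intro hy
    have hdvd : (p : ℤ) ^ d ∣ y := by
      by_contra hnd
      rcases d with _ | d
      · simp at hnd
      · have hg : ∃ a ≤ d, Int.gcd y (p ^ (d + 1) : ℕ) = p ^ a := by
          have : Int.gcd y (p ^ (d + 1) : ℕ) ∣ p ^ (d + 1) := by
            have := Int.gcd_dvd_right y ((p ^ (d + 1) : ℕ) : ℤ)
            exact_mod_cast this
          obtain ⟨a, ha, he⟩ := (Nat.dvd_prime_pow hp).1 this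
          refine ⟨a, ?_, he⟩
          by_contra hlt
          obtain rfl : a = d + 1 := by omega
          refine hnd ?_
          have := Int.gcd_dvd_left y ((p ^ (d + 1) : ℕ) : ℤ)
          rw [he] at this
          exact_mod_cast this
        obtain ⟨a, ha, he⟩ := hg
        have hb := Int.gcd_eq_gcd_ab y (p ^ (d + 1) : ℕ)
        set A := Int.gcdA y (p ^ (d + 1) : ℕ)
        set B := Int.gcdB y (p ^ (d + 1) : ℕ)
        rw [he] at hb
        have e1 : (p : ℤ) ^ d = y * (A * p ^ (d - a)) + p ^ (d + 1) * (B * p ^ (d - a)) := by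
          have : (p : ℤ) ^ d = p ^ a * p ^ (d - a) := by rw [← pow_add]; congr 1; omega
          rw [this]
          push_cast at hb
          rw [hb]; ring
        refine hmin d rfl (fun i => z i * (A * p ^ (d - a)) + x i * (B * p ^ (d - a))) ?_
        have e2 : g ^ p ^ d = g ^ ((p : ℤ) ^ d) := by rw [← zpow_natCast]; push_cast; rfl
        have e3 : ∀ A' : ℤ, g ^ (y * A') * (∏ i ∈ Finset.range s, α i ^ z i) ^ A' = 1 :=
          fun A' => by rw [zpow_mul, ← mul_zpow, hy, one_zpow]
        have e4 : ∀ B' : ℤ, g ^ ((p : ℤ) ^ (d + 1) * B') *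
            (∏ i ∈ Finset.range s, α i ^ (x i : ℤ)) ^ B' = 1 :=
          fun B' => by rw [zpow_mul, ← mul_zpow, h', one_zpow]
        rw [e2, e1, zpow_add, ← prod_zpow_mul, ← prod_zpow_zpow, ← prod_zpow_zpow,
          mul_mul_mul_comm, e3, e4, mul_one]
    obtain ⟨y', rfl⟩ := hdvd
    exact ⟨y', rfl, (key y').1 hy⟩
  · rintro ⟨y', rfl, hz⟩
    exact (key y').2 hz

/-- Compare the `p ^ (j + 1)`-th power of `h2` with `h1`. By independence, `p ^ n i` divides `p * (c
i - z i * p ^ j)`, so for `j < n i` the error `c i - z i * p ^ j` is a multiple of `p ^ (n i - 1)`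
and one digit corrects it. Hence a failing search excludes `g` from the span. -/
theorem exists_digits_of_mem_span (hp : p.Prime) (hα : IsIndependent p s α n)
    {j : ℕ} {g : G} {c : ℕ → ℕ} (h0 : ∀ i < s, n i ≤ j → c i = 0)
    (h1 : g ^ p ^ (j + 1) * ∏ i ∈ Finset.range s, α i ^ (p * c i) = 1) {z : ℕ → ℤ}
    (h2 : g * ∏ i ∈ Finset.range s, α i ^ z i = 1) :
    ∃ δ : ℕ → ℕ, (∀ i < s, δ i < p ∧ (n i ≤ j → δ i = 0)) ∧
      g ^ p ^ j * (∏ i ∈ Finset.range s, α i ^ c i) *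
        ∏ i ∈ Finset.range s, α i ^ (p ^ (n i - 1) * δ i) = 1 := by
  have hp0 : (p : ℤ) ≠ 0 := by exact_mod_cast hp.ne_zero
  have hpos : (0 : ℤ) < p := by exact_mod_cast hp.pos
  have hz : ∀ k : ℕ, g ^ p ^ k = ∏ i ∈ Finset.range s, α i ^ (-(z i * p ^ k)) := by
    intro k
    rw [eq_inv_of_mul_eq_one_left h2, inv_pow, ← zpow_natCast, prod_zpow_zpow,
      ← Finset.prod_inv_distrib]
    exact Finset.prod_congr rfl fun i _ => by rw [← zpow_neg]; push_cast; rfl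
  have hdvd : ∀ i < s, (p : ℤ) ^ n i ∣ -(z i * p ^ (j + 1)) + p * c i := by
    refine (hα _).1 ?_
    rw [← prod_zpow_mul, ← hz, ← h1]
    congr 1
    exact Finset.prod_congr rfl fun i _ => by rw [← zpow_natCast]; push_cast; rfl
  have hq : ∀ i < s, j < n i → ∃ q : ℤ, -(z i * p ^ j) + c i = p ^ (n i - 1) * q := by
    intro i hi hj
    obtain ⟨q, hq⟩ := hdvd i hi
    refine ⟨q, mul_left_cancel₀ hp0 ?_⟩
    rw [← mul_assoc, ← pow_succ', show n i - 1 + 1 = n i by omega, ← hq]; ring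
  choose! q hq using hq
  refine ⟨fun i => if j < n i then ((-q i) % p).toNat else 0, fun i hi => ⟨?_, fun h => ?_⟩, ?_⟩
  · dsimp only
    split_ifs
    · have h1 := Int.emod_nonneg (-q i) hp0
      have h2 := Int.emod_lt_of_pos (-q i) hpos
      omega
    · exact hp.pos
  · exact if_neg (by omega)
  · have hcast : ∀ c : ℕ → ℕ, ∏ i ∈ Finset.range s, α i ^ c i =
        ∏ i ∈ Finset.range s, α i ^ (c i : ℤ) := fun c =>
      Finset.prod_congr rfl fun i _ => (zpow_natCast _ _).symm
    rw [hz, hcast c, hcast, prod_zpow_mul, prod_zpow_mul, hα]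
    intro i hi
    by_cases hj : j < n i
    · rw [hq i hi hj]
      simp only [if_pos hj]
      push_cast
      rw [Int.toNat_of_nonneg (Int.emod_nonneg _ hp0), ← mul_add]
      have : (p : ℤ) ∣ q i + -q i % p := by
        have := Int.emod_add_mul_ediv (-q i) p
        exact ⟨-(-q i / p), by linarith⟩
      obtain ⟨w, hw⟩ := this
      rw [hw, ← mul_assoc, ← pow_succ, show n i - 1 + 1 = n i by omega]
      exact dvd_mul_right _ _
    · simp only [if_neg hj, h0 i hi (by omega)]
      push_cast
      simp only [mul_zero, add_zero]
      exact (((pow_dvd_pow _ (by omega)).mul_left _)).neg_right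

theorem spec_findRelation (hident : Function.Injective ident) (hp : p.Prime)
    (hα : IsIndependent p s α n) (hn : ∀ i < s, 0 < n i) {basis : List (ℕ × ℕ)}
    (hbasis : ∀ i < s, basis.getD i (0, 0) = (ident (α i), n i)) {g : G} {N : ℕ}
    (hg : g ^ p ^ N = 1) :
    QueryM.Spec ident (findRelation (ident 1) p s basis (ident g)) fun u c => ∃ (k d : ℕ)
      (x : ℕ → ℕ), g ^ p ^ k = 1 ∧ (∀ i < k, g ^ p ^ i ≠ 1) ∧ u = (d, (List.range s).map x) ∧
      IsRelation p s α n g d 1 x ∧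
      c ≤ k * (2 * Nat.log 2 p) + ∑ i ∈ Finset.range s, onlineCost p (n i) +
        ∑ j ∈ Finset.range k, (rankAbove n s j + searchCost p (rankAbove n s j)) := by
  have hone : ∀ i < s, α i ^ p ^ n i = 1 := by
    intro i hi
    have := (hα (Pi.single i ((p : ℤ) ^ n i))).2 fun j hj => by
      by_cases h : j = i
      · subst h; simp
      · simp [h]
    rw [Finset.prod_eq_single i] at this
    · rw [Pi.single_eq_same] at this
      rw [← zpow_natCast]; push_cast; exact this
    · intro j _ hj; rw [Pi.single_eq_of_ne hj, zpow_zero]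
    · intro h; simp at h; omega
  refine QueryM.Spec.bind (spec_primePowers hident hp.two_le hg) ?_
  rintro l c₁ ⟨k, rfl, hk, hk', hc₁⟩
  have hlen : ((List.range k).map (fun i => ident (g ^ p ^ i))).length = k := by simp
  rw [hlen]
  -- After `m` rounds, `k - m` positions are left and a relation for `g ^ p ^ (d + (k - m))` is
  -- known. Each round either takes a `p`-th root of this relation or increases `d`; in both cases
  -- `d + (k - m)` fits the new `m`. The term `2 * s` is for the two exponents in each initial
  -- table.
  let I : ℕ → ℕ × List (ℕ × ℕ × List (ℕ × ℕ)) → ℕ → Prop := fun m u c =>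
    ∃ (d : ℕ) (t X : ℕ → ℕ) (M : ℕ → List (ℕ × ℕ)) (K : ℕ → Finset ℕ),
      u = (d, (List.range s).map fun i => (t i, X i, M i)) ∧ d ≤ m ∧
      (∀ i < s, IsItem ident p (n i) (α i) (t i) (X i) (M i) (K i)) ∧
      (∀ i < s, t i ≤ n i - (k - m)) ∧
      g ^ p ^ (d + (k - m)) * ∏ i ∈ Finset.range s, α i ^ (p ^ (n i - t i) * X i) = 1 ∧
      (∀ d', d = d' + 1 → ∀ z : ℕ → ℤ, g ^ p ^ d' * ∏ i ∈ Finset.range s, α i ^ z i ≠ 1) ∧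
      2 * s + c ≤ ∑ i ∈ Finset.range s, (K i).card +
        ∑ i ∈ Finset.range m, (rankAbove n s (k - 1 - i) + searchCost p (rankAbove n s (k - 1 - i)))
  refine QueryM.Spec.bind (QueryM.Spec.loop_range k _ I ?_ ?_) ?_
  · refine ⟨0, fun _ => 0, fun _ => 0, fun i => [(0, ident 1), (1, ident (α i))], fun _ => {0, 1},
      ?_, le_rfl, fun i hi => ⟨isMemo_init _, by simp, by simp, fun X' _ => ?_⟩, by simp,
      ?_, by simp,
      ?_⟩
    · refine Prod.ext rfl (List.map_congr_left fun i hi => ?_)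
      rw [hbasis i (List.mem_range.1 hi)]
    · unfold onlineSet
      rw [Finset.union_assoc]; exact Finset.subset_union_left
    · simpa using hk
    · simp [mul_comm]
  · rintro m hm u c ⟨d, t, X, M, K, rfl, hd, hI, ht, hrel, hmin, hc⟩
    set j := k - 1 - m with hj
    have hJ : k - m = j + 1 := by omega
    rw [hJ] at ht hrel
    rw [getD_map_range _ _ (show d + j < k by omega)]
    refine QueryM.Spec.bind (spec_preparePosition hp.two_le hbasis hI
      (fun i hi hji => by have := ht i hi; omega) _) ?_
    rintro ⟨u₁, u₂, u₃⟩ c₂ ⟨M', K', hI', h1, h2, h3, hc₂⟩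
    simp only at h1 h2 h3
    subst h1 h2 h3
    -- A basis element of order at most `p ^ j` has received no digits so far.
    have hX0 : ∀ i < s, ¬ j < n i → X i = 0 := by
      intro i hi hji
      have h1 := ht i hi
      have h2 := (hI i hi).lt
      rw [show t i = 0 by omega, pow_zero] at h2
      omega
    have hprod : (∏ i ∈ Finset.range s,
        if j < n i then α i ^ (p ^ (n i - (t i + 1)) * X i) else 1) =
        ∏ i ∈ Finset.range s, α i ^ (p ^ (n i - (t i + 1)) * X i) := by
      refine Finset.prod_congr rfl fun i hi => ?_
      split_ifs with h
      · rfl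
      · rw [hX0 i (Finset.mem_range.1 hi) h, mul_zero, pow_zero]
    rw [hprod]
    refine QueryM.Spec.bind (spec_searchBox (b := fun i => if j < n i then α i ^ p ^ (n i - 1)
      else α i) (f := fun i => if j < n i then 1 else 0) hident (fun i => by split_ifs <;> omega)
      hp.pos (fun i hi h => ?_) fun i hi => ?_) ?_
    · have h : j < n i := by by_contra h'; simp [h'] at h
      rw [if_pos h, ← pow_mul, ← pow_succ, show n i - 1 + 1 = n i by omega, hone i hi]
    · rw [getD_map_range _ _ hi]
      split_ifs <;> rfl
    rintro o c₃ ⟨hc₃, hnone, hsome⟩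
    refine QueryM.Spec.ret ?_
    have hJ' : k - (m + 1) = j := by omega
    have hcost : 2 * s + (c + (c₂ + (c₃ + 0))) ≤ ∑ i ∈ Finset.range s, (K' i).card +
        ∑ i ∈ Finset.range (m + 1),
          (rankAbove n s (k - 1 - i) + searchCost p (rankAbove n s (k - 1 - i))) := by
      rw [Finset.sum_range_succ, ← hj]
      change c₃ ≤ searchCost p (rankAbove n s j) at hc₃
      omega
    rcases o with _ | v
    -- The search failed: the relation stays the same, now counted from `d + 1`, and `g ^ p ^ d` is
    -- not in the span.
    · refine ⟨d + 1, t, X, M', K', rfl, by omega, hI', fun i hi => ?_, ?_, ?_, hcost⟩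
      · have := ht i hi; omega
      · rw [hJ', show d + 1 + j = d + (j + 1) by omega]; exact hrel
      · rintro d' hd' z hz
        obtain rfl : d = d' := by omega
        have hrel' : (g ^ p ^ d) ^ p ^ (j + 1) * ∏ i ∈ Finset.range s,
            α i ^ (p * (p ^ (n i - (t i + 1)) * X i)) = 1 := by
          rw [← pow_mul, ← pow_add, ← hrel]
          congr 1
          refine Finset.prod_congr rfl fun i hi => ?_
          by_cases h : j < n i
          · have := ht i (Finset.mem_range.1 hi)
            rw [← mul_assoc, ← pow_succ', show n i - (t i + 1) + 1 = n i - t i by omega]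
          · rw [hX0 i (Finset.mem_range.1 hi) h]; simp
        obtain ⟨δ, hδ, hδ'⟩ := exists_digits_of_mem_span hp hα (j := j)
          (fun i hi h => by rw [hX0 i hi (by omega), mul_zero]) hrel' hz
        refine hnone rfl δ (fun i hi => ⟨(hδ i hi).1, fun h => (hδ i hi).2 ?_⟩) ?_
        · by_contra h'; rw [if_pos (by omega)] at h; omega
        · rw [← hδ', ← pow_mul, ← pow_add]
          congr 1
          refine Finset.prod_congr rfl fun i hi => ?_
          split_ifs with h
          · rw [pow_mul]
          · rw [(hδ i (Finset.mem_range.1 hi)).2 (by omega), mul_zero, pow_zero]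
    -- The search succeeded: the digit found becomes the leading digit of `X i`.
    · obtain ⟨hv1, hv2, hv3⟩ := hsome v rfl
      refine ⟨d, fun i => if j < n i then t i + 1 else t i,
        fun i => if j < n i then X i + v.getD i 0 * p ^ t i else X i, M', K', ?_, by omega,
        fun i hi => ?_, fun i hi => ?_, ?_, hmin, hcost⟩
      · refine Prod.ext rfl (List.map_congr_left fun i hi => ?_)
        have hi := List.mem_range.1 hi
        rw [hbasis i hi, getD_map_range _ _ hi]
        dsimp only
        by_cases hji : j < n i <;> simp [hji]
      · have h := hI' i hi
        by_cases hji : j < n i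
        · simp only [if_pos hji]
          have hvi := (hv2 i hi).1
          refine ⟨h.memo, ?_, h.mem, fun X' hX' => h.subset X' ?_⟩
          · have hXl := h.lt
            calc X i + v.getD i 0 * p ^ t i < p ^ t i + v.getD i 0 * p ^ t i := by omega
              _ = (v.getD i 0 + 1) * p ^ t i := by ring
              _ ≤ p * p ^ t i := Nat.mul_le_mul_right _ hvi
              _ = p ^ (t i + 1) := by ring
          · rw [← Nat.mod_mod_of_dvd X' (pow_dvd_pow p (Nat.le_succ (t i))), hX',
              Nat.add_mul_mod_self_right, Nat.mod_eq_of_lt h.lt]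
        · simp only [if_neg hji]; exact h
      · have := ht i hi
        dsimp only
        split_ifs with h <;> omega
      · rw [hJ', ← hv3, pow_add, mul_assoc, ← Finset.prod_mul_distrib]
        congr 1
        refine Finset.prod_congr rfl fun i hi => ?_
        have hi := Finset.mem_range.1 hi
        dsimp only
        split_ifs with h
        · have := ht i hi
          rw [← pow_mul, ← pow_add]
          congr 1
          rw [mul_add]
          congr 1
          rw [mul_left_comm, ← pow_add, mul_comm, show n i - (t i + 1) + t i = n i - 1 by omega]
        · rw [hX0 i hi h, (hv2 i hi).2 (if_neg h)]
          simp
  · rintro u c₂ ⟨d, t, X, M, K, rfl, hd, hI, ht, hrel, hmin, hc⟩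
    refine QueryM.Spec.ret ⟨k, d, fun i => p ^ (n i - t i) * X i, hk, hk', ?_, ?_, ?_⟩
    · refine Prod.ext rfl (List.map_congr_left fun i hi => ?_)
      have hi := List.mem_range.1 hi
      rw [hbasis i hi, getD_map_range _ _ hi]
    · rw [Nat.sub_self, add_zero] at hrel
      exact isRelation_of_minimal hp hα hrel hmin
    · have hK : ∑ i ∈ Finset.range s, (K i).card ≤ ∑ i ∈ Finset.range s, onlineCost p (n i) := by
        refine Finset.sum_le_sum fun i hi => ?_
        have hi := Finset.mem_range.1 hi
        have hw := onlineWidth_eq (n i)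
        refine (Finset.card_le_card ((hI i hi).subset (X i)
          (Nat.mod_eq_of_lt (hI i hi).lt))).trans (card_onlineSet_le (by omega) (hn i hi) ?_)
        rw [hw, pow_add]
        have := Nat.pow_log_le_self 2 (hn i hi).ne'
        omega
      have hr : ∑ i ∈ Finset.range k,
          (rankAbove n s (k - 1 - i) + searchCost p (rankAbove n s (k - 1 - i))) =
          ∑ j ∈ Finset.range k, (rankAbove n s j + searchCost p (rankAbove n s j)) :=
        Finset.sum_range_reflect (fun j => rankAbove n s j + searchCost p (rankAbove n s j)) k
      rw [hr] at hc
      omega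

end Relation

/-! ### Reduction of a relation, and the extended basis. -/

/-- The least `t` with `p ^ n ∣ x * p ^ t`. -/
def orderLevel (p n x : ℕ) : ℕ := rangeSum n fun t => if (x * p ^ t) % p ^ n = 0 then 0 else 1

@[fun_prop] theorem primrec_orderLevel {α : Type*} [Primcodable α] {p n x : α → ℕ}
    (hp : Primrec p) (hn : Primrec n) (hx : Primrec x) :
    Primrec fun a => orderLevel (p a) (n a) (x a) := by
  unfold orderLevel; fun_prop

/-- The divisibility is monotone in `t` and holds for `t = n`, so counting the failures below `n`
gives the least `t` for which it holds. -/
theorem dvd_mul_pow_iff_orderLevel_le (p n x t : ℕ) :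
    p ^ n ∣ x * p ^ t ↔ orderLevel p n x ≤ t := by
  have hmono : ∀ t t', t ≤ t' → p ^ n ∣ x * p ^ t → p ^ n ∣ x * p ^ t' := fun t t' h h' =>
    h'.trans (Nat.mul_dvd_mul_left _ (pow_dvd_pow p h))
  have hn : p ^ n ∣ x * p ^ n := dvd_mul_left _ _
  classical
  have hex : ∃ t, p ^ n ∣ x * p ^ t := ⟨n, hn⟩
  have hfind : ∀ t, p ^ n ∣ x * p ^ t ↔ Nat.find hex ≤ t := fun t =>
    ⟨fun h => Nat.find_min' hex h, fun h => hmono _ _ h (Nat.find_spec hex)⟩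
  have : orderLevel p n x = Nat.find hex := by
    rw [orderLevel, rangeSum_eq]
    have : ∀ t, (if (x * p ^ t) % p ^ n = 0 then 0 else 1) =
        if t < Nat.find hex then 1 else 0 := by
      intro t
      by_cases h : Nat.find hex ≤ t
      · rw [if_pos (Nat.mod_eq_zero_of_dvd ((hfind t).2 h)), if_neg (by omega)]
      · rw [if_neg (fun h' => h ((hfind t).1 (Nat.dvd_of_mod_eq_zero h'))), if_pos (by omega)]
    rw [Finset.sum_congr rfl fun t _ => this t, ← Finset.sum_filter, Finset.sum_const, smul_eq_mul,
      mul_one]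
    have h := Nat.find_min' hex hn
    convert Finset.card_range (Nat.find hex) using 2
    ext t
    simp only [Finset.mem_filter, Finset.mem_range]
    omega
  rw [this, hfind]

theorem orderLevel_le (p n x : ℕ) : orderLevel p n x ≤ n :=
  (dvd_mul_pow_iff_orderLevel_le p n x n).1 (dvd_mul_left _ _)

theorem pow_sub_orderLevel_dvd {p : ℕ} (hp : 0 < p) (n x : ℕ) :
    p ^ (n - orderLevel p n x) ∣ x := by
  have h := (dvd_mul_pow_iff_orderLevel_le p n x _).2 le_rfl
  have h' := orderLevel_le p n x
  nth_rw 1 [show n = (n - orderLevel p n x) + orderLevel p n x by omega] at h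
  rw [pow_add] at h
  exact Nat.dvd_of_mul_dvd_mul_right (pow_pos hp _) h

theorem not_dvd_div_of_orderLevel {p : ℕ} (hp : 0 < p) {n x : ℕ} (h : orderLevel p n x ≠ 0) :
    ¬ p ∣ x / p ^ (n - orderLevel p n x) := by
  have h1 := pow_sub_orderLevel_dvd hp n x
  have h2 := orderLevel_le p n x
  have h3 := (dvd_mul_pow_iff_orderLevel_le p n x (orderLevel p n x - 1)).not.2 (by omega)
  generalize orderLevel p n x = w at *
  rintro ⟨q, hq⟩
  have hx := Nat.eq_mul_of_div_eq_right h1 hq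
  refine h3 ⟨q, ?_⟩
  rw [hx, show p ^ (n - w) * (p * q) * p ^ (w - 1) = p ^ (n - w) * p ^ 1 * p ^ (w - 1) * q by ring,
    ← pow_add, ← pow_add, show n - w + 1 + (w - 1) = n by omega]

/-- The index of an entry for which the order of the power of the basis element is maximal. -/
def topEntry (p s : ℕ) (l : List (ℕ × ℕ × ℕ)) : ℕ :=
  (List.range s).foldl (fun b i =>
    if orderLevel p (l.getD b (0, 0, 0)).2.1 (l.getD b (0, 0, 0)).2.2 <
      orderLevel p (l.getD i (0, 0, 0)).2.1 (l.getD i (0, 0, 0)).2.2 then i else b) 0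

@[fun_prop] theorem primrec_topEntry {α : Type*} [Primcodable α] {p s : α → ℕ}
    {l : α → List (ℕ × ℕ × ℕ)} (hp : Primrec p) (hs : Primrec s) (hl : Primrec l) :
    Primrec fun a => topEntry (p a) (s a) (l a) := by
  unfold topEntry; fun_prop

theorem foldl_max_index (w : ℕ → ℕ) (s : ℕ) (hs : 0 < s) :
    (List.range s).foldl (fun b i => if w b < w i then i else b) 0 < s ∧
    ∀ j < s, w j ≤ w ((List.range s).foldl (fun b i => if w b < w i then i else b) 0) := by
  induction s with
  | zero => omega
  | succ s ih =>
    rw [List.range_succ, List.foldl_append]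
    simp only [List.foldl_cons, List.foldl_nil]
    rcases Nat.eq_zero_or_pos s with rfl | h
    · simp
    · obtain ⟨h1, h2⟩ := ih h
      split_ifs with h3
      · refine ⟨by omega, fun j hj => ?_⟩
        rcases Nat.lt_succ_iff_lt_or_eq.1 hj with hj | rfl
        · exact (h2 j hj).trans h3.le
        · exact le_rfl
      · refine ⟨by omega, fun j hj => ?_⟩
        rcases Nat.lt_succ_iff_lt_or_eq.1 hj with hj | rfl
        · exact h2 j hj
        · omega

/-- A solution `y < N` of `a * y ≡ x` modulo `N`, if there is one. -/
def solveMod (N a x : ℕ) : ℕ :=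
  (List.range N).foldl (fun b y => if (a * y) % N = x % N then y else b) 0

@[fun_prop] theorem primrec_solveMod {α : Type*} [Primcodable α] {N b x : α → ℕ}
    (hN : Primrec N) (hb : Primrec b) (hx : Primrec x) :
    Primrec fun a => solveMod (N a) (b a) (x a) := by
  unfold solveMod; fun_prop

theorem solveMod_spec {N a x y : ℕ} (hy : y < N) (h : (a * y) % N = x % N) :
    (a * solveMod N a x) % N = x % N ∧ solveMod N a x < N := by
  have key : ∀ M, (∃ y < M, (a * y) % N = x % N) →
      (a * ((List.range M).foldl (fun b y => if (a * y) % N = x % N then y else b) 0)) % N =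
        x % N ∧ (List.range M).foldl (fun b y => if (a * y) % N = x % N then y else b) 0 < M := by
    intro M
    induction M with
    | zero => rintro ⟨y, hy, -⟩; omega
    | succ M ih =>
      rintro ⟨y, hy, h⟩
      rw [List.range_succ, List.foldl_append]
      simp only [List.foldl_cons, List.foldl_nil]
      split_ifs with h1
      · exact ⟨h1, by omega⟩
      · have : y ≠ M := by rintro rfl; exact h1 h
        obtain ⟨h2, h3⟩ := ih ⟨y, by omega, h⟩
        exact ⟨h2, by omega⟩
  exact key N ⟨y, hy, h⟩

/-- Replace the entry with index `i` of a list of `s` entries. -/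
def replaceEntry (s i : ℕ) (a : ℕ × ℕ × ℕ) (l : List (ℕ × ℕ × ℕ)) : List (ℕ × ℕ × ℕ) :=
  (List.range s).map fun j => if j = i then a else l.getD j (0, 0, 0)

@[fun_prop] theorem primrec_replaceEntry {α : Type*} [Primcodable α] {s i : α → ℕ}
    {b : α → ℕ × ℕ × ℕ} {l : α → List (ℕ × ℕ × ℕ)} (hs : Primrec s) (hi : Primrec i)
    (hb : Primrec b) (hl : Primrec l) :
    Primrec fun a => replaceEntry (s a) (i a) (b a) (l a) := by
  unfold replaceEntry; fun_prop

/-- Simplify a relation `g ^ (u * p ^ d) * ∏ i, α i ^ x i = 1` at the index `i`: remove `α i` from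
the relation by changing `g`, or exchange `g` and `α i`. The state consists of the entries
`(α i, n i, x i)` and of `g`, `d` and `u`. -/
def reduceAt (e p s i : ℕ) (q : List (ℕ × ℕ × ℕ) × ℕ × ℕ × ℕ) :
    QueryM (List (ℕ × ℕ × ℕ) × ℕ × ℕ × ℕ) := fun ans =>
  if orderLevel p (q.1.getD i (0, 0, 0)).2.1 (q.1.getD i (0, 0, 0)).2.2 = 0 then
    QueryM.ret q ans
  else if q.2.2.1 + orderLevel p (q.1.getD i (0, 0, 0)).2.1 (q.1.getD i (0, 0, 0)).2.2 ≤
      (q.1.getD i (0, 0, 0)).2.1 then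
    QueryM.bind (powQuery e (q.1.getD i (0, 0, 0)).1
      (solveMod (p ^ (q.1.getD i (0, 0, 0)).2.1) (q.2.2.2 * p ^ q.2.2.1)
        (q.1.getD i (0, 0, 0)).2.2)) (fun y =>
      QueryM.bind (QueryM.ask q.2.1 y) fun g => QueryM.ret (replaceEntry s i
        ((q.1.getD i (0, 0, 0)).1, (q.1.getD i (0, 0, 0)).2.1, 0) q.1, g, q.2.2.1, q.2.2.2)) ans
  else QueryM.ret (replaceEntry s i (q.2.1, q.2.2.1 +
      orderLevel p (q.1.getD i (0, 0, 0)).2.1 (q.1.getD i (0, 0, 0)).2.2,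
      q.2.2.2 * p ^ q.2.2.1) q.1, (q.1.getD i (0, 0, 0)).1, (q.1.getD i (0, 0, 0)).2.1 -
        orderLevel p (q.1.getD i (0, 0, 0)).2.1 (q.1.getD i (0, 0, 0)).2.2,
      (q.1.getD i (0, 0, 0)).2.2 / p ^ ((q.1.getD i (0, 0, 0)).2.1 -
        orderLevel p (q.1.getD i (0, 0, 0)).2.1 (q.1.getD i (0, 0, 0)).2.2)) ans

@[fun_prop] theorem primrec_reduceAt {α : Type*} [Primcodable α] {e p s i : α → ℕ}
    {q : α → List (ℕ × ℕ × ℕ) × ℕ × ℕ × ℕ} {r : α → List ℕ} (he : Primrec e) (hp : Primrec p)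
    (hs : Primrec s) (hi : Primrec i) (hq : Primrec q) (hr : Primrec r) :
    Primrec fun a => reduceAt (e a) (p a) (s a) (i a) (q a) (r a) := by
  unfold reduceAt; fun_prop

/-- Extend a basis by an element for which a relation is known. -/
def extendBasis (e p s : ℕ) (basis : List (ℕ × ℕ)) (g d : ℕ) (x : List ℕ) :
    QueryM (List (ℕ × ℕ)) :=
  QueryM.bind (QueryM.loop (List.range (2 * s)) ((List.range s).map fun i =>
      ((basis.getD i (0, 0)).1, (basis.getD i (0, 0)).2, x.getD i 0), g, d, 1)
      fun q _ => reduceAt e p s (topEntry p s q.1) q)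
    fun q => QueryM.ret (((List.range s).map fun i =>
      ((q.1.getD i (0, 0, 0)).1, (q.1.getD i (0, 0, 0)).2.1)) ++
        if q.2.2.1 = 0 then [] else [(q.2.1, q.2.2.1)])

@[fun_prop] theorem primrec_extendBasis {α : Type*} [Primcodable α] {e p s g d : α → ℕ}
    {basis : α → List (ℕ × ℕ)} {x r : α → List ℕ} (he : Primrec e) (hp : Primrec p)
    (hs : Primrec s) (hb : Primrec basis) (hg : Primrec g) (hd : Primrec d) (hx : Primrec x)
    (hr : Primrec r) :
    Primrec fun a => extendBasis (e a) (p a) (s a) (basis a) (g a) (d a) (x a) (r a) := by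
  unfold extendBasis; fun_prop

section Reduction

variable {G : Type*} [CommGroup G] {ident : G → ℕ} {p s : ℕ} {α : ℕ → G} {n : ℕ → ℕ} {g : G}
  {d u : ℕ} {x : ℕ → ℕ}

theorem isCoprime_pow_natCast (hp : p.Prime) (hu : ¬ p ∣ u) (k : ℕ) :
    IsCoprime ((p : ℤ) ^ k) (u : ℤ) := by
  have := Nat.Coprime.pow_left k ((Nat.Prime.coprime_iff_not_dvd hp).2 hu)
  exact_mod_cast Nat.isCoprime_iff_coprime.2 this

/-- As `u` and `x'` are prime to `p`, the parameters `y'` and `y''` of the two descriptions are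
linked by `u * y'' ≡ x' * y'` modulo `p ^ w`. By the maximality of `w`, an error divisible by `p ^
w` does not matter in any other coordinate: multiplied by `x j`, it is divisible by `p ^ n j`. -/
theorem IsRelation.exchange (hp : p.Prime) (h : IsRelation p s α n g d u x) (hu : ¬ p ∣ u) {i : ℕ}
    (hi : i < s) {v w x' : ℕ} (hn : n i = v + w) (hx : x i = p ^ v * x') (hx' : ¬ p ∣ x')
    (hmax : ∀ j < s, p ^ n j ∣ x j * p ^ w) :
    IsRelation p s (Function.update α i g) (Function.update n i (d + w)) (α i) v x'
      (Function.update x i (u * p ^ d)) := by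
  have hp0 : (p : ℤ) ≠ 0 := by exact_mod_cast hp.ne_zero
  have hi' := Finset.mem_range.2 hi
  have hmax' : ∀ j < s, ∀ a : ℤ, (p : ℤ) ^ w ∣ a → (p : ℤ) ^ n j ∣ a * x j := by
    rintro j hj a ⟨b, rfl⟩
    have : (p : ℤ) ^ n j ∣ x j * p ^ w := by exact_mod_cast hmax j hj
    rw [show (p : ℤ) ^ w * b * x j = (x j * p ^ w) * b by ring]
    exact this.mul_right _
  intro y z
  have e : α i ^ y * ∏ j ∈ Finset.range s, Function.update α i g j ^ z j =
      g ^ z i * ∏ j ∈ Finset.range s, α j ^ Function.update z i y j := by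
    rw [← Finset.mul_prod_erase _ _ hi', ← Finset.mul_prod_erase _ (fun j => α j ^ _) hi']
    simp only [Function.update_self]
    rw [mul_left_comm]
    congr 2
    refine Finset.prod_congr rfl fun j hj => ?_
    have := Finset.ne_of_mem_erase hj
    simp only [Function.update_of_ne this]
  rw [e, h]
  constructor
  · rintro ⟨y', hy', hz⟩
    have h1 := hz i hi
    rw [Function.update_self, hn, hx] at h1
    push_cast at h1
    have h2 : (p : ℤ) ^ v ∣ y := by
      refine (isCoprime_pow_natCast hp hu v).dvd_of_dvd_mul_left ?_
      have := (pow_dvd_pow (p : ℤ) (Nat.le_add_right v w)).trans h1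
      have h3 : (p : ℤ) ^ v ∣ y' * (p ^ v * x') := ⟨y' * x', by ring⟩
      have := dvd_add this h3
      rwa [sub_add_cancel] at this
    obtain ⟨y'', rfl⟩ := h2
    have h3 : (p : ℤ) ^ w ∣ x' * y' - u * y'' := by
      rw [pow_add, show (u : ℤ) * (p ^ v * y'') - y' * (p ^ v * x') =
        p ^ v * -(x' * y' - u * y'') by ring] at h1
      exact (dvd_neg).1 (Int.dvd_of_mul_dvd_mul_left (pow_ne_zero _ hp0) h1)
    refine ⟨y'', rfl, fun j hj => ?_⟩
    by_cases hji : j = i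
    · subst hji
      rw [Function.update_self, Function.update_self, hy', pow_add]
      push_cast
      rw [show (x' : ℤ) * (p ^ d * y') - y'' * (u * p ^ d) = p ^ d * (x' * y' - u * y'') by ring]
      exact mul_dvd_mul_left _ h3
    · have h4 := hz j hj
      simp only [Function.update_of_ne hji] at h4 ⊢
      refine (isCoprime_pow_natCast hp hu _).dvd_of_dvd_mul_left ?_
      rw [show (u : ℤ) * (x' * z j - y'' * x j) =
        x' * (u * z j - y' * x j) + (x' * y' - u * y'') * x j by ring]
      exact dvd_add (h4.mul_left _) (hmax' j hj _ h3)
  · rintro ⟨y'', rfl, hz⟩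
    have h1 := hz i hi
    rw [Function.update_self, Function.update_self] at h1
    push_cast at h1
    have h2 : (p : ℤ) ^ d ∣ z i := by
      refine (isCoprime_pow_natCast hp hx' d).dvd_of_dvd_mul_left ?_
      have := (pow_dvd_pow (p : ℤ) (Nat.le_add_right d w)).trans h1
      have h3 : (p : ℤ) ^ d ∣ y'' * (u * p ^ d) := ⟨y'' * u, by ring⟩
      have := dvd_add this h3
      rwa [sub_add_cancel] at this
    obtain ⟨y', hy'⟩ := h2
    have h3 : (p : ℤ) ^ w ∣ u * y'' - x' * y' := by
      rw [hy', pow_add, show (x' : ℤ) * (p ^ d * y') - y'' * (u * p ^ d) =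
        p ^ d * -(u * y'' - x' * y') by ring] at h1
      exact (dvd_neg).1 (Int.dvd_of_mul_dvd_mul_left (pow_ne_zero _ hp0) h1)
    refine ⟨y', hy', fun j hj => ?_⟩
    by_cases hji : j = i
    · subst hji
      rw [Function.update_self, hn, hx, pow_add]
      push_cast
      rw [show (u : ℤ) * (p ^ v * y'') - y' * (p ^ v * x') = p ^ v * (u * y'' - x' * y') by ring]
      exact mul_dvd_mul_left _ h3
    · have h4 := hz j hj
      simp only [Function.update_of_ne hji] at h4 ⊢
      refine (isCoprime_pow_natCast hp hx' _).dvd_of_dvd_mul_left ?_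
      rw [show (x' : ℤ) * (u * z j - y' * x j) =
        u * (x' * z j - y'' * x j) + (u * y'' - x' * y') * x j by ring]
      exact dvd_add (h4.mul_left _) (hmax' j hj _ h3)

/-- Passing from `g` to `g * α i ^ y₀` adds `y₀ * y` to the exponent of `α i`, and by `hy₀` this
cancels `x i`. -/
theorem IsRelation.eliminate (h : IsRelation p s α n g d u x) {i : ℕ} (hi : i < s) {y₀ : ℕ}
    (hy₀ : (p : ℤ) ^ n i ∣ u * p ^ d * y₀ - x i) :
    IsRelation p s α n (g * α i ^ y₀) d u (Function.update x i 0) := by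
  have hi' := Finset.mem_range.2 hi
  intro y z
  have e : (g * α i ^ y₀) ^ y * ∏ j ∈ Finset.range s, α j ^ z j =
      g ^ y * ∏ j ∈ Finset.range s, α j ^ Function.update z i (z i + y₀ * y) j := by
    have e' : ∏ j ∈ (Finset.range s).erase i, α j ^ Function.update z i (z i + y₀ * y) j =
        ∏ j ∈ (Finset.range s).erase i, α j ^ z j := Finset.prod_congr rfl fun j hj => by
      rw [Function.update_of_ne (Finset.ne_of_mem_erase hj)]
    rw [← Finset.mul_prod_erase _ _ hi', ← Finset.mul_prod_erase _
      (fun j => α j ^ Function.update z i (z i + y₀ * y) j) hi', e', Function.update_self, mul_zpow,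
      zpow_add, ← zpow_natCast (α i), ← zpow_mul, mul_assoc, mul_comm (α i ^ z i), mul_assoc,
      mul_comm (∏ _ ∈ _, _), mul_left_comm (α i ^ z i)]
  rw [e, h]
  refine exists_congr fun y' => and_congr_right fun hy' => forall₂_congr fun j _ => ?_
  by_cases hji : j = i
  · subst hji
    rw [Function.update_self, Function.update_self, hy',
      show (u : ℤ) * (z j + y₀ * (p ^ d * y')) - y' * x j =
        (u * z j - y' * (0 : ℕ)) + y' * (u * p ^ d * y₀ - x j) by push_cast; ring]
    exact dvd_add_left (hy₀.mul_left _)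
  · rw [Function.update_of_ne hji, Function.update_of_ne hji]

/-- The state of `reduceAt`, as a list. -/
def reductionState (ident : G → ℕ) (s : ℕ) (α : ℕ → G) (n : ℕ → ℕ) (g : G) (d u : ℕ)
    (x : ℕ → ℕ) : List (ℕ × ℕ × ℕ) × ℕ × ℕ × ℕ :=
  ((List.range s).map fun i => (ident (α i), n i, x i), ident g, d, u)

/-- The invariant of `reduceAt`. -/
structure IsReduction (K : Subgroup G) (p s : ℕ) (α : ℕ → G) (n : ℕ → ℕ) (g : G) (d u : ℕ)
    (x : ℕ → ℕ) : Prop where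
  rel : IsRelation p s α n g d u x
  not_dvd : ¬ p ∣ u
  pos : ∀ i < s, 0 < n i
  le : K ≤ Subgroup.closure (insert g (α '' Set.Iio s))

/-- A bound for the number of steps that are left in a reduction. -/
def reductionMeasure (p s : ℕ) (n : ℕ → ℕ) (d : ℕ) (x : ℕ → ℕ) : ℕ :=
  ∑ i ∈ Finset.range s, if orderLevel p (n i) (x i) = 0 then 0 else
    if d + orderLevel p (n i) (x i) ≤ n i then 1 else 2

/-- The cost of a reduction is bounded by the decrease of this quantity. -/
def reductionPotential (p s : ℕ) (n : ℕ → ℕ) (d : ℕ) (x : ℕ → ℕ) : ℕ :=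
  (∑ i ∈ Finset.range s, if orderLevel p (n i) (x i) = 0 then 0 else n i) + d

theorem orderLevel_zero (p n : ℕ) : orderLevel p n 0 = 0 :=
  Nat.le_zero.1 ((dvd_mul_pow_iff_orderLevel_le p n 0 0).1 (by simp))

theorem orderLevel_mul_pow (hp : p.Prime) (hu : ¬ p ∣ u) (w : ℕ) :
    orderLevel p (d + w) (u * p ^ d) = w := by
  refine le_antisymm ((dvd_mul_pow_iff_orderLevel_le _ _ _ _).1 ?_) ?_
  · rw [mul_assoc, ← pow_add]; exact dvd_mul_left _ _
  · by_contra h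
    have h1 := (dvd_mul_pow_iff_orderLevel_le p (d + w) (u * p ^ d) _).2 le_rfl
    generalize orderLevel p (d + w) (u * p ^ d) = t at *
    have h2 := (pow_dvd_pow p (show d + t + 1 ≤ d + w by omega)).trans h1
    rw [mul_assoc, ← pow_add, pow_succ', mul_comm u, mul_comm p] at h2
    exact hu (Nat.dvd_of_mul_dvd_mul_left (pow_pos hp.pos _) h2)

theorem update_of_lt {β : Type*} (f : ℕ → β) (b : β) {i : ℕ} (hi : i < s) :
    Function.update f s b i = f i := Function.update_of_ne hi.ne _ _

theorem replaceEntry_map {i : ℕ} (a : ℕ × ℕ × ℕ) (f : ℕ → ℕ × ℕ × ℕ) :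
    replaceEntry s i a ((List.range s).map f) =
      (List.range s).map fun j => if j = i then a else f j := by
  refine List.map_congr_left fun j hj => ?_
  rw [getD_map_range _ _ (List.mem_range.1 hj)]

theorem IsReduction.exchange {K : Subgroup G} (hp : p.Prime) (h : IsReduction K p s α n g d u x)
    {i : ℕ} (hi : i < s)
    (hmax : ∀ j < s, orderLevel p (n j) (x j) ≤ orderLevel p (n i) (x i))
    (h0 : orderLevel p (n i) (x i) ≠ 0) :
    IsReduction K p s (Function.update α i g)
      (Function.update n i (d + orderLevel p (n i) (x i))) (α i)
      (n i - orderLevel p (n i) (x i)) (x i / p ^ (n i - orderLevel p (n i) (x i)))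
      (Function.update x i (u * p ^ d)) := by
  have hle := orderLevel_le p (n i) (x i)
  have hnd := not_dvd_div_of_orderLevel hp.pos h0
  refine ⟨h.rel.exchange hp h.not_dvd hi (by omega)
    (Nat.mul_div_cancel' (pow_sub_orderLevel_dvd hp.pos _ _)).symm hnd fun j hj =>
    (dvd_mul_pow_iff_orderLevel_le _ _ _ _).2 (hmax j hj), hnd, fun j hj => ?_, h.le.trans ?_⟩
  · by_cases hji : j = i
    · subst hji; rw [Function.update_self]; omega
    · rw [Function.update_of_ne hji]; exact h.pos j hj
  · rw [Subgroup.closure_le, Set.insert_subset_iff]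
    refine ⟨Subgroup.subset_closure (Set.mem_insert_of_mem _ ⟨i, hi, by simp⟩), ?_⟩
    rintro _ ⟨j, hj, rfl⟩
    by_cases hji : j = i
    · subst hji; exact Subgroup.subset_closure (Set.mem_insert _ _)
    · exact Subgroup.subset_closure (Set.mem_insert_of_mem _ ⟨j, hj, by simp [hji]⟩)

theorem IsReduction.eliminate {K : Subgroup G} (h : IsReduction K p s α n g d u x) {i : ℕ}
    (hi : i < s) {y₀ : ℕ} (hy₀ : (p : ℤ) ^ n i ∣ u * p ^ d * y₀ - x i) :
    IsReduction K p s α n (g * α i ^ y₀) d u (Function.update x i 0) := by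
  refine ⟨h.rel.eliminate hi hy₀, h.not_dvd, h.pos, h.le.trans ?_⟩
  have hα : ∀ j < s, α j ∈ Subgroup.closure (insert (g * α i ^ y₀) (α '' Set.Iio s)) := fun j hj =>
    Subgroup.subset_closure (Set.mem_insert_of_mem _ ⟨j, hj, rfl⟩)
  rw [Subgroup.closure_le, Set.insert_subset_iff]
  constructor
  · have := Subgroup.mul_mem _ (Subgroup.subset_closure (Set.mem_insert (g * α i ^ y₀)
      (α '' Set.Iio s))) (Subgroup.inv_mem _ (Subgroup.pow_mem _ (hα i hi) y₀))
    rwa [mul_inv_cancel_right] at this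
  · rintro _ ⟨j, hj, rfl⟩
    exact hα j hj

theorem exists_solution (hp : p.Prime) (hu : ¬ p ∣ u) {N : ℕ} {X : ℕ} (h : p ^ d ∣ X) :
    ∃ y < p ^ N, (u * p ^ d * y) % p ^ N = X % p ^ N := by
  obtain ⟨X, rfl⟩ := h
  obtain ⟨y, hy⟩ := Nat.exists_mul_mod_eq_of_coprime (k := p ^ N) X
    (Nat.Coprime.pow_right N ((Nat.Prime.coprime_iff_not_dvd hp).2 hu).symm)
    (pow_ne_zero _ hp.ne_zero)
  refine ⟨y % p ^ N, Nat.mod_lt _ (pow_pos hp.pos _), ?_⟩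
  rw [Nat.mul_mod, Nat.mod_mod, ← Nat.mul_mod, mul_comm u, mul_assoc, Nat.mul_mod, hy.2,
    ← Nat.mul_mod]

theorem reductionMeasure_eliminate {i : ℕ} (hi : i < s) (h0 : orderLevel p (n i) (x i) ≠ 0) :
    reductionMeasure p s n d (Function.update x i 0) < reductionMeasure p s n d x := by
  refine Finset.sum_lt_sum (fun j _ => ?_) ⟨i, Finset.mem_range.2 hi, ?_⟩
  · by_cases hji : j = i
    · subst hji; simp [orderLevel_zero]
    · rw [Function.update_of_ne hji]
  · rw [Function.update_self, orderLevel_zero, if_pos rfl, if_neg h0]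
    split_ifs <;> norm_num

theorem reductionPotential_eliminate {i : ℕ} (hi : i < s) (h0 : orderLevel p (n i) (x i) ≠ 0) :
    reductionPotential p s n d (Function.update x i 0) + n i = reductionPotential p s n d x := by
  have hi' := Finset.mem_range.2 hi
  unfold reductionPotential
  rw [← Finset.add_sum_erase _ _ hi', ← Finset.add_sum_erase (Finset.range s)
    (fun i => if orderLevel p (n i) (x i) = 0 then 0 else n i) hi', Function.update_self,
    orderLevel_zero, if_pos rfl, if_neg h0, Finset.sum_congr rfl fun j hj => by
      rw [Function.update_of_ne (Finset.ne_of_mem_erase hj)]]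
  ring

/-- The exchange turns `n i < d + w` into the opposite inequality, so that `i` can be eliminated
next. It also decreases `d`, so no other index gets worse. -/
theorem reductionMeasure_exchange (hp : p.Prime) (hu : ¬ p ∣ u) {i w : ℕ} (hi : i < s)
    (hw : orderLevel p (n i) (x i) = w) (h0 : w ≠ 0) (hd : n i < d + w) :
    reductionMeasure p s (Function.update n i (d + w)) (n i - w)
      (Function.update x i (u * p ^ d)) < reductionMeasure p s n d x := by
  refine Finset.sum_lt_sum (fun j _ => ?_) ⟨i, Finset.mem_range.2 hi, ?_⟩
  · by_cases hji : j = i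
    · subst hji
      simp only [Function.update_self]
      rw [orderLevel_mul_pow hp hu, hw, if_neg h0, if_neg h0, if_neg (show ¬ d + w ≤ n j by omega)]
      split_ifs <;> norm_num
    · simp only [Function.update_of_ne hji]
      split_ifs <;> omega
  · have h := orderLevel_le p (n i) (x i)
    simp only [Function.update_self]
    rw [orderLevel_mul_pow hp hu, hw, if_neg h0, if_neg h0, if_neg (show ¬ d + w ≤ n i by omega),
      if_pos (by omega)]
    norm_num

theorem reductionPotential_exchange (hp : p.Prime) (hu : ¬ p ∣ u) {i w : ℕ} (hi : i < s)
    (hw : orderLevel p (n i) (x i) = w) (h0 : w ≠ 0) :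
    reductionPotential p s (Function.update n i (d + w)) (n i - w)
      (Function.update x i (u * p ^ d)) = reductionPotential p s n d x := by
  have hi' := Finset.mem_range.2 hi
  have h := orderLevel_le p (n i) (x i)
  unfold reductionPotential
  rw [← Finset.add_sum_erase _ _ hi', ← Finset.add_sum_erase (Finset.range s)
    (fun i => if orderLevel p (n i) (x i) = 0 then 0 else n i) hi', Function.update_self,
    Function.update_self, orderLevel_mul_pow hp hu, hw, if_neg h0, if_neg h0,
    Finset.sum_congr rfl fun j hj => by
      rw [Function.update_of_ne (Finset.ne_of_mem_erase hj),
        Function.update_of_ne (Finset.ne_of_mem_erase hj)]]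
  omega

theorem sum_exchange {i w : ℕ} (hi : i < s) (hw : w ≤ n i) :
    ∑ j ∈ Finset.range s, Function.update n i (d + w) j + (n i - w) =
      ∑ j ∈ Finset.range s, n j + d := by
  have hi' := Finset.mem_range.2 hi
  rw [← Finset.add_sum_erase _ _ hi', ← Finset.add_sum_erase (Finset.range s) n hi',
    Function.update_self, Finset.sum_congr rfl fun j hj => by
      rw [Function.update_of_ne (Finset.ne_of_mem_erase hj)]]
  change d + w + ((Finset.range s).erase i).sum n + (n i - w) =
    n i + ((Finset.range s).erase i).sum n + d
  omega

theorem spec_reduceAt (hp : p.Prime) {K : Subgroup G} (h : IsReduction K p s α n g d u x) {i : ℕ}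
    (hi : i < s) (hmax : ∀ j < s, orderLevel p (n j) (x j) ≤ orderLevel p (n i) (x i)) :
    QueryM.Spec ident (reduceAt (ident 1) p s i (reductionState ident s α n g d u x)) fun q c =>
      ∃ (α' : ℕ → G) (n' : ℕ → ℕ) (g' : G) (d' u' : ℕ) (x' : ℕ → ℕ),
        q = reductionState ident s α' n' g' d' u' x' ∧ IsReduction K p s α' n' g' d' u' x' ∧
        ∑ j ∈ Finset.range s, n' j + d' = ∑ j ∈ Finset.range s, n j + d ∧
        reductionMeasure p s n' d' x' ≤ reductionMeasure p s n d x - 1 ∧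
        c + 3 * (Nat.log 2 p + 1) * reductionPotential p s n' d' x' ≤
          3 * (Nat.log 2 p + 1) * reductionPotential p s n d x := by
  have hget : (reductionState ident s α n g d u x).1.getD i (0, 0, 0) = (ident (α i), n i, x i) :=
    getD_map_range _ _ hi
  have hle := orderLevel_le p (n i) (x i)
  unfold reduceAt
  rw [hget]
  dsimp only
  by_cases h0 : orderLevel p (n i) (x i) = 0
  · simp only [if_pos h0]
    refine QueryM.Spec.ret ⟨α, n, g, d, u, x, rfl, h, rfl, ?_, by omega⟩
    rw [show reductionMeasure p s n d x = 0 from Finset.sum_eq_zero fun j hj =>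
      if_pos (by have := hmax j (Finset.mem_range.1 hj); omega)]
  simp only [if_neg h0]
  -- In this case `p ^ d` divides `x i`, so `α i ^ x i` is a `p ^ d`-th power and can be absorbed
  -- into `g`.
  by_cases hd : d + orderLevel p (n i) (x i) ≤ n i
  · rw [show (reductionState ident s α n g d u x).2.2.1 = d from rfl]
    simp only [if_pos hd]
    obtain ⟨y, hy, hy'⟩ := exists_solution hp h.not_dvd (N := n i) (d := d)
      ((pow_dvd_pow p (by omega)).trans (pow_sub_orderLevel_dvd hp.pos (n i) (x i)))
    obtain ⟨hy1, hy2⟩ := solveMod_spec hy hy'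
    refine QueryM.Spec.bind (spec_powQuery (α i) _) ?_
    rintro _ c ⟨rfl, hc, -⟩
    refine QueryM.Spec.bind (QueryM.Spec.ask g _ (Q := fun v c => v = _ ∧ c = 1) ⟨rfl, rfl⟩) ?_
    rintro _ _ ⟨rfl, rfl⟩
    change _ ≤ 2 * Nat.log 2 (solveMod (p ^ n i) (u * p ^ d) (x i)) at hc
    change (u * p ^ d * solveMod (p ^ n i) (u * p ^ d) (x i)) % _ = _ at hy1
    refine QueryM.Spec.ret ⟨α, n, g * α i ^ solveMod (p ^ n i) (u * p ^ d) (x i), d, u,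
      Function.update x i 0, ?_, h.eliminate hi ?_, rfl,
      Nat.le_sub_one_of_lt (reductionMeasure_eliminate hi h0), ?_⟩
    · refine Prod.ext ?_ rfl
      refine (replaceEntry_map _ _).trans (List.map_congr_left fun j _ => ?_)
      by_cases hji : j = i
      · subst hji; simp
      · simp [hji]
    · have := (Nat.modEq_iff_dvd.1 (show Nat.ModEq _ _ _ from hy1.symm))
      exact_mod_cast this
    -- An elimination takes one power with exponent below `p ^ n i` and one multiplication, at most
    -- `3 * (Nat.log 2 p + 1) * n i` operations, and lowers the potential by `n i`. Exchanges are
    -- free.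
    · rw [← reductionPotential_eliminate hi h0 (d := d), mul_add (3 * _)]
      have h1 : Nat.log 2 (solveMod (p ^ n i) (u * p ^ d) (x i)) ≤ n i * (Nat.log 2 p + 1) := by
        refine (Nat.log_mono_right hy2.le).trans ?_
        refine (Nat.log_lt_of_lt_pow (pow_ne_zero _ hp.ne_zero) ?_).le
        rw [mul_comm, pow_mul]
        exact Nat.pow_lt_pow_left (Nat.lt_pow_succ_log_self (by norm_num) p) (h.pos i hi).ne'
      have h2 : 1 ≤ n i * (Nat.log 2 p + 1) := Nat.mul_pos (h.pos i hi) (Nat.succ_pos _)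
      have h3 : 3 * (Nat.log 2 p + 1) * n i = 3 * (n i * (Nat.log 2 p + 1)) := by ring
      omega
  · rw [show (reductionState ident s α n g d u x).2.2.1 = d from rfl]
    simp only [if_neg hd]
    refine QueryM.Spec.ret ⟨_, _, _, _, _, _, ?_, h.exchange hp hi hmax h0, sum_exchange hi hle,
      Nat.le_sub_one_of_lt (reductionMeasure_exchange hp h.not_dvd hi rfl h0 (by omega)), ?_⟩
    · refine Prod.ext ?_ rfl
      refine (replaceEntry_map _ _).trans (List.map_congr_left fun j _ => ?_)
      by_cases hji : j = i
      · subst hji; simp [reductionState]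
      · simp [hji]
    · rw [reductionPotential_exchange hp h.not_dvd hi rfl h0]
      omega

/-- Each index needs at most one exchange and one elimination, so `2 * s` rounds suffice. Then all
`α i ^ x i` are trivial, and the relation says that `g` is independent of the `α i` with order `p ^
d`. For `d = 0` it is the identity and is dropped. -/
theorem spec_extendBasis (hp : p.Prime) (hn : ∀ i < s, 0 < n i) {basis : List (ℕ × ℕ)}
    (hbasis : ∀ i < s, basis.getD i (0, 0) = (ident (α i), n i))
    (hrel : IsRelation p s α n g d 1 x) :
    QueryM.Spec ident (extendBasis (ident 1) p s basis (ident g) d ((List.range s).map x))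
      fun l c => ∃ (s' : ℕ) (α' : ℕ → G) (n' : ℕ → ℕ),
        l = ((List.range s').map fun i => (ident (α' i), n' i)) ∧ (s' = s ∨ s' = s + 1) ∧
        IsIndependent p s' α' n' ∧ (∀ i < s', 0 < n' i) ∧
        Subgroup.closure (insert g (α '' Set.Iio s)) ≤ Subgroup.closure (α' '' Set.Iio s') ∧
        ∑ i ∈ Finset.range s', n' i = ∑ i ∈ Finset.range s, n i + d ∧
        c ≤ 3 * (Nat.log 2 p + 1) * (∑ i ∈ Finset.range s, n i + d) := by
  have h0 : IsReduction (Subgroup.closure (insert g (α '' Set.Iio s))) p s α n g d 1 x :=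
    ⟨hrel, hp.one_lt.ne' ∘ Nat.dvd_one.1, hn, le_rfl⟩
  have hm : reductionMeasure p s n d x ≤ 2 * s := by
    refine (Finset.sum_le_card_nsmul _ _ 2 fun i _ => ?_).trans (by simp [mul_comm])
    split_ifs <;> norm_num
  have hP : reductionPotential p s n d x ≤ ∑ i ∈ Finset.range s, n i + d := by
    unfold reductionPotential
    gcongr with i
    split_ifs <;> simp
  refine QueryM.Spec.bind (QueryM.Spec.loop_range (2 * s) _ (fun t q c =>
    ∃ (α' : ℕ → G) (n' : ℕ → ℕ) (g' : G) (d' u' : ℕ) (x' : ℕ → ℕ),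
        q = reductionState ident s α' n' g' d' u' x' ∧
        IsReduction (Subgroup.closure (insert g (α '' Set.Iio s))) p s α' n' g' d' u' x' ∧
        ∑ j ∈ Finset.range s, n' j + d' = ∑ j ∈ Finset.range s, n j + d ∧
        reductionMeasure p s n' d' x' ≤ 2 * s - t ∧
        c + 3 * (Nat.log 2 p + 1) * reductionPotential p s n' d' x' ≤
          3 * (Nat.log 2 p + 1) * (∑ i ∈ Finset.range s, n i + d)) ?_ ?_) ?_
  · refine ⟨α, n, g, d, 1, x, ?_, h0, rfl, hm, ?_⟩
    · refine Prod.ext (List.map_congr_left fun i hi => ?_) rfl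
      rw [hbasis i (List.mem_range.1 hi), getD_map_range _ _ (List.mem_range.1 hi)]
    · rw [zero_add]; gcongr
  · rintro t ht q c ⟨α', n', g', d', u', x', rfl, h1, h2, h3, h4⟩
    have hs : 0 < s := by omega
    have htop := foldl_max_index (fun i => orderLevel p (n' i) (x' i)) s hs
    have htop' : topEntry p s (reductionState ident s α' n' g' d' u' x').1 =
        (List.range s).foldl (fun b i => if orderLevel p (n' b) (x' b) <
          orderLevel p (n' i) (x' i) then i else b) 0 := by
      have key : ∀ (l : List ℕ) (b : ℕ), b < s → (∀ i ∈ l, i < s) →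
          l.foldl (fun b i => if orderLevel p
            ((reductionState ident s α' n' g' d' u' x').1.getD b (0, 0, 0)).2.1
            ((reductionState ident s α' n' g' d' u' x').1.getD b (0, 0, 0)).2.2 < orderLevel p
            ((reductionState ident s α' n' g' d' u' x').1.getD i (0, 0, 0)).2.1
            ((reductionState ident s α' n' g' d' u' x').1.getD i (0, 0, 0)).2.2 then i else b) b =
          l.foldl (fun b i => if orderLevel p (n' b) (x' b) <
            orderLevel p (n' i) (x' i) then i else b) b := by
        intro l
        induction l with
        | nil => intro b _ _; rfl
        | cons i l ih =>
          intro b hb hl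
          have hi : i < s := hl i (by simp)
          have e : ∀ j < s, (reductionState ident s α' n' g' d' u' x').1.getD j (0, 0, 0) =
            (ident (α' j), n' j, x' j) := fun j hj => getD_map_range _ _ hj
          simp only [List.foldl_cons]
          rw [e b hb, e i hi]
          refine ih _ ?_ fun j hj => hl j (by simp [hj])
          dsimp only
          split_ifs <;> assumption
      exact key _ _ hs fun i hi => List.mem_range.1 hi
    rw [htop']
    refine (spec_reduceAt hp h1 htop.1 htop.2).mono ?_
    rintro q c' ⟨α'', n'', g'', d'', u'', x'', rfl, h5, h6, h7, h8⟩
    exact ⟨α'', n'', g'', d'', u'', x'', rfl, h5, by omega, by omega, by omega⟩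
  · rintro q c ⟨α', n', g', d', u', x', rfl, h1, h2, h3, h4⟩
    have hx : ∀ i < s, ∀ a : ℤ, (p : ℤ) ^ n' i ∣ a * x' i := by
      intro i hi a
      have h5 : reductionMeasure p s n' d' x' = 0 := by omega
      have h6 := Finset.sum_eq_zero_iff.1 h5 i (Finset.mem_range.2 hi)
      have h7 : orderLevel p (n' i) (x' i) = 0 := by
        by_contra h
        rw [if_neg h] at h6
        split_ifs at h6
      have h8 := (dvd_mul_pow_iff_orderLevel_le p (n' i) (x' i) 0).2 h7.le
      rw [pow_zero, mul_one] at h8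
      have h9 : (p : ℤ) ^ n' i ∣ x' i := by exact_mod_cast h8
      exact h9.mul_left a
    have hind : ∀ (y : ℤ) (z : ℕ → ℤ), g' ^ y * ∏ i ∈ Finset.range s, α' i ^ z i = 1 ↔
        (p : ℤ) ^ d' ∣ y ∧ ∀ i < s, (p : ℤ) ^ n' i ∣ z i := by
      intro y z
      rw [h1.rel]
      have e : ∀ y' : ℤ, (∀ i < s, (p : ℤ) ^ n' i ∣ u' * z i - y' * x' i) ↔
          ∀ i < s, (p : ℤ) ^ n' i ∣ z i := fun y' => forall₂_congr fun i hi => by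
        rw [dvd_sub_left (hx i hi y')]
        exact ⟨(isCoprime_pow_natCast hp h1.not_dvd _).dvd_of_dvd_mul_left, fun h => h.mul_left _⟩
      simp only [e]
      exact ⟨fun ⟨y', h, h'⟩ => ⟨⟨y', h⟩, h'⟩, fun ⟨⟨y', h⟩, h'⟩ => ⟨y', h, h'⟩⟩
    have hl : ∀ f : ℕ → ℕ × ℕ × ℕ, ((List.range s).map fun i =>
        ((((List.range s).map f).getD i (0, 0, 0)).1,
          (((List.range s).map f).getD i (0, 0, 0)).2.1)) =
        (List.range s).map fun i => ((f i).1, (f i).2.1) := fun f =>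
      List.map_congr_left fun i hi => by rw [getD_map_range _ _ (List.mem_range.1 hi)]
    have hc : c + 0 ≤ 3 * (Nat.log 2 p + 1) * (∑ i ∈ Finset.range s, n i + d) := by omega
    refine QueryM.Spec.ret ?_
    unfold reductionState
    dsimp only
    rw [hl]
    by_cases hd : d' = 0
    · rw [if_pos hd, List.append_nil]
      subst hd
      refine ⟨s, α', n', rfl, .inl rfl, fun z => ?_, h1.pos, h1.le.trans ?_, h2, hc⟩
      · have := hind 0 z
        simpa using this
      · have hg : g' = 1 := by
          have := (hind 1 0).2 (by simp)
          simpa using this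
        rw [hg, Subgroup.closure_insert_one]
    · rw [if_neg hd]
      refine ⟨s + 1, Function.update α' s g', Function.update n' s d', ?_, .inr rfl, fun z => ?_,
        fun i hi => ?_, h1.le.trans ?_, ?_, hc⟩
      · rw [List.range_succ, List.map_append]
        congr 1
        · refine List.map_congr_left fun i hi => ?_
          rw [update_of_lt _ _ (List.mem_range.1 hi), update_of_lt _ _ (List.mem_range.1 hi)]
        · simp
      · rw [Finset.prod_range_succ, Function.update_self, mul_comm, Finset.prod_congr rfl
          fun i hi => by rw [update_of_lt _ _ (Finset.mem_range.1 hi)], hind]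
        constructor
        · rintro ⟨h5, h6⟩ i hi
          rcases Nat.lt_succ_iff_lt_or_eq.1 hi with hi | rfl
          · rw [update_of_lt _ _ hi]; exact h6 i hi
          · rw [Function.update_self]; exact h5
        · intro h5
          refine ⟨?_, fun i hi => ?_⟩
          · have := h5 s (by omega)
            rwa [Function.update_self] at this
          · have := h5 i (by omega)
            rwa [update_of_lt _ _ hi] at this
      · rcases Nat.lt_succ_iff_lt_or_eq.1 hi with hi | rfl
        · rw [update_of_lt _ _ hi]; exact h1.pos i hi
        · rw [Function.update_self]; omega
      · refine Subgroup.closure_mono (Set.insert_subset_iff.2 ⟨⟨s, by simp, by simp⟩, ?_⟩)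
        rintro _ ⟨i, hi, rfl⟩
        exact ⟨i, (Set.mem_Iio.1 hi).trans (Nat.lt_succ_self s), update_of_lt _ _ hi⟩
      · rw [Finset.sum_range_succ, Function.update_self, Finset.sum_congr rfl fun i hi =>
          update_of_lt _ _ (Finset.mem_range.1 hi), h2]

end Reduction

/-! ### Orders and ranks: comparing an independent family with the group. -/

section Counting

variable {G : Type*} [CommGroup G] {p s : ℕ} {α : ℕ → G} {n : ℕ → ℕ}

theorem IsIndependent.zpow_eq_one_iff (hα : IsIndependent p s α n) {i : ℕ} (hi : i < s) (z : ℤ) :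
    α i ^ z = 1 ↔ (p : ℤ) ^ n i ∣ z := by
  have := hα (Pi.single i z)
  rw [Finset.prod_eq_single i (fun j _ hj => by rw [Pi.single_eq_of_ne hj, zpow_zero])
    (fun h => absurd (Finset.mem_range.2 hi) h), Pi.single_eq_same] at this
  rw [this]
  refine ⟨fun h => by simpa using h i hi, fun h j hj => ?_⟩
  by_cases hji : j = i
  · subst hji; simpa using h
  · simp [hji]

theorem IsIndependent.orderOf_eq (hα : IsIndependent p s α n) {i : ℕ} (hi : i < s) :
    orderOf (α i) = p ^ n i := by
  refine Nat.dvd_antisymm ?_ ?_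
  · have := (hα.zpow_eq_one_iff hi ((p : ℤ) ^ n i)).2 dvd_rfl
    exact Int.natCast_dvd_natCast.1 (orderOf_dvd_iff_zpow_eq_one.2 (by exact_mod_cast this))
  · have := (hα.zpow_eq_one_iff hi (orderOf (α i))).1 (by simp [pow_orderOf_eq_one])
    exact_mod_cast this

theorem IsIndependent.dvd_sub_of_prod_eq (hα : IsIndependent p s α n) {x y : ℕ → ℕ}
    (h : ∏ i ∈ Finset.range s, α i ^ x i = ∏ i ∈ Finset.range s, α i ^ y i) {i : ℕ} (hi : i < s) :
    (p : ℤ) ^ n i ∣ x i - y i := by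
  refine (hα fun i => (x i : ℤ) - y i).1 ?_ i hi
  simp only [zpow_sub, zpow_natCast]
  rw [Finset.prod_mul_distrib, Finset.prod_inv_distrib, h, mul_inv_cancel]

theorem IsIndependent.eq_of_prod_eq (hα : IsIndependent p s α n) {x y : ℕ → ℕ}
    (hx : ∀ i < s, x i < p ^ n i) (hy : ∀ i < s, y i < p ^ n i)
    (h : ∏ i ∈ Finset.range s, α i ^ x i = ∏ i ∈ Finset.range s, α i ^ y i) {i : ℕ} (hi : i < s) :
    x i = y i := by
  have h1 : ((p ^ n i : ℕ) : ℤ) ∣ x i - y i := by exact_mod_cast hα.dvd_sub_of_prod_eq h hi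
  have h2 := Nat.modEq_iff_dvd.2 h1
  exact (h2.eq_of_lt_of_lt (hy i hi) (hx i hi)).symm

/-- Extend a family indexed by `Fin s` by zeros. -/
def extendFin {s : ℕ} (x : Fin s → ℕ) (i : ℕ) : ℕ := if h : i < s then x ⟨i, h⟩ else 0

theorem extendFin_of_lt {s : ℕ} (x : Fin s → ℕ) {i : ℕ} (hi : i < s) :
    extendFin x i = x ⟨i, hi⟩ := dif_pos hi

theorem IsIndependent.pow_sum_le_card [Finite G] (hα : IsIndependent p s α n) :
    p ^ ∑ i ∈ Finset.range s, n i ≤ Nat.card G := by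
  have h : Function.Injective fun x : (i : Fin s) → Fin (p ^ n i) =>
      ∏ i ∈ Finset.range s, α i ^ extendFin (fun i => (x i : ℕ)) i := by
    intro x y hxy
    funext i
    have hlt : ∀ x : (i : Fin s) → Fin (p ^ n i), ∀ i < s,
        extendFin (fun i => (x i : ℕ)) i < p ^ n i := fun x i hi => by
      rw [extendFin_of_lt _ hi]; exact (x ⟨i, hi⟩).2
    have := hα.eq_of_prod_eq (hlt x) (hlt y) hxy i.2
    rw [extendFin_of_lt _ i.2, extendFin_of_lt _ i.2] at this
    exact Fin.ext this
  have := Nat.card_le_card_of_injective _ h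
  rwa [Nat.card_pi, Finset.prod_congr rfl fun i _ => Nat.card_fin _,
    ← Finset.prod_range fun i => p ^ n i, Finset.prod_pow_eq_pow_sum] at this

theorem IsIndependent.sum_le [Finite G] (hα : IsIndependent p s α n) (hp : p.Prime) {N : ℕ}
    (hN : Nat.card G = p ^ N) : ∑ i ∈ Finset.range s, n i ≤ N :=
  (Nat.pow_le_pow_iff_right hp.one_lt).1 (hN ▸ hα.pow_sum_le_card)

/-- Kernel and cokernel of the `p`-th power map have the same size. The cokernel is killed by `p`
and needs at most `Group.rank A` generators. -/
theorem card_torsion_le_pow_rank {A : Type*} [CommGroup A] [Finite A] {p : ℕ} (hp : 0 < p) :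
    Nat.card (powMonoidHom p : A →* A).ker ≤ p ^ Group.rank A := by
  have h1 : Nat.card (powMonoidHom p : A →* A).ker =
      Nat.card (A ⧸ (powMonoidHom p : A →* A).range) := by
    have h2 := Subgroup.card_mul_index (powMonoidHom p : A →* A).ker
    have h3 := Subgroup.card_mul_index (powMonoidHom p : A →* A).range
    rw [Subgroup.index_ker, mul_comm] at h2
    rw [← Subgroup.index_eq_card]
    exact Nat.eq_of_mul_eq_mul_left (Nat.card_pos) (h2.trans h3.symm)
  rw [h1]
  have h4 : ∀ q : A ⧸ (powMonoidHom p : A →* A).range, q ^ p = 1 := by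
    rintro ⟨a⟩
    exact (QuotientGroup.eq_one_iff _).2 ⟨a, rfl⟩
  refine (Nat.le_of_dvd (pow_pos hp _) (card_dvd_exponent_pow_rank' _ h4)).trans
    (Nat.pow_le_pow_right hp (Group.rank_le_of_surjective (QuotientGroup.mk' _)
      (QuotientGroup.mk'_surjective _)))

theorem rankAbove_eq_card (n : ℕ → ℕ) (s j : ℕ) :
    rankAbove n s j = ((Finset.range s).filter fun i => j < n i).card := by
  rw [rankAbove, ← Finset.sum_filter, Finset.sum_const, smul_eq_mul, mul_one]

/-- The elements `α i ^ p ^ (n i - 1)` with `j < n i` are `p ^ j`-th powers, independent and of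
order `p`. So the group of `p ^ j`-th powers has at least `p ^ rankAbove n s j` elements killed by
`p`. -/
theorem IsIndependent.rankAbove_le [Finite G] (hα : IsIndependent p s α n) (hp : p.Prime) (j : ℕ) :
    rankAbove n s j ≤ powRank G p j := by
  set J := (Finset.range s).filter fun i => j < n i with hJ
  have hJm : ∀ {i}, i ∈ J ↔ i < s ∧ j < n i := by simp [hJ]
  let e : (J → Fin p) → ℕ → ℕ := fun δ i => if h : i ∈ J then δ ⟨i, h⟩ else 0
  have he : ∀ δ i, i ∉ J → e δ i = 0 := fun δ i h => dif_neg h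
  have hep : ∀ δ i, e δ i < p := fun δ i => by
    by_cases h : i ∈ J
    · simp only [e, dif_pos h]; exact (δ ⟨i, h⟩).2
    · rw [he δ i h]; exact hp.pos
  have hmem : ∀ δ : J → Fin p, ∏ i ∈ Finset.range s, α i ^ (p ^ (n i - 1) * e δ i) ∈
      (powMonoidHom (p ^ j) : G →* G).range := fun δ => by
    refine Subgroup.prod_mem _ fun i hi => ?_
    by_cases h : i ∈ J
    · refine ⟨α i ^ (p ^ (n i - 1 - j) * e δ i), ?_⟩
      have := (hJm.1 h).2
      rw [powMonoidHom_apply, ← pow_mul, mul_right_comm, ← pow_add,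
        show n i - 1 - j + j = n i - 1 by omega]
    · rw [he δ i h, mul_zero, pow_zero]; exact Subgroup.one_mem _
  have hker : ∀ δ : J → Fin p, (⟨_, hmem δ⟩ : (powMonoidHom (p ^ j) : G →* G).range) ∈
      (powMonoidHom p : (powMonoidHom (p ^ j) : G →* G).range →* _).ker := fun δ => by
    rw [MonoidHom.mem_ker, powMonoidHom_apply]
    refine Subtype.ext ?_
    change (∏ i ∈ Finset.range s, α i ^ (p ^ (n i - 1) * e δ i)) ^ p = 1
    rw [← Finset.prod_pow]
    refine Finset.prod_eq_one fun i hi => ?_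
    by_cases h : i ∈ J
    · have := (hJm.1 h).2
      rw [← pow_mul, mul_right_comm, ← pow_succ, show n i - 1 + 1 = n i by omega, pow_mul,
        ← hα.orderOf_eq (Finset.mem_range.1 hi), pow_orderOf_eq_one, one_pow]
    · rw [he δ i h, mul_zero, pow_zero, one_pow]
  have hinj : Function.Injective fun δ : J → Fin p =>
      (⟨_, hker δ⟩ : (powMonoidHom p : (powMonoidHom (p ^ j) : G →* G).range →* _).ker) := by
    intro δ δ' h
    have h1 : ∏ i ∈ Finset.range s, α i ^ (p ^ (n i - 1) * e δ i) =
        ∏ i ∈ Finset.range s, α i ^ (p ^ (n i - 1) * e δ' i) :=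
      congrArg (fun x => ((x : (powMonoidHom (p ^ j) : G →* G).range) : G)) (congrArg Subtype.val h)
    have hlt : ∀ δ : J → Fin p, ∀ i < s, p ^ (n i - 1) * e δ i < p ^ n i := fun δ i hi => by
      by_cases h : i ∈ J
      · have := (hJm.1 h).2
        calc p ^ (n i - 1) * e δ i < p ^ (n i - 1) * p :=
              Nat.mul_lt_mul_of_pos_left (hep δ i) (pow_pos hp.pos _)
          _ = p ^ n i := by rw [← pow_succ, show n i - 1 + 1 = n i by omega]
      · rw [he δ i h, mul_zero]; exact pow_pos hp.pos _
    funext ⟨i, hi⟩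
    have h2 := Nat.eq_of_mul_eq_mul_left (pow_pos hp.pos _)
      (hα.eq_of_prod_eq (hlt δ) (hlt δ') h1 (hJm.1 hi).1)
    simp only [e, dif_pos hi] at h2
    exact Fin.ext h2
  have h := (Nat.card_le_card_of_injective _ hinj).trans (card_torsion_le_pow_rank hp.pos)
  rw [Nat.card_fun, Nat.card_fin, Nat.card_eq_fintype_card, Fintype.card_coe] at h
  rw [rankAbove_eq_card]
  exact (Nat.pow_le_pow_iff_right hp.one_lt).1 h

theorem powRank_zero (G : Type*) [CommGroup G] [Finite G] (p : ℕ) :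
    powRank G p 0 = Group.rank G := by
  rw [powRank]
  have : Function.Surjective (powMonoidHom (p ^ 0) : G →* G) := fun a => ⟨a, by simp⟩
  exact Group.rank_congr ((MulEquiv.subgroupCongr (MonoidHom.range_eq_top.2 this)).trans
    Subgroup.topEquiv)

theorem IsIndependent.le_rank [Finite G] (hα : IsIndependent p s α n) (hp : p.Prime)
    (hn : ∀ i < s, 0 < n i) : s ≤ Group.rank G := by
  have h := hα.rankAbove_le hp 0
  rwa [powRank_zero, rankAbove_eq_card, Finset.filter_true_of_mem
    (fun i hi => hn i (Finset.mem_range.1 hi)), Finset.card_range] at h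

theorem rank_le_of_closure_eq_top [Finite G] (h : Subgroup.closure (α '' Set.Iio s) = ⊤) :
    Group.rank G ≤ s := by
  classical
  refine (Group.rank_le (S := (Finset.range s).image α) ?_).trans
    (Finset.card_image_le.trans (Finset.card_range s).le)
  rw [← h]; congr 1; ext; simp

theorem IsIndependent.isGroupBasis {B : List G} (hp : p.Prime)
    (hα : IsIndependent p B.length α n) (hB : ∀ i : Fin B.length, B.get i = α i)
    (h : Subgroup.closure (α '' Set.Iio B.length) = ⊤) : IsGroupBasis B.get := by
  have hprod : ∀ x : Fin B.length → ℕ, ∏ i, B.get i ^ x i =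
      ∏ i ∈ Finset.range B.length, α i ^ extendFin x i := fun x => by
    rw [Finset.prod_range]
    exact Finset.prod_congr rfl fun i _ => by rw [hB, extendFin_of_lt _ i.2]
  have hord : ∀ i : Fin B.length, orderOf (B.get i) = p ^ n i := fun i => by
    rw [hB, hα.orderOf_eq i.2]
  have hex : ∀ β : G, ∃ z : ℕ → ℤ, ∏ i ∈ Finset.range B.length, α i ^ z i = β := by
    intro β
    have hβ : β ∈ Subgroup.closure (α '' Set.Iio B.length) := h ▸ Subgroup.mem_top β
    induction hβ using Subgroup.closure_induction with
    | mem x hx =>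
      obtain ⟨i, hi, rfl⟩ := hx
      refine ⟨Pi.single i 1, ?_⟩
      rw [Finset.prod_eq_single i (fun j _ hj => by rw [Pi.single_eq_of_ne hj, zpow_zero])
        (fun h => absurd (Finset.mem_range.2 hi) h), Pi.single_eq_same, zpow_one]
    | one => exact ⟨fun _ => 0, by simp⟩
    | mul x y _ _ hx hy =>
      obtain ⟨z, rfl⟩ := hx
      obtain ⟨w, rfl⟩ := hy
      exact ⟨_, (prod_zpow_mul _ _ _ _).symm⟩
    | inv x _ hx =>
      obtain ⟨z, rfl⟩ := hx
      refine ⟨fun i => -z i, ?_⟩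
      simp only [zpow_neg, Finset.prod_inv_distrib]
  intro β
  obtain ⟨z, rfl⟩ := hex β
  have hpos : ∀ i, (0 : ℤ) < (p : ℤ) ^ n i := fun i => pow_pos (by exact_mod_cast hp.pos) _
  refine ⟨fun i => (z i % (p : ℤ) ^ n i).toNat, ⟨fun i => ?_, ?_⟩, fun y hy => ?_⟩
  · rw [hord]
    have h1 := Int.emod_nonneg (z i) (hpos i).ne'
    have h2 := Int.emod_lt_of_pos (z i) (hpos i)
    zify
    rwa [Int.toNat_of_nonneg h1]
  · beta_reduce
    rw [hprod]
    refine Finset.prod_congr rfl fun i hi => ?_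
    have hi := Finset.mem_range.1 hi
    rw [extendFin_of_lt _ hi, ← zpow_natCast, Int.toNat_of_nonneg (Int.emod_nonneg _ (hpos i).ne'),
      ← mul_inv_eq_one, ← zpow_neg, ← zpow_add, hα.zpow_eq_one_iff hi, Int.emod_def]
    exact ⟨-(z i / p ^ n i), by ring⟩
  · have h1 := hy.2
    rw [hprod] at h1
    funext i
    have hy' := hy.1 i
    rw [hord] at hy'
    have h2 := (hα fun i => (extendFin y i : ℤ) - z i).1 (by
      simp only [zpow_sub, zpow_natCast]
      rw [Finset.prod_mul_distrib, Finset.prod_inv_distrib, h1, mul_inv_cancel]) i i.2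
    rw [extendFin_of_lt _ i.2] at h2
    have h3 : ((y i : ℕ) : ℤ) = z i % (p : ℤ) ^ n i := by
      have h4 : z i % (p : ℤ) ^ n i = y i % (p : ℤ) ^ n i := Int.modEq_iff_dvd.2 h2
      rw [h4]
      exact (Int.emod_eq_of_lt (by positivity) (by exact_mod_cast hy')).symm
    rw [← h3, Int.toNat_natCast]

/-- The exponents of the orders of the elements of a family. -/
noncomputable def orderExponent {r : ℕ} (p : ℕ) (β : Fin r → G) (i : Fin r) : ℕ :=
  Nat.log p (orderOf (β i))

theorem orderOf_eq_pow_orderExponent [Finite G] (hp : p.Prime) {N : ℕ} (hN : Nat.card G = p ^ N)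
    {r : ℕ} (β : Fin r → G) (i : Fin r) : orderOf (β i) = p ^ orderExponent p β i := by
  obtain ⟨k, -, hk⟩ := (Nat.dvd_prime_pow hp).1 (hN ▸ orderOf_dvd_natCard (β i))
  rw [orderExponent, hk, Nat.log_pow hp.one_lt]

theorem IsGroupBasis.le_sum [Finite G] (hp : p.Prime) {N : ℕ} (hN : Nat.card G = p ^ N)
    {r : ℕ} {β : Fin r → G} (hβ : IsGroupBasis β) : N ≤ ∑ i, orderExponent p β i := by
  have h : Function.Surjective fun x : (i : Fin r) → Fin (orderOf (β i)) =>
      ∏ i, β i ^ (x i : ℕ) := fun a => by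
    obtain ⟨x, ⟨hx, rfl⟩, -⟩ := hβ a
    exact ⟨fun i => ⟨x i, hx i⟩, rfl⟩
  have := Nat.card_le_card_of_surjective _ h
  rw [Nat.card_pi, Finset.prod_congr rfl fun i _ => Nat.card_fin _,
    Finset.prod_congr rfl fun i _ => orderOf_eq_pow_orderExponent hp hN β i,
    Finset.prod_pow_eq_pow_sum, hN] at this
  exact (Nat.pow_le_pow_iff_right hp.one_lt).1 this

/-- The `β i ^ p ^ j` generate the group of `p ^ j`-th powers, and those with `orderExponent p β i ≤
j` are trivial. -/
theorem IsGroupBasis.powRank_le [Finite G] (hp : p.Prime) {N : ℕ} (hN : Nat.card G = p ^ N)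
    {r : ℕ} {β : Fin r → G} (hβ : IsGroupBasis β) (j : ℕ) :
    powRank G p j ≤ (Finset.univ.filter fun i => j < orderExponent p β i).card := by
  classical
  refine (Group.rank_le (S := (Finset.univ.filter fun i => j < orderExponent p β i).image
    fun i => (⟨β i ^ p ^ j, β i, rfl⟩ : (powMonoidHom (p ^ j) : G →* G).range)) ?_).trans
    Finset.card_image_le
  rw [eq_top_iff]
  rintro ⟨_, a, rfl⟩ -
  obtain ⟨x, ⟨-, rfl⟩, -⟩ := hβ a
  have e : (⟨powMonoidHom (p ^ j) (∏ i, β i ^ x i), _, rfl⟩ :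
      (powMonoidHom (p ^ j) : G →* G).range) =
      ∏ i, (⟨β i ^ p ^ j, β i, rfl⟩ : (powMonoidHom (p ^ j) : G →* G).range) ^ x i := by
    refine Subtype.ext ?_
    change (∏ i, β i ^ x i) ^ p ^ j = _
    rw [← Finset.prod_pow, Subgroup.val_finsetProd]
    exact Finset.prod_congr rfl fun i _ => pow_right_comm _ _ _
  rw [e]
  refine Subgroup.prod_mem _ fun i _ => Subgroup.pow_mem _ ?_ _
  by_cases h : j < orderExponent p β i
  · exact Subgroup.subset_closure (by simpa using ⟨i, h, rfl⟩)
  · have : β i ^ p ^ j = 1 := by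
      refine orderOf_dvd_iff_pow_eq_one.1 ?_
      rw [orderOf_eq_pow_orderExponent hp hN]
      exact pow_dvd_pow _ (by omega)
    rw [show (⟨β i ^ p ^ j, β i, rfl⟩ : (powMonoidHom (p ^ j) : G →* G).range) = 1 from
      Subtype.ext this]
    exact Subgroup.one_mem _

end Counting

/-! ### The complete algorithm. -/

/-- Compute a basis of a `p`-group from the identifiers `L` of generators, adding one generator
after the other. -/
def computeBasis (e p : ℕ) (L : List ℕ) : QueryM (List ℕ) :=
  QueryM.bind (QueryM.loop L [] fun (basis : List (ℕ × ℕ)) g =>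
    QueryM.bind (findRelation e p basis.length basis g) fun u =>
      extendBasis e p basis.length basis g u.1 u.2) fun basis => QueryM.ret (basis.map fun b => b.1)

@[fun_prop] theorem primrec_computeBasis {α : Type*} [Primcodable α] {e p : α → ℕ}
    {L r : α → List ℕ} (he : Primrec e) (hp : Primrec p) (hL : Primrec L) (hr : Primrec r) :
    Primrec fun a => computeBasis (e a) (p a) (L a) (r a) := by
  unfold computeBasis; fun_prop

/-- A bound for the cost of adding one generator `g` of order `p ^ k` to a basis of length `s`,
where `p ^ d` is the order of `g` modulo the span of the basis. -/
def stepCost (p s : ℕ) (n : ℕ → ℕ) (k d : ℕ) : ℕ :=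
  k * (2 * Nat.log 2 p) + ∑ i ∈ Finset.range s, onlineCost p (n i) +
    ∑ j ∈ Finset.range k, (rankAbove n s j + searchCost p (rankAbove n s j)) +
    3 * (Nat.log 2 p + 1) * (∑ i ∈ Finset.range s, n i + d)

/-- The situation when a generator is added to a basis. -/
structure IsStep {G : Type*} [CommGroup G] (p N m s : ℕ) (α : ℕ → G) (n : ℕ → ℕ) (k d : ℕ) :
    Prop where
  indep : IsIndependent p s α n
  pos : ∀ i < s, 0 < n i
  sum_le : ∑ i ∈ Finset.range s, n i + d ≤ N
  le : k ≤ m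

/-- A step that lengthens a family of length `s` is charged `D s`, any other step `E`. The length
grows by at most one per step and ends at the rank, so each `D s` with `s < Group.rank G` is charged
exactly once. -/
theorem spec_computeBasis {G : Type*} [CommGroup G] [Finite G] {ident : G → ℕ}
    (hident : Function.Injective ident) {p N m : ℕ} (hp : p.Prime) (hN : Nat.card G = p ^ N)
    (hm : Monoid.exponent G = p ^ m) (L : List G)
    (hL : Subgroup.closure {g | g ∈ L} = ⊤) :
    QueryM.Spec ident (computeBasis (ident 1) p (L.map ident)) fun out c => ∃ B : List G,
      out = B.map ident ∧ IsGroupBasis B.get ∧ (∀ b ∈ B, b ≠ 1) ∧ Group.rank G ≤ L.length ∧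
      ∀ (D : ℕ → ℝ) (E : ℝ),
        (∀ (α : ℕ → G) (s : ℕ) (n : ℕ → ℕ) (k d : ℕ), IsStep p N m s α n k d → s < Group.rank G →
          (stepCost p s n k d : ℝ) ≤ D s) →
        (∀ (α : ℕ → G) (s : ℕ) (n : ℕ → ℕ) (k d : ℕ), IsStep p N m s α n k d →
          (stepCost p s n k d : ℝ) ≤ E) →
        (c : ℝ) ≤ ∑ s ∈ Finset.range (Group.rank G), D s +
          ((L.length : ℝ) - Group.rank G) * E := by
  refine QueryM.Spec.bind (QueryM.Spec.loop (L.map ident) [] (fun t basis c =>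
    ∃ (s : ℕ) (α : ℕ → G) (n : ℕ → ℕ),
      basis = ((List.range s).map fun i => (ident (α i), n i)) ∧ s ≤ t ∧
      IsIndependent p s α n ∧ (∀ i < s, 0 < n i) ∧
      Subgroup.closure {g | g ∈ L.take t} ≤ Subgroup.closure (α '' Set.Iio s) ∧
      ∀ (D : ℕ → ℝ) (E : ℝ),
        (∀ (α : ℕ → G) (s : ℕ) (n : ℕ → ℕ) (k d : ℕ), IsStep p N m s α n k d → s < Group.rank G →
          (stepCost p s n k d : ℝ) ≤ D s) →
        (∀ (α : ℕ → G) (s : ℕ) (n : ℕ → ℕ) (k d : ℕ), IsStep p N m s α n k d →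
          (stepCost p s n k d : ℝ) ≤ E) →
        (c : ℝ) ≤ ∑ s ∈ Finset.range s, D s + ((t : ℝ) - s) * E) ?_ ?_) ?_
  · exact ⟨0, fun _ => 1, fun _ => 0, rfl, le_rfl, fun z => by simp, by simp, by simp, by simp⟩
  · rintro t ht basis c ⟨s, α, n, rfl, hst, hα, hn, hcl, hcost⟩
    rw [List.length_map] at ht
    rw [List.getElem_map, List.length_map, List.length_range]
    set g := L[t] with hg
    have hbasis : ∀ i < s, ((List.range s).map fun i => (ident (α i), n i)).getD i (0, 0) =
        (ident (α i), n i) := fun i hi => getD_map_range _ _ hi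
    have hgm : g ^ p ^ m = 1 := by rw [← hm, Monoid.pow_exponent_eq_one]
    refine QueryM.Spec.bind (spec_findRelation hident hp hα hn hbasis hgm) ?_
    rintro _ c₁ ⟨k, d, x, hk, hk', rfl, hrel, hc₁⟩
    refine (spec_extendBasis hp hn hbasis hrel).mono ?_
    rintro _ c₂ ⟨s', α', n', rfl, hs', hα', hn', hcl', hsum, hc₂⟩
    have hkm : k ≤ m := by
      by_contra h
      exact hk' m (by omega) hgm
    have hstep : IsStep p N m s α n k d := ⟨hα, hn, hsum ▸ hα'.sum_le hp hN, hkm⟩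
    refine ⟨s', α', n', rfl, by omega, hα', hn', ?_, fun D E hD hE => ?_⟩
    · refine (Subgroup.closure_le _).2 fun a ha => hcl' ?_
      have ha' : a ∈ L.take (t + 1) := ha
      rw [List.take_add_one, List.mem_append] at ha'
      rcases ha' with ha' | ha'
      · exact Subgroup.closure_mono (Set.subset_insert _ _) (hcl (Subgroup.subset_closure ha'))
      · rw [List.getElem?_eq_getElem ht] at ha'
        obtain rfl : a = g := by simpa using ha'
        exact Subgroup.subset_closure (Set.mem_insert _ _)
    · have h1 := hcost D E hD hE
      have h2 : ((c + (c₁ + c₂) : ℕ) : ℝ) ≤ c + stepCost p s n k d := by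
        unfold stepCost
        exact_mod_cast (by omega)
      rcases hs' with rfl | rfl
      · have h3 := hE α s' n k d hstep
        push_cast at h2 ⊢
        linarith
      · have h3 := hD α s n k d hstep (hα'.le_rank hp hn')
        rw [Finset.sum_range_succ]
        push_cast at h2 ⊢
        linarith
  · rintro basis c ⟨s, α, n, rfl, hst, hα, hn, hcl, hcost⟩
    rw [List.length_map] at *
    rw [List.take_length, hL, top_le_iff] at hcl
    have hs : Group.rank G = s := le_antisymm (rank_le_of_closure_eq_top hcl) (hα.le_rank hp hn)
    refine QueryM.Spec.ret ⟨(List.range s).map α, by simp [Function.comp_def], ?_, ?_, hs ▸ hst, ?_⟩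
    · have hlen : ((List.range s).map α).length = s := by simp
      exact IsIndependent.isGroupBasis hp (hlen.symm ▸ hα) (fun i => by simp) (hlen.symm ▸ hcl)
    · intro b hb h1
      obtain ⟨i, hi, rfl⟩ := List.mem_map.1 hb
      have hi := List.mem_range.1 hi
      have h2 := hα.orderOf_eq hi
      rw [h1, orderOf_one] at h2
      exact (Nat.one_lt_pow (hn i hi).ne' hp.one_lt).ne h2
    · rw [hs] at hcost ⊢
      simpa using hcost

/-! ### Estimates for logarithms and for the digit-by-digit powers. -/

/-- The factor in the cost of a discrete logarithm in a cyclic group of order `p ^ x`. -/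
noncomputable def logFactor (x : ℕ) : ℝ := lg (x + 1) / lg (lg (x + 2))

theorem lg_le_self {x : ℝ} (hx : 1 ≤ x) : lg x ≤ x := by
  unfold lg
  rw [Real.logb_le_iff_le_rpow (by norm_num) (by linarith)]
  have h := one_add_mul_self_le_rpow_one_add (s := (1 : ℝ)) (by norm_num) hx
  norm_num at h
  linarith

theorem lg_mono {x y : ℝ} (hx : 0 < x) (hxy : x ≤ y) : lg x ≤ lg y :=
  (Real.logb_le_logb (by norm_num) hx (hx.trans_le hxy)).2 hxy

theorem lg_nonneg {x : ℝ} (hx : 1 ≤ x) : 0 ≤ lg x := Real.logb_nonneg (by norm_num) hx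

theorem le_lg_three : 3 / 2 ≤ lg 3 := by
  unfold lg
  rw [Real.le_logb_iff_rpow_le (by norm_num) (by norm_num)]
  have h : ((2 : ℝ) ^ (3 / 2 : ℝ)) ^ 2 ≤ 3 ^ 2 := by
    rw [← Real.rpow_natCast, ← Real.rpow_mul (by norm_num)]
    norm_num
  exact le_of_sq_le_sq h (by norm_num)

theorem le_lg_add_two {x : ℕ} (hx : 1 ≤ x) : 3 / 2 ≤ lg (x + 2) := by
  have : (1 : ℝ) ≤ x := by exact_mod_cast hx
  exact le_lg_three.trans (lg_mono (by norm_num) (by linarith))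

theorem half_le_lg_lg {x : ℝ} (hx : 3 / 2 ≤ x) : 1 / 2 ≤ lg x := by
  unfold lg
  rw [Real.le_logb_iff_rpow_le (by norm_num) (by linarith)]
  refine le_trans ?_ hx
  have h : ((2 : ℝ) ^ (1 / 2 : ℝ)) ^ 2 ≤ (3 / 2) ^ 2 := by
    rw [← Real.rpow_natCast, ← Real.rpow_mul (by norm_num)]
    norm_num
  exact le_of_sq_le_sq h (by norm_num)

theorem lg_mul {x y : ℝ} (hx : 0 < x) (hy : 0 < y) : lg (x * y) = lg x + lg y :=
  Real.logb_mul hx.ne' hy.ne'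

theorem lg_pow (x : ℝ) (k : ℕ) : lg (x ^ k) = k * lg x := by
  unfold lg; exact Real.logb_pow _ _ _

theorem one_le_logFactor {x : ℕ} (hx : 1 ≤ x) : 1 ≤ logFactor x := by
  have h1 := le_lg_add_two hx
  have h2 := half_le_lg_lg h1
  unfold logFactor
  rw [le_div_iff₀ (by linarith), one_mul]
  refine lg_mono (by linarith) ?_
  have h3 : (2 : ℝ) ^ (x + 1 : ℕ) ≥ x + 2 := by
    have : x + 2 ≤ 2 ^ (x + 1) := Nat.lt_pow_self (by norm_num)
    exact_mod_cast this
  calc lg (x + 2) ≤ lg (2 ^ (x + 1 : ℕ)) := lg_mono (by positivity) h3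
    _ = x + 1 := by rw [lg_pow]; unfold lg; rw [Real.logb_self_eq_one (by norm_num)]; simp

theorem logFactor_nonneg (x : ℕ) : 0 ≤ logFactor x := by
  rcases Nat.eq_zero_or_pos x with rfl | h
  · simp [logFactor, lg]
  · exact zero_le_one.trans (one_le_logFactor h)

/-- With `X = lg (a + 2)` and `Y = lg (b + 2)`, writing `Y = X * (Y / X)` gives `lg Y ≤ lg X + Y /
X`. Since `1 / 2 ≤ lg X`, this yields `X * lg Y ≤ 3 * Y * lg X`; together with `Y ≤ 2 * lg (b + 1)`
the factor is `6`. -/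
theorem logFactor_le_of_le {a b : ℕ} (ha : 1 ≤ a) (hab : a ≤ b) :
    logFactor a ≤ 6 * logFactor b := by
  have hX := le_lg_add_two ha
  have hY := le_lg_add_two (ha.trans hab)
  have hlX := half_le_lg_lg hX
  have hlY := half_le_lg_lg hY
  have ha' : (1 : ℝ) ≤ a := by exact_mod_cast ha
  have hab' : (a : ℝ) ≤ b := by exact_mod_cast hab
  have h1 : lg ((a : ℝ) + 1) ≤ lg (a + 2) := lg_mono (by linarith) (by linarith)
  have h2 : lg ((b : ℝ) + 2) ≤ 2 * lg (b + 1) := by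
    have := lg_pow ((b : ℝ) + 1) 2
    push_cast at this
    rw [← this]
    exact lg_mono (by linarith) (by nlinarith)
  have hXY : lg ((a : ℝ) + 2) ≤ lg (b + 2) := lg_mono (by linarith) (by linarith)
  have h0 := lg_nonneg (show (1 : ℝ) ≤ a + 1 by linarith)
  unfold logFactor
  generalize lg ((a : ℝ) + 2) = X at *
  generalize lg ((b : ℝ) + 2) = Y at *
  have hX0 : 0 < X := by linarith
  have h3 : lg Y ≤ lg X + Y / X := by
    have : Y = X * (Y / X) := by field_simp
    nth_rw 1 [this]
    rw [lg_mul hX0 (div_pos (by linarith) hX0)]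
    have := lg_le_self ((one_le_div hX0).2 hXY)
    linarith
  have h4 : X * lg Y ≤ 3 * (Y * lg X) := by
    have h5 : X * lg Y ≤ X * lg X + Y := by
      have := mul_le_mul_of_nonneg_left h3 hX0.le
      rwa [mul_add, mul_div_cancel₀ _ hX0.ne'] at this
    nlinarith
  rw [← mul_div_assoc, div_le_div_iff₀ (by linarith) (by linarith)]
  have h6 : lg ((a : ℝ) + 1) * lg Y ≤ X * lg Y := mul_le_mul_of_nonneg_right h1 (by linarith)
  have h7 : Y * lg X ≤ 2 * lg ((b : ℝ) + 1) * lg X := mul_le_mul_of_nonneg_right h2 (by linarith)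
  linarith

theorem natLog_le_lg {x : ℕ} (hx : 1 ≤ x) : (Nat.log 2 x : ℝ) ≤ lg x := by
  unfold lg
  rw [Real.le_logb_iff_rpow_le (by norm_num) (by exact_mod_cast hx), Real.rpow_natCast]
  exact_mod_cast Nat.pow_log_le_self 2 (by omega)

theorem one_le_lg {p : ℕ} (hp : 2 ≤ p) : 1 ≤ lg p := by
  unfold lg
  rw [Real.le_logb_iff_rpow_le (by norm_num) (by positivity), Real.rpow_one]
  exact_mod_cast hp

/-- As `onlineWidth ℓ` is at least `lg (ℓ + 2)`, there are at most `logFactor ℓ + 1` levels. The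
constant is `36 * 2 * 3`, from `Nat.log 2 p + 1 ≤ 2 * lg p` and from `1 ≤ logFactor ℓ`. -/
theorem onlineCost_le {p ℓ : ℕ} (hp : 2 ≤ p) (hℓ : 1 ≤ ℓ) :
    (onlineCost p ℓ : ℝ) ≤ 216 * lg p * (logFactor ℓ * ℓ) := by
  have hw := onlineWidth_eq ℓ
  have h1 := le_lg_add_two hℓ
  have h2 := half_le_lg_lg h1
  have hℓ' : (1 : ℝ) ≤ ℓ := by exact_mod_cast hℓ
  have h3 : lg ((ℓ : ℝ) + 2) ≤ onlineWidth ℓ := by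
    rw [hw]
    have h4 : (ℓ : ℝ) + 2 ≤ 2 ^ (Nat.log 2 ℓ + 3) := by
      have := Nat.lt_pow_succ_log_self (b := 2) (by norm_num) ℓ
      have h5 : ℓ + 2 ≤ 2 ^ (Nat.log 2 ℓ + 3) := by
        have h6 : 2 ^ (Nat.log 2 ℓ + 3) = 4 * 2 ^ (Nat.log 2 ℓ).succ := by
          rw [Nat.succ_eq_add_one]; ring
        omega
      exact_mod_cast h5
    refine (lg_mono (by linarith) h4).trans ?_
    rw [lg_pow]; unfold lg; rw [Real.logb_self_eq_one (by norm_num)]; simp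
  have hW : (1 : ℕ) < onlineWidth ℓ := by omega
  have h8 : (Nat.clog (onlineWidth ℓ) ℓ : ℝ) ≤ logFactor ℓ + 1 := by
    have h9 : ((Nat.clog (onlineWidth ℓ) ℓ : ℕ) : ℝ) ≤ Nat.log (onlineWidth ℓ) ℓ + 1 := by
      have : Nat.clog (onlineWidth ℓ) ℓ ≤ Nat.log (onlineWidth ℓ) ℓ + 1 :=
        Nat.clog_le_of_le_pow (Nat.lt_pow_succ_log_self hW ℓ).le
      exact_mod_cast this
    refine h9.trans (by
      gcongr
      unfold logFactor
      rw [le_div_iff₀ (by linarith)]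
      calc (Nat.log (onlineWidth ℓ) ℓ : ℝ) * lg (lg (ℓ + 2))
          ≤ Nat.log (onlineWidth ℓ) ℓ * lg (onlineWidth ℓ) := by
            gcongr; exact lg_mono (by linarith) h3
        _ = lg ((onlineWidth ℓ : ℝ) ^ Nat.log (onlineWidth ℓ) ℓ) := (lg_pow _ _).symm
        _ ≤ lg (ℓ + 1) := by
            refine lg_mono (by positivity) ?_
            have := Nat.pow_log_le_self (onlineWidth ℓ) (x := ℓ) (by omega)
            have : ((onlineWidth ℓ : ℝ) ^ Nat.log (onlineWidth ℓ) ℓ) ≤ ℓ := by exact_mod_cast this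
            linarith)
  have h10 := one_le_logFactor hℓ
  have h11 := one_le_lg hp
  have h12 := natLog_le_lg (show 1 ≤ p by omega)
  unfold onlineCost
  push_cast
  calc 36 * (ℓ : ℝ) * (Nat.log 2 p + 1) * (Nat.clog (onlineWidth ℓ) ℓ + 1)
      ≤ 36 * ℓ * (2 * lg p) * (3 * logFactor ℓ) := by
        gcongr <;> linarith
    _ = 216 * lg p * (logFactor ℓ * ℓ) := by ring

/-- Comparison of two families of numbers by the number of their entries above each bound. -/
theorem sum_le_sum_of_rankAbove_le {Φ : ℕ → ℝ} (hΦ : Monotone Φ) (h0 : Φ 0 = 0) {n : ℕ → ℕ}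
    {s r : ℕ} {b : Fin r → ℕ}
    (h : ∀ j, rankAbove n s j ≤ (Finset.univ.filter fun i => j < b i).card) :
    ∑ i ∈ Finset.range s, Φ (n i) ≤ ∑ i, Φ (b i) := by
  obtain ⟨M, hM1, hM2⟩ : ∃ M, (∀ i < s, n i ≤ M) ∧ ∀ i, b i ≤ M :=
    ⟨(∑ i ∈ Finset.range s, n i) + ∑ i, b i,
      fun i hi => le_add_right (Finset.single_le_sum_of_canonicallyOrdered
        (Finset.mem_range.2 hi)),
      fun i => le_add_left (Finset.single_le_sum_of_canonicallyOrdered (Finset.mem_univ i))⟩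
  -- Telescoping writes `Φ x` as a sum over the levels `j < x`. After exchanging sums, only the
  -- numbers of entries above each level matter.
  have key : ∀ x ≤ M, Φ x =
      ∑ j ∈ Finset.range M, if j < x then Φ (j + 1) - Φ j else 0 := by
    intro x hx
    rw [← Finset.sum_filter]
    have : (Finset.range M).filter (fun j => j < x) = Finset.range x := by
      ext j; simp only [Finset.mem_filter, Finset.mem_range]; omega
    rw [this, Finset.sum_range_sub, h0, sub_zero]
  rw [Finset.sum_congr rfl fun i hi => key _ (hM1 i (Finset.mem_range.1 hi)),
    Finset.sum_congr rfl fun i _ => key _ (hM2 i), Finset.sum_comm (s := Finset.range s),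
    Finset.sum_comm (s := Finset.univ)]
  refine Finset.sum_le_sum fun j _ => ?_
  rw [← Finset.sum_filter, ← Finset.sum_filter, Finset.sum_const, Finset.sum_const,
    nsmul_eq_mul, nsmul_eq_mul]
  refine mul_le_mul_of_nonneg_right ?_ (sub_nonneg.2 (hΦ (Nat.le_succ j)))
  have := h j
  rw [rankAbove_eq_card] at this
  exact_mod_cast this

/-- The comparison needs a monotone function, so the running maximum replaces `logFactor x * x`; by
`logFactor_le_of_le` this costs a factor `6`. -/
theorem sum_logFactor_le {n : ℕ → ℕ} {s r : ℕ} {b : Fin r → ℕ}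
    (h : ∀ j, rankAbove n s j ≤ (Finset.univ.filter fun i => j < b i).card) :
    ∑ i ∈ Finset.range s, logFactor (n i) * n i ≤ 6 * ∑ i, logFactor (b i) * b i := by
  let F : ℕ → ℝ := fun x => logFactor x * x
  have hF : ∀ x, partialSups F x ≤ 6 * F x := fun x => by
    refine partialSups_le _ _ _ fun a ha => ?_
    rcases Nat.eq_zero_or_pos a with rfl | ha'
    · have := logFactor_nonneg x
      simp only [F]
      push_cast
      nlinarith [Nat.cast_nonneg (α := ℝ) x, mul_nonneg this (Nat.cast_nonneg (α := ℝ) x)]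
    · have h1 := logFactor_le_of_le ha' ha
      have h2 : (a : ℝ) ≤ x := by exact_mod_cast ha
      have h3 := logFactor_nonneg x
      calc logFactor a * a ≤ 6 * logFactor x * x := by gcongr
        _ = 6 * F x := by ring
  calc ∑ i ∈ Finset.range s, F (n i) ≤ ∑ i ∈ Finset.range s, partialSups F (n i) :=
        Finset.sum_le_sum fun i _ => le_partialSups F _
    _ ≤ ∑ i, partialSups F (b i) := sum_le_sum_of_rankAbove_le (partialSups F).monotone
        (by simp [F]) h
    _ ≤ ∑ i, 6 * F (b i) := Finset.sum_le_sum fun i _ => hF _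
    _ = 6 * ∑ i, F (b i) := (Finset.mul_sum _ _ _).symm

/-! ### Estimates for powers of the square root of `p`. -/

section Sqrt

variable {p : ℕ}

theorem rpow_half (p r : ℕ) : (p : ℝ) ^ ((r : ℝ) / 2) = √(p : ℝ) ^ r := by
  rw [Real.sqrt_eq_rpow, ← Real.rpow_mul_natCast (Nat.cast_nonneg _)]
  congr 1; ring

theorem le_sqrt_of_two_le (hp : 2 ≤ p) : 1.414 ≤ √(p : ℝ) := by
  refine Real.le_sqrt_of_sq_le ?_
  have : (2 : ℝ) ≤ p := by exact_mod_cast hp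
  norm_num
  linarith

theorem searchCost_le (hp : 2 ≤ p) (r : ℕ) : (searchCost p r : ℝ) ≤ 10 * √(p : ℝ) ^ r := by
  have hq := le_sqrt_of_two_le hp
  have hsq : (p : ℝ) = √(p : ℝ) ^ 2 := (Real.sq_sqrt (Nat.cast_nonneg _)).symm
  unfold searchCost
  rcases Nat.eq_zero_or_pos r with rfl | h
  · simp
  rw [if_neg (by omega)]
  rcases Nat.mod_two_eq_zero_or_one r with h | h
  · rw [if_neg (by omega)]
    push_cast
    nth_rw 1 [hsq]
    rw [← pow_mul, show 2 * (r / 2) = r by omega, mul_one]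
    have : 0 ≤ √(p : ℝ) ^ r := by positivity
    linarith
  · rw [if_pos h]
    push_cast
    nth_rw 1 [hsq]
    have h1 : √(p : ℝ) ^ r = (√(p : ℝ) ^ 2) ^ (r / 2) * √(p : ℝ) := by
      rw [← pow_mul, ← pow_succ, show 2 * (r / 2) + 1 = r by omega]
    have h2 : (p.sqrt : ℝ) ≤ √(p : ℝ) := Real.nat_sqrt_le_real_sqrt
    have h3 : 0 ≤ (√(p : ℝ) ^ 2) ^ (r / 2) := by positivity
    rw [h1]
    nlinarith

theorem natCast_le_three_mul_pow_sqrt (hp : 2 ≤ p) (r : ℕ) : (r : ℝ) ≤ 3 * √(p : ℝ) ^ r := by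
  have hq := le_sqrt_of_two_le hp
  have h := one_add_mul_le_pow (a := (0.414 : ℝ)) (by norm_num) r
  have h2 : (1 + 0.414 : ℝ) ^ r ≤ √(p : ℝ) ^ r := by
    refine pow_le_pow_left₀ (by norm_num) ?_ r
    linarith
  nlinarith [Nat.cast_nonneg (α := ℝ) r]

theorem rankAbove_add_searchCost_le (hp : 2 ≤ p) (r : ℕ) :
    ((r + searchCost p r : ℕ) : ℝ) ≤ 13 * √(p : ℝ) ^ r := by
  have h1 := searchCost_le hp r
  have h2 := natCast_le_three_mul_pow_sqrt hp r
  push_cast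
  linarith

/-- Up to a factor `3`, `√p ^ ρ / ρ` increases with `ρ`. This trades the search cost at a position
for `ρ` itself, and the sum of the `ρ` over all positions is small (`sum_rankAbove_le`). -/
theorem pow_sqrt_le (hp : 2 ≤ p) {ρ s : ℕ} (hρ : 1 ≤ ρ) (hs : ρ ≤ s) :
    √(p : ℝ) ^ ρ ≤ 3 * ρ * (√(p : ℝ) ^ s / s) := by
  obtain ⟨t, rfl⟩ := Nat.exists_eq_add_of_le hs
  have hq := le_sqrt_of_two_le hp
  have h := one_add_mul_le_pow (a := (0.414 : ℝ)) (by norm_num) t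
  have h2 : (1 + 0.414 : ℝ) ^ t ≤ √(p : ℝ) ^ t := by
    refine pow_le_pow_left₀ (by norm_num) ?_ t
    linarith
  have hρ' : (1 : ℝ) ≤ ρ := by exact_mod_cast hρ
  have ht : (0 : ℝ) ≤ t := Nat.cast_nonneg t
  have h3 : (ρ : ℝ) + t ≤ 3 * ρ * √(p : ℝ) ^ t := by nlinarith
  have h4 : 0 < √(p : ℝ) ^ ρ := by positivity
  rw [← mul_div_assoc, le_div_iff₀ (by push_cast; linarith), pow_add]
  push_cast
  nlinarith

theorem sum_pow_sqrt_div_le (hp : 2 ≤ p) (r : ℕ) :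
    ∑ s ∈ Finset.range r, √(p : ℝ) ^ s / s ≤ 40 * (√(p : ℝ) ^ (r - 1) / r) := by
  have hq := le_sqrt_of_two_le hp
  generalize √(p : ℝ) = q at *
  -- For `q` near `√2` the induction step fails below length `3`, so shorter sums are treated
  -- separately. The term for `s = 0` is `0`, as a quotient by zero.
  have key : ∀ r : ℕ, ∑ s ∈ Finset.range (r + 3), q ^ s / s ≤ 40 * (q ^ (r + 2) / (r + 3)) := by
    intro r
    induction r with
    | zero =>
      simp only [Finset.sum_range_succ, Finset.sum_range_zero]
      norm_num
      nlinarith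
    | succ r ih =>
      rw [show r + 1 + 3 = (r + 3) + 1 by ring, Finset.sum_range_succ]
      have hr : (0 : ℝ) ≤ r := Nat.cast_nonneg r
      have h1 : 40 * (q ^ (r + 2) / (r + 3)) + q ^ (r + 3) / (r + 3) ≤
          40 * (q ^ (r + 3) / (r + 4)) := by
        rw [← mul_div_assoc, ← mul_div_assoc, ← add_div, div_le_div_iff₀ (by linarith)
          (by linarith), pow_succ q (r + 2)]
        have h2 : 0 < q ^ (r + 2) := pow_pos (by linarith) _
        have h3 : 0 ≤ q * (40 * (r + 3) - (r + 4)) - 40 * (r + 4) := by nlinarith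
        nlinarith
      have h4 : ((r + 3 : ℕ) : ℝ) = r + 3 := by push_cast; ring
      have h5 : ((r + 1 : ℕ) : ℝ) + 3 = r + 4 := by push_cast; ring
      rw [h4, h5, show r + 1 + 2 = r + 3 by ring]
      linarith
  rcases r with _ | _ | _ | r
  · simp
  · simp
  · simp only [Finset.sum_range_succ, Finset.sum_range_zero]
    norm_num
    linarith
  · rw [show ((r + 1 + 1 + 1 : ℕ) : ℝ) = r + 3 by push_cast; ring]
    exact key r

end Sqrt

/-! ### The cost of adding one generator. -/

section Bounds

variable {G : Type*} [CommGroup G] {p N m s : ℕ} {α : ℕ → G} {n : ℕ → ℕ} {k d : ℕ}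

theorem exponent_le_of_card_eq (hp : p.Prime) (hN : Nat.card G = p ^ N)
    (hm : Monoid.exponent G = p ^ m) : m ≤ N := by
  have h := Group.exponent_dvd_nat_card (G := G)
  rw [hN, hm] at h
  exact (Nat.pow_dvd_pow_iff_le_right hp.one_lt).1 h

theorem sum_rankAbove_le (n : ℕ → ℕ) (s k : ℕ) :
    ∑ j ∈ Finset.range k, rankAbove n s j ≤ ∑ i ∈ Finset.range s, n i := by
  unfold rankAbove
  rw [Finset.sum_comm]
  refine Finset.sum_le_sum fun i _ => ?_
  rw [← Finset.sum_filter, Finset.sum_const, smul_eq_mul, mul_one]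
  refine (Finset.card_le_card fun j hj => ?_).trans (Finset.card_range (n i)).le
  exact Finset.mem_range.2 (Finset.mem_filter.1 hj).2

theorem TDL_eq [Finite G] (hp : p.Prime) (hN : Nat.card G = p ^ N) {r : ℕ} (β : Fin r → G) :
    TDL p m β = lg p * ∑ i, logFactor (orderExponent p β i) * orderExponent p β i +
      ∑ j ∈ Finset.range m, √(p : ℝ) ^ powRank G p j := by
  unfold TDL
  congr 1
  · rw [Finset.mul_sum]
    refine Finset.sum_congr rfl fun i _ => ?_
    change logFactor (orderExponent p β i) * _ = _
    rw [orderOf_eq_pow_orderExponent hp hN β i]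
    push_cast
    rw [lg_pow]
    ring
  · exact Finset.sum_congr rfl fun j _ => rpow_half _ _

theorem TDL_nonneg [Finite G] (hp : p.Prime) (hN : Nat.card G = p ^ N) {r : ℕ} (β : Fin r → G) :
    0 ≤ TDL p m β := by
  have h := one_le_lg hp.two_le
  rw [TDL_eq hp hN]
  refine add_nonneg (mul_nonneg (by linarith) (Finset.sum_nonneg fun i _ =>
    mul_nonneg (logFactor_nonneg _) (Nat.cast_nonneg _))) (Finset.sum_nonneg fun j _ => ?_)
  positivity

/-- The part of `stepCost` that does not come from the online algorithm and the searches. -/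
theorem IsStep.linear_le (h : IsStep p N m s α n k d) (hp : p.Prime) (hmN : m ≤ N) :
    ((k * (2 * Nat.log 2 p) + 3 * (Nat.log 2 p + 1) * (∑ i ∈ Finset.range s, n i + d) : ℕ) : ℝ) ≤
      8 * (lg p * N) := by
  have h1 := one_le_lg hp.two_le
  have h2 := natLog_le_lg hp.one_lt.le
  have h3 : (k : ℝ) ≤ N := by exact_mod_cast h.le.trans hmN
  have h4 : ((∑ i ∈ Finset.range s, n i + d : ℕ) : ℝ) ≤ N := by exact_mod_cast h.sum_le
  rw [Nat.cast_add, Nat.cast_mul, Nat.cast_mul (3 * _)]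
  push_cast at h4 ⊢
  calc (k : ℝ) * (2 * Nat.log 2 p) + 3 * (Nat.log 2 p + 1) * (∑ i ∈ Finset.range s, (n i : ℝ) + d)
      ≤ N * (2 * lg p) + 3 * (lg p + lg p) * N := by gcongr
    _ = 8 * (lg p * N) := by ring

theorem IsStep.online_le (h : IsStep p N m s α n k d) (hp : p.Prime) :
    ((∑ i ∈ Finset.range s, onlineCost p (n i) : ℕ) : ℝ) ≤
      216 * lg p * ∑ i ∈ Finset.range s, logFactor (n i) * n i := by
  push_cast
  rw [Finset.mul_sum]
  exact Finset.sum_le_sum fun i hi => onlineCost_le hp.two_le (h.pos i (Finset.mem_range.1 hi))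

/-- The constant is `216 * 6 + 8`: the digit-by-digit powers, compared with the basis `β` level by
level, and the linear part, which is absorbed because nonzero exponents have log factor at least
`1`. The searches need only `13`, as the number of generators at position `j` is at most `powRank G
p j`. -/
theorem IsStep.stepCost_le_TDL [Finite G] (h : IsStep p N m s α n k d) (hp : p.Prime)
    (hN : Nat.card G = p ^ N) (hmN : m ≤ N) {r : ℕ} {β : Fin r → G} (hβ : IsGroupBasis β) :
    (stepCost p s n k d : ℝ) ≤ 1304 * TDL p m β := by
  have h1 := h.linear_le hp hmN
  have h2 := h.online_le hp
  have h3 := sum_logFactor_le fun j =>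
    (h.indep.rankAbove_le hp j).trans (hβ.powRank_le hp hN j)
  have hlg := one_le_lg hp.two_le
  have hq := le_sqrt_of_two_le hp.two_le
  have h4 : (N : ℝ) ≤ ∑ i, logFactor (orderExponent p β i) * orderExponent p β i := by
    have h5 : (N : ℝ) ≤ ∑ i, (orderExponent p β i : ℝ) := by exact_mod_cast hβ.le_sum hp hN
    refine h5.trans (Finset.sum_le_sum fun i _ => ?_)
    rcases Nat.eq_zero_or_pos (orderExponent p β i) with h0 | h0
    · simp [h0]
    · exact le_mul_of_one_le_left (Nat.cast_nonneg _) (one_le_logFactor h0)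
  have h5 : ((∑ j ∈ Finset.range k, (rankAbove n s j + searchCost p (rankAbove n s j)) : ℕ) : ℝ) ≤
      13 * ∑ j ∈ Finset.range m, √(p : ℝ) ^ powRank G p j := by
    rw [Nat.cast_sum, Finset.mul_sum]
    refine (Finset.sum_le_sum fun j _ => ?_).trans (Finset.sum_le_sum_of_subset_of_nonneg
      (Finset.range_subset_range.2 h.le) fun j _ _ => by positivity)
    refine (rankAbove_add_searchCost_le hp.two_le _).trans ?_
    gcongr
    · linarith
    · exact h.indep.rankAbove_le hp j
  have h6 : 0 ≤ ∑ j ∈ Finset.range m, √(p : ℝ) ^ powRank G p j :=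
    Finset.sum_nonneg fun j _ => by positivity
  have h7 := mul_le_mul_of_nonneg_left h3 (show 0 ≤ 216 * lg p by linarith)
  have h8 := mul_le_mul_of_nonneg_left h4 (show 0 ≤ 8 * lg p by linarith)
  rw [TDL_eq hp hN]
  unfold stepCost
  push_cast at h1 h2 h5 ⊢
  linarith

/-- All `n i` are at most `m`, which bounds the log factors by `6 * logFactor m`. The searches
contribute `13 * 3 = 39` times `√p ^ s / s` times the sum of `rankAbove n s j` over the positions,
and that sum is at most `N`. -/
theorem IsStep.stepCost_le_of_lt_rank [Finite G] (h : IsStep p N m s α n k d) (hp : p.Prime)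
    (hN : Nat.card G = p ^ N) (hm : Monoid.exponent G = p ^ m) (hs : s < Group.rank G) :
    (stepCost p s n k d : ℝ) ≤
      1304 * (logFactor m * lg (Nat.card G)) + 39 * N * (√(p : ℝ) ^ s / s) := by
  have hmN := exponent_le_of_card_eq hp hN hm
  have h1 := h.linear_le hp hmN
  have h2 := h.online_le hp
  have hlg := one_le_lg hp.two_le
  have hq := le_sqrt_of_two_le hp.two_le
  have hm1 : 1 ≤ m := by
    by_contra h0
    rw [show m = 0 by omega, pow_zero, Monoid.exp_eq_one_iff] at hm
    have := Group.rank_eq_zero G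
    omega
  have hsum : ∑ i ∈ Finset.range s, n i ≤ N := (Nat.le_add_right _ _).trans h.sum_le
  have h3 : ∑ i ∈ Finset.range s, logFactor (n i) * n i ≤ 6 * logFactor m * N := by
    calc ∑ i ∈ Finset.range s, logFactor (n i) * n i
        ≤ ∑ i ∈ Finset.range s, 6 * logFactor m * n i := by
          refine Finset.sum_le_sum fun i hi => mul_le_mul_of_nonneg_right ?_ (Nat.cast_nonneg _)
          have hi := Finset.mem_range.1 hi
          refine logFactor_le_of_le (h.pos i hi) ?_
          have := Monoid.order_dvd_exponent (α i)
          rw [hm, h.indep.orderOf_eq hi] at this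
          exact (Nat.pow_dvd_pow_iff_le_right hp.one_lt).1 this
      _ = 6 * logFactor m * (∑ i ∈ Finset.range s, n i : ℕ) := by
          rw [← Finset.mul_sum]; push_cast; rfl
      _ ≤ 6 * logFactor m * N := by
          have := logFactor_nonneg m
          gcongr
  have h5 : ((∑ j ∈ Finset.range k, (rankAbove n s j + searchCost p (rankAbove n s j)) : ℕ) : ℝ) ≤
      39 * N * (√(p : ℝ) ^ s / s) := by
    calc ((∑ j ∈ Finset.range k, (rankAbove n s j + searchCost p (rankAbove n s j)) : ℕ) : ℝ)
        ≤ ∑ j ∈ Finset.range k, 39 * (√(p : ℝ) ^ s / s) * rankAbove n s j := by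
          rw [Nat.cast_sum]
          refine Finset.sum_le_sum fun j _ => ?_
          have hρs : rankAbove n s j ≤ s := by
            rw [rankAbove_eq_card]
            exact (Finset.card_filter_le _ _).trans (Finset.card_range s).le
          rcases Nat.eq_zero_or_pos (rankAbove n s j) with h0 | h0
          · simp [h0, searchCost]
          · refine (rankAbove_add_searchCost_le hp.two_le _).trans ?_
            have := pow_sqrt_le hp.two_le h0 hρs
            linarith
      _ = 39 * (√(p : ℝ) ^ s / s) * (∑ j ∈ Finset.range k, rankAbove n s j : ℕ) := by
          rw [← Finset.mul_sum]; push_cast; rfl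
      _ ≤ 39 * (√(p : ℝ) ^ s / s) * N := by
          gcongr
          exact (sum_rankAbove_le n s k).trans hsum
      _ = 39 * N * (√(p : ℝ) ^ s / s) := by ring
  have h6 : lg (Nat.card G) = lg p * N := by rw [hN]; push_cast; rw [lg_pow]; ring
  have h7 := mul_le_mul_of_nonneg_left h3 (show 0 ≤ 216 * lg p by linarith)
  have h8 := mul_le_mul_of_nonneg_right (one_le_logFactor hm1)
    (show 0 ≤ 8 * (lg p * N) by positivity)
  rw [h6]
  unfold stepCost
  push_cast at h1 h2 h5 ⊢
  linarith

end Bounds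

theorem proposition2 :
    ∃ (A : GenericAlgorithm) (c : ℝ),
      ∀ (p n m r : ℕ) (G : Type*) [CommGroup G] [Finite G] (S : Finset G),
        p.Prime → Nat.card G = p ^ n → Monoid.exponent G = p ^ m → Group.rank G = r →
        Subgroup.closure (S : Set G) = ⊤ →
        ∀ L : List G, L.Nodup → (∀ g, g ∈ L ↔ g ∈ S) →
        ∀ ident : G → ℕ, Function.Injective ident →
          ∃ (B : List G) (T : ℕ),
            A.Runs ident (A.start (p, ident 1, L.map ident)) T (B.map ident) ∧
            IsGroupBasis B.get ∧ (∀ b ∈ B, b ≠ 1) ∧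
            ∀ α : Fin r → G, IsGroupBasis α →
              (T : ℝ) ≤ c * (r * lg (m + 1) / lg (lg (m + 2)) * lg (Nat.card G) +
                (n : ℝ) / r * (p : ℝ) ^ (((r : ℝ) - 1) / 2) +
                ((S.card : ℝ) - r) * TDL p m α) := by
  -- The constant is `39 * 40`, from `IsStep.stepCost_le_of_lt_rank` and `sum_pow_sqrt_div_le`; the
  -- other two terms need only `1304`.
  refine ⟨GenericAlgorithm.ofQueryM (fun x => computeBasis x.2.1 x.1 x.2.2) (by fun_prop), 1560, ?_⟩
  intro p n m r G _ _ S hp hn hm hr hS L hL hLS ident hident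
  have hmem : {g | g ∈ L} = (S : Set G) := Set.ext hLS
  obtain ⟨ans, _, hrun, B, rfl, hB, hB1, hle, hcost⟩ :=
    spec_computeBasis hident hp hn hm L (hmem ▸ hS)
  refine ⟨B, ans.length, GenericAlgorithm.runs_ofQueryM hrun, hB, hB1, fun α hα => ?_⟩
  have hcard : L.length = S.card := by
    classical
    rw [← List.toFinset_card_of_nodup hL]
    congr 1
    ext g
    rw [List.mem_toFinset, hLS]
  rw [hr] at hle hcost
  have h1 := hcost
    (fun s => 1304 * (logFactor m * lg (Nat.card G)) + 39 * n * (√(p : ℝ) ^ s / s))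
    (1304 * TDL p m α) (fun _ _ _ _ _ h hs => h.stepCost_le_of_lt_rank hp hn hm (hr ▸ hs))
    (fun _ _ _ _ _ h => h.stepCost_le_TDL hp hn (exponent_le_of_card_eq hp hn hm) hα)
  rw [Finset.sum_add_distrib, Finset.sum_const, Finset.card_range, nsmul_eq_mul, ← Finset.mul_sum,
    hcard] at h1
  have h2 := mul_le_mul_of_nonneg_left (sum_pow_sqrt_div_le hp.two_le r)
    (show (0 : ℝ) ≤ 39 * n by positivity)
  -- For `r = 0` both sides vanish because of the division by `0`, so the truncated `r - 1` does no
  -- harm.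
  have h3 : (n : ℝ) * (√(p : ℝ) ^ (r - 1) / r) =
      (n : ℝ) / r * (p : ℝ) ^ (((r : ℝ) - 1) / 2) := by
    rcases Nat.eq_zero_or_pos r with rfl | h
    · simp
    · rw [← rpow_half, Nat.cast_pred h]; ring
  have h4 : (r : ℝ) * (logFactor m * lg (Nat.card G)) =
      r * lg (m + 1) / lg (lg (m + 2)) * lg (Nat.card G) := by
    unfold logFactor; ring
  have h5 : 0 ≤ (r : ℝ) * (logFactor m * lg (Nat.card G)) :=
    mul_nonneg (Nat.cast_nonneg _) (mul_nonneg (logFactor_nonneg m)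
      (lg_nonneg (by exact_mod_cast Nat.card_pos)))
  have h6 : 0 ≤ ((S.card : ℝ) - r) * TDL p m α :=
    mul_nonneg (sub_nonneg.2 (by exact_mod_cast hcard ▸ hle)) (TDL_nonneg hp hn α)
  rw [← h4, ← h3]
  linarith
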